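/- **Setting.** Write $\ell(u)=\ln(1+e^u)$. Let $\bar n>0$ and let the parameters satisfy $0<\alpha<\tfrac16$, $c_0>0$, $\mu<\tfrac12-\tfrac38\alpha$, $\alpha<\mu c_0<\tfrac14$, $a\ge 9$, $0<\gamma_0\le\tfrac18$, $\mu'>\mu$, $\varepsilon_0>0$; put $a_1=a/c_0$. Let $b_0'>0$ and $m_0'>\max(b_0',2a_1)$ be cut-off parameters. Let $\nu(dw)=e^{-w}\ell(w)^{5/2}\,dw$ on $\mathbb R$, and let $X$ be the space of continuous $h:\mathbb R\to\mathbb C$ with $$\|h\|_X=\sup_{v}\frac{|h(v)|}{\tilde\Gamma(v)}<\infty,\qquad \tilde\Gamma(v)=\max\big(\ell(v)^{-\alpha},(\ln 2)^{-\alpha}\big)\,e^{\mu\max(a,c_0v)} .$$ *Kernels.* Let $\varepsilon(x)=\varepsilon_0\exp\!\big(-\tfrac{\mu'}{\gamma_0}\max(a_1,x)\big)$ and $$\rho(v,w)=\frac{1-e^{-\min(\varepsilon(\max(v,w)),|v-w|)}}{1-e^{-\varepsilon(\max(v,w))}} .$$ For $w<v$ put $$K^2(v,w)=4\bar n\,\ell(v)^{-3/2}\ell(w)\frac{e^w+2e^{-(v-w)}}{1+e^w+e^{-(v-w)}},\qquad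 K^1(v,w)=K^2(v,w)\frac{e^{-(v-w)}}{1-e^{-(v-w)}},\qquad K=K^1+K^2,$$ and for $w>v$ put $$K(v,w)=4\bar n\,\ell(v)^{-3/2}\ell(w)\frac{e^v+2e^{-(w-v)}}{1+e^v+e^{-(w-v)}}\,\frac{e^{-(w-v)}}{1-e^{-(w-v)}} .$$ Write $K^{\varepsilon}=\rho K$ and $K^{i,\varepsilon}=\rho K^i$ for $i=1,2$. The symmetric kernel $\overline K^\varepsilon(v,w)$ is defined for $v\neq w$ by $$\overline K^{\varepsilon}(v,w)=4\bar n\,[\ell(v)\ell(w)]^{-3/2}\,\frac{e^{-|v-w|}}{1+e^{-\min(v,w)}+e^{-\max(v,w)}}\;\frac{2+e^{\max(v,w)}}{1-e^{-|v-w|}}\;\rho(v,w),$$ so that $K^\varepsilon(v,w)\,dw=\overline K^\varepsilon(v,w)\,\nu(dw)$. *Operators.* Let $V^\varepsilon(v)=\int_0^\infty K^\varepsilon(v,v-r)\,dr+\int_0^\infty K^\varepsilon(v,v+r)\,dr$. With $r_0=-v-b_0'$, let $$\begin{aligned} (K_u^\varepsilon\psi)(v)=\ &\mathbb 1(v<-b_0')\Big[\int_0^{r_0}K^{1,\varepsilon}(v,v-r)\psi(v-r)dr+\int_{r_0}^\infty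 K^{1,\varepsilon}(v,v-r)e^{-r}\psi(v-r)dr\\ &\quad+\int_0^{r_0}K^{\varepsilon}(v,v+r)\psi(v+r)dr+\int_{r_0}^\infty K^{\varepsilon}(v,v+r)e^{-r}\psi(v+r)dr\Big]\\ &+\mathbb 1(-b_0'\le v\le m_0')\int_0^\infty \big[K^{1,\varepsilon}(v,v-r)\psi(v-r)+K^{\varepsilon}(v,v+r)\psi(v+r)\big]e^{-r}dr\\ &+\mathbb 1(v>m_0')\Big[\int_0^vK^{1,\varepsilon}(v,v-r)\psi(v-r)dr+\int_0^\infty K^\varepsilon(v,v+r)\psi(v+r)dr\Big]\\ &+\mathbb 1(v<-m_0')\int_0^{r_0}K^{2,\varepsilon}(v,v-r)\psi(v-r)dr+\mathbb 1(v>m_0')\int_0^{v-a_1}K^{2,\varepsilon}(v,v-r)\psi(v-r)dr, \end{aligned}$$ $$\begin{aligned} (K_b^\varepsilon\psi)(v)=\ &\mathbb 1(v<-b_0')\int_{r_0}^\infty\big[K^{1,\varepsilon}(v,v-r)\psi(v-r)+K^\varepsilon(v,v+r)\psi(v+r)\big](1-e^{-r})dr\\ &+\mathbb 1(-b_0'\le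 v\le m_0')\int_0^\infty\big[K^{1,\varepsilon}(v,v-r)\psi(v-r)+K^\varepsilon(v,v+r)\psi(v+r)\big](1-e^{-r})dr\\ &+\mathbb 1(v>m_0')\int_v^\infty K^{1,\varepsilon}(v,v-r)\psi(v-r)dr+\mathbb 1(v<-m_0')\int_{r_0}^\infty K^{2,\varepsilon}(v,v-r)\psi(v-r)dr\\ &+\mathbb 1(|v|\le m_0')\int_0^\infty K^{2,\varepsilon}(v,v-r)\psi(v-r)dr+\mathbb 1(v>m_0')\int_{v-a_1}^\infty K^{2,\varepsilon}(v,v-r)\psi(v-r)dr . \end{aligned}$$ *The $L^2$ operator.* Let $\tilde Q_\varepsilon(\phi,\psi)=\tfrac12\iint\overline K^\varepsilon(u,v)\,(\phi(u)-\phi(v))^*(\psi(u)-\psi(v))\,\nu(du)\nu(dv)$ with form domain $D=\{\psi\in L^2(\nu):\tilde Q_\varepsilon(\psi,\psi)<\infty\}$. Let $L_3^\varepsilon$ be the associated (Friedrichs) operator: $\psi\in D(L_3^\varepsilon)$ and $L_3^\varepsilon\psi=\eta\in L^2(\nu)$ iff $\psi\in D$ and $(\phi,\eta)=\tilde Q_\varepsilon(\phi,\psi)$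 for all $\phi\in D$. **Theorem.** Let $\psi_0^\varepsilon\in X$. There is a family $(\psi^\varepsilon_t)_{t\ge0}$ in $X$ with $\sup_{t\ge0}\|\psi_t^\varepsilon\|_X<\infty$ such that, for all $t\ge0$ and all $v\in\mathbb R$ (with absolutely convergent time integrals), $$\psi_t^\varepsilon(v)=e^{-tV^\varepsilon(v)}\psi_0^\varepsilon(v)+\int_0^te^{-(t-s)V^\varepsilon(v)}(K_u^\varepsilon\psi_s^\varepsilon)(v)\,ds+\int_0^te^{-(t-s)V^\varepsilon(v)}(K_b^\varepsilon\psi_s^\varepsilon)(v)\,ds ,$$ and it is the only such family. Moreover $\psi_0^\varepsilon\in L^2(\nu)$, the operator $-L_3^\varepsilon$ generates a strongly continuous contraction semigroup $(e^{-tL_3^\varepsilon})_{t\ge0}$ on $L^2(\nu)$, and $\psi^\varepsilon_t=e^{-tL_3^\varepsilon}\psi^\varepsilon_0$ $\nu$-almost everywhere for every $t\ge 0$. -/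

import Mathlib

open MeasureTheory Set Filter Topology
open scoped ENNReal

noncomputable section

namespace RegularizedBose

/-- All numerical parameters: the condensate density `nbar`, the parameters `α, μ, c₀, a` of the
weight functions, the parameters `μ', γ₀, ε₀` of the regularization, and the two cut-offs
`b, m` used to split the integral operator. -/
structure Params where
  nbar : ℝ
  α : ℝ
  μ : ℝ
  c₀ : ℝ
  a : ℝ
  γ₀ : ℝ
  μ' : ℝ
  ε₀ : ℝ
  b : ℝ
  m : ℝ

namespace Params

/-- The point `a₁ = a / c₀`. -/
def a₁ (p : Params) : ℝ := p.a / p.c₀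

/-- The admissible ranges of the parameters. -/
structure Admissible (p : Params) : Prop where
  nbar_pos : 0 < p.nbar
  α_pos : 0 < p.α
  α_lt : p.α < 1 / 6
  c₀_pos : 0 < p.c₀
  μ_lt : p.μ < 1 / 2 - 3 / 8 * p.α
  lt_μc₀ : p.α < p.μ * p.c₀
  μc₀_lt : p.μ * p.c₀ < 1 / 4
  a_ge : 9 ≤ p.a
  γ₀_pos : 0 < p.γ₀
  γ₀_le : p.γ₀ ≤ 1 / 8
  μ_lt_μ' : p.μ < p.μ'
  ε₀_pos : 0 < p.ε₀
  b_pos : 0 < p.b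
  b_lt_m : p.b < p.m
  a₁_lt_m : 2 * p.a₁ < p.m

/-! ### The weight `ν` and the kernels -/

/-- `ln (1 + e^u)`. -/
def lg (u : ℝ) : ℝ := Real.log (1 + Real.exp u)

/-- The measure `ν(dw) = e^{-w} (ln (1 + e^w))^{5/2} dw` on `ℝ`. -/
def nu : Measure ℝ :=
  volume.withDensity fun w => ENNReal.ofReal (Real.exp (-w) * lg w ^ (5 / 2 : ℝ))

/-- The symmetric kernel with respect to `ν` (the value on the diagonal is irrelevant). -/
def kernelBar (p : Params) (u v : ℝ) : ℝ :=
  4 * p.nbar * (lg u * lg v) ^ (-(3 / 2) : ℝ)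
    * (Real.exp (-|u - v|) / (1 + Real.exp (-min u v) + Real.exp (-max u v)))
    * ((2 + Real.exp (max u v)) / (1 - Real.exp (-|u - v|)))

/-- The regularization length `ε(x) = ε₀ exp (-(μ'/γ₀) max (a₁, x))`. -/
def eps (p : Params) (x : ℝ) : ℝ :=
  p.ε₀ * Real.exp (-(p.μ' / p.γ₀) * max p.a₁ x)

/-- The regularizing factor
`(1 - e^{-min(ε, |u-v|)}) / (1 - e^{-ε})` with `ε = ε(max(u,v))`. -/
def reg (p : Params) (u v : ℝ) : ℝ :=
  (1 - Real.exp (-min (p.eps (max u v)) |u - v|)) / (1 - Real.exp (-p.eps (max u v)))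

/-- The regularized symmetric kernel with respect to `ν`. -/
def kernelBarEps (p : Params) (u v : ℝ) : ℝ := p.kernelBar u v * p.reg u v

/-- The part of the flat kernel below the diagonal (`w < v`) with the line singularity. -/
def K1 (p : Params) (v w : ℝ) : ℝ :=
  4 * p.nbar * lg v ^ (-(3 / 2) : ℝ) * lg w
    * ((Real.exp w + 2 * Real.exp (-(v - w))) / (1 + Real.exp w + Real.exp (-(v - w))))
    * (Real.exp (-(v - w)) / (1 - Real.exp (-(v - w))))

/-- The part of the flat kernel below the diagonal (`w < v`) without line singularity. -/
def K2 (p : Params) (v w : ℝ) : ℝ :=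
  4 * p.nbar * lg v ^ (-(3 / 2) : ℝ) * lg w
    * ((Real.exp w + 2 * Real.exp (-(v - w))) / (1 + Real.exp w + Real.exp (-(v - w))))

/-- The flat kernel above the diagonal (`v < w`). -/
def Kup (p : Params) (v w : ℝ) : ℝ :=
  4 * p.nbar * lg v ^ (-(3 / 2) : ℝ) * lg w
    * ((Real.exp v + 2 * Real.exp (-(w - v))) / (1 + Real.exp v + Real.exp (-(w - v))))
    * (Real.exp (-(w - v)) / (1 - Real.exp (-(w - v))))

/-- The flat kernel, i.e. the kernel with respect to Lebesgue measure. -/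
def K3 (p : Params) (v w : ℝ) : ℝ := if w < v then p.K1 v w + p.K2 v w else p.Kup v w

/-- The regularized flat kernel and its two parts below the diagonal. -/
def K3eps (p : Params) (v w : ℝ) : ℝ := p.K3 v w * p.reg v w

def K1eps (p : Params) (v w : ℝ) : ℝ := p.K1 v w * p.reg v w

def K2eps (p : Params) (v w : ℝ) : ℝ := p.K2 v w * p.reg v w

/-! ### The multiplication operator and the two integral operators -/

/-- The potential `V^ε`. -/
def V (p : Params) (v : ℝ) : ℝ :=
  (∫ r in Ioi (0 : ℝ), p.K3eps v (v - r)) + ∫ r in Ioi (0 : ℝ), p.K3eps v (v + r)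

/-- The unbounded, positivity preserving part `K_u^ε` of the integral operator. -/
def Ku (p : Params) (ψ : ℝ → ℂ) (v : ℝ) : ℂ :=
  (if v < -p.b then
      (∫ r in Ioc 0 (-v - p.b), p.K1eps v (v - r) • ψ (v - r))
      + (∫ r in Ioi (-v - p.b), (p.K1eps v (v - r) * Real.exp (-r)) • ψ (v - r))
      + (∫ r in Ioc 0 (-v - p.b), p.K3eps v (v + r) • ψ (v + r))
      + (∫ r in Ioi (-v - p.b), (p.K3eps v (v + r) * Real.exp (-r)) • ψ (v + r))
    else 0)
  + (if -p.b ≤ v then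
      (if v ≤ p.m then
          ∫ r in Ioi (0 : ℝ), (p.K1eps v (v - r) * Real.exp (-r)) • ψ (v - r) else 0)
      + (if p.m < v then ∫ r in Ioc 0 v, p.K1eps v (v - r) • ψ (v - r) else 0)
      + (if v ≤ p.m then
          ∫ r in Ioi (0 : ℝ), (p.K3eps v (v + r) * Real.exp (-r)) • ψ (v + r) else 0)
      + (if p.m < v then ∫ r in Ioi (0 : ℝ), p.K3eps v (v + r) • ψ (v + r) else 0)
    else 0)
  + (if v < -p.m then ∫ r in Ioc 0 (-v - p.b), p.K2eps v (v - r) • ψ (v - r) else 0)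
  + (if p.m < v then ∫ r in Ioc 0 (v - p.a₁), p.K2eps v (v - r) • ψ (v - r) else 0)

/-- The remaining part `K_b^ε` of the integral operator (which is bounded on `L²(ν)`). -/
def Kb (p : Params) (ψ : ℝ → ℂ) (v : ℝ) : ℂ :=
  (if v < -p.b then
      (∫ r in Ioi (-v - p.b), (p.K1eps v (v - r) * (1 - Real.exp (-r))) • ψ (v - r))
      + (∫ r in Ioi (-v - p.b), (p.K3eps v (v + r) * (1 - Real.exp (-r))) • ψ (v + r))
    else 0)
  + (if -p.b ≤ v then
      (if v ≤ p.m then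
          ∫ r in Ioi (0 : ℝ), (p.K1eps v (v - r) * (1 - Real.exp (-r))) • ψ (v - r) else 0)
      + (if p.m < v then ∫ r in Ioi v, p.K1eps v (v - r) • ψ (v - r) else 0)
      + (if v ≤ p.m then
          ∫ r in Ioi (0 : ℝ), (p.K3eps v (v + r) * (1 - Real.exp (-r))) • ψ (v + r) else 0)
    else 0)
  + (if v < -p.m then ∫ r in Ioi (-v - p.b), p.K2eps v (v - r) • ψ (v - r) else 0)
  + (if -p.m ≤ v ∧ v ≤ p.m then ∫ r in Ioi (0 : ℝ), p.K2eps v (v - r) • ψ (v - r) else 0)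
  + (if p.m < v then ∫ r in Ioi (v - p.a₁), p.K2eps v (v - r) • ψ (v - r) else 0)

/-! ### The Banach space `X` and the Duhamel-integrated equation -/

/-- `f(v) = max ((ln (1 + e^v))^{-α}, (ln 2)^{-α})`. -/
def f (p : Params) (v : ℝ) : ℝ := max (lg v ^ (-p.α)) (Real.log 2 ^ (-p.α))

/-- The weight `Γ̃(v) = f(v) exp (μ max (a, c₀ v))`. -/
def Γt (p : Params) (v : ℝ) : ℝ := p.f v * Real.exp (p.μ * max p.a (p.c₀ * v))

/-- The weighted sup norm, with values in `[0, ∞]`. -/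
def normX (p : Params) (h : ℝ → ℂ) : ℝ≥0∞ := ⨆ v : ℝ, ENNReal.ofReal (‖h v‖ / p.Γt v)

/-- The space `X` of continuous functions with finite weighted sup norm. -/
def X (p : Params) : Set (ℝ → ℂ) := {h | Continuous h ∧ p.normX h < ⊤}

/-- The norm `sup_{t ≥ 0} ‖ψ_t‖_X`, with values in `[0, ∞]`. -/
def normSup (p : Params) (ψ : ℝ → ℝ → ℂ) : ℝ≥0∞ := ⨆ t ∈ Ici (0 : ℝ), p.normX (ψ t)

/-- `ψ` (of which only the times `t ≥ 0` matter) solves the Duhamel-integrated equation with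
initial datum `ψ₀`: each `ψ_t` is in `X`, the time integrals converge absolutely, and
`ψ_t = e^{-tV} ψ₀ + ∫₀ᵗ e^{-(t-s)V} K_u[ψ_s] ds + ∫₀ᵗ e^{-(t-s)V} K_b[ψ_s] ds` pointwise. -/
structure IsDuhamelSolution (p : Params) (ψ₀ : ℝ → ℂ) (ψ : ℝ → ℝ → ℂ) : Prop where
  mem_X : ∀ t, 0 ≤ t → ψ t ∈ p.X
  integrable_Ku : ∀ t, 0 ≤ t → ∀ v, IntervalIntegrable
    (fun s => Real.exp (-(t - s) * p.V v) • p.Ku (ψ s) v) volume 0 t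
  integrable_Kb : ∀ t, 0 ≤ t → ∀ v, IntervalIntegrable
    (fun s => Real.exp (-(t - s) * p.V v) • p.Kb (ψ s) v) volume 0 t
  eqn : ∀ t, 0 ≤ t → ∀ v, ψ t v = Real.exp (-t * p.V v) • ψ₀ v
    + (∫ s in (0 : ℝ)..t, Real.exp (-(t - s) * p.V v) • p.Ku (ψ s) v)
    + ∫ s in (0 : ℝ)..t, Real.exp (-(t - s) * p.V v) • p.Kb (ψ s) v

/-! ### The self-adjoint operator on `L²(ν)` and its semigroup -/

/-- The complex Hilbert space `L²(ν)`. -/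
abbrev L2 : Type := Lp ℂ 2 nu

/-- The form domain: all `ψ ∈ L²(ν)` of finite energy. -/
def formDomain (p : Params) : Set L2 :=
  {ψ | ∫⁻ z : ℝ × ℝ, ENNReal.ofReal (p.kernelBarEps z.1 z.2 * ‖ψ z.1 - ψ z.2‖ ^ 2)
    ∂(nu.prod nu) < ⊤}

/-- The sesquilinear form of the regularized operator, conjugate linear in the first argument. -/
def form (p : Params) (φ ψ : L2) : ℂ :=
  (1 / 2 : ℝ) • ∫ z : ℝ × ℝ, p.kernelBarEps z.1 z.2 •
    (starRingEnd ℂ (φ z.1 - φ z.2) * (ψ z.1 - ψ z.2)) ∂(nu.prod nu)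

/-- The graph of the Friedrichs extension of the regularized operator: `(ψ, η)` belongs to it iff
`ψ` is in the form domain and `(φ, η) = form φ ψ` for all `φ` in the form domain. -/
def graphL3 (p : Params) : Set (L2 × L2) :=
  {q | q.1 ∈ p.formDomain ∧ ∀ φ ∈ p.formDomain, inner ℂ φ q.2 = p.form φ q.1}

/-- `S` (of which only the times `t ≥ 0` matter) is the strongly continuous contraction semigroup
`e^{-tA}`, where the operator `A` is given by its graph: the infinitesimal generator of `S`,
with its full domain, is `-A`. -/
structure IsSemigroupOf (A : Set (L2 × L2)) (S : ℝ → L2 →L[ℂ] L2) : Prop where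
  zero : S 0 = ContinuousLinearMap.id ℂ L2
  add : ∀ s t, 0 ≤ s → 0 ≤ t → S (s + t) = (S s).comp (S t)
  continuousOn : ∀ ψ : L2, ContinuousOn (fun t => S t ψ) (Ici 0)
  contraction : ∀ t, 0 ≤ t → ‖S t‖ ≤ 1
  generator : ∀ ψ η : L2, (ψ, η) ∈ A ↔
    Tendsto (fun h : ℝ => h⁻¹ • (S h ψ - ψ)) (𝓝[>] 0) (𝓝 (-η))

end Params

end RegularizedBose

end

/-! By `Ku_add_Kb` the two integral operators add up to a single operator $K$ with nonnegative
kernel $K^\varepsilon$, and $V=K1$. The equation is therefore $\partial_t\psi=-(V-K)\psi$, the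
backward equation of a jump process with rates $K^\varepsilon(v,w)\,dw$, reversible with respect to
$\nu$.

Everything pointwise rests on one Lyapunov estimate. The weight of $X$ is comparable to
$G(v)=e^{-\alpha v}+e^{\mu c_0v}$. With $W=\ell^{-1/2}+\ell^{1/2}$, `exists_drift` gives $KG\le
VG-cWG+C$, and `exists_V_le` gives $V\le C'W$. Near $-\infty$ the gain comes from jumps to the
right, which beat jumps to the left because $\ell$ decays exponentially there. Near $+\infty$ it
comes from the jumps of length between $v/4$ and $v/2$ to the left, whose total rate is at least of
order $\ell(v)^{1/2}$.

Since the gain $cWG$ controls a fraction of $VG$, one gets $KG\le q(V+l)G$ with $q<1$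
(`exists_contraction_const`). The Duhamel map is then a contraction for the norm $\sup
e^{-lt}|\psi_t(v)|/G(v)$, although $V$ and $K$ are unbounded. This yields existence and uniqueness.
Since $W\ge2$, one also gets $KG\le(V-d)G+C$ (`exists_decay_const`). Hence $e^{-dt}G+\frac
Cd(1-e^{-dt})$ is a supersolution, which the Picard iterates never exceed up to a factor, and the
solution is bounded uniformly in time.

On the Hilbert space side, the form domain, with each function paired with its differences, is a
closed subspace of $L^2(\nu)\oplus L^2(\mathtt{jump})$. Compressing the projection onto it gives
$R=(1+L_3^\varepsilon)^{-1}$ (`mem_graphL3_iff`), and $e^{-t(R^{-1}-1)}$ is defined by continuous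
functional calculus.

The two sides meet because $WG\in L^2(\nu)$ (`memLp_W_mul_G`). Continuous functions dominated by $G$
lie in the domain of $L_3^\varepsilon$, where it acts as $V-K$ (`mem_graphL3`), and the Duhamel
solution is right differentiable in $L^2(\nu)$. Its difference from the semigroup orbit starts at
$0$ and is dissipated, so it vanishes. -/

namespace RegularizedBose

open scoped ComplexConjugate

namespace Params

/-! ### Elementary facts on `lg` -/

lemma lg_pos (v : ℝ) : 0 < lg v := Real.log_pos (by linarith [Real.exp_pos v])

lemma lg_nonneg (v : ℝ) : 0 ≤ lg v := (lg_pos v).le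

lemma lg_le_exp (v : ℝ) : lg v ≤ Real.exp v := by
  have := Real.log_le_sub_one_of_pos (by positivity : 0 < 1 + Real.exp v)
  unfold lg; linarith

lemma lg_mono {u v : ℝ} (h : u ≤ v) : lg u ≤ lg v :=
  Real.log_le_log (by positivity) (by gcongr)

lemma self_le_lg (v : ℝ) : v ≤ lg v := by
  rw [lg, Real.le_log_iff_exp_le (by positivity)]; linarith

lemma lg_add_le (v : ℝ) {r : ℝ} (hr : 0 ≤ r) : lg (v + r) ≤ lg v + r := by
  have h1 : 1 ≤ Real.exp r := Real.one_le_exp hr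
  rw [lg, lg, Real.log_le_iff_le_exp (by positivity), Real.exp_add,
    Real.exp_add _ r, Real.exp_log (by positivity)]
  nlinarith [Real.exp_pos v]

lemma div_le_lg (v : ℝ) : Real.exp v / (1 + Real.exp v) ≤ lg v := by
  have h := Real.one_sub_inv_le_log_of_pos (by positivity : 0 < 1 + Real.exp v)
  have : Real.exp v / (1 + Real.exp v) = 1 - (1 + Real.exp v)⁻¹ := by
    field_simp; ring
  rw [this]; exact h

lemma half_exp_le_lg {v : ℝ} (hv : v ≤ 0) : Real.exp v / 2 ≤ lg v := by
  refine le_trans ?_ (div_le_lg v)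
  have : Real.exp v ≤ 1 := Real.exp_le_one_iff.2 hv
  gcongr
  linarith

lemma half_le_lg {v : ℝ} (hv : 0 ≤ v) : 1 / 2 ≤ lg v := by
  have := half_exp_le_lg (le_refl (0 : ℝ))
  rw [Real.exp_zero] at this
  exact this.trans (lg_mono hv)

lemma lg_le_add_one {v : ℝ} (hv : 0 ≤ v) : lg v ≤ v + 1 := by
  have := lg_add_le 0 hv
  have h2 := lg_le_exp 0
  rw [Real.exp_zero] at h2
  rw [zero_add] at this
  linarith

lemma continuous_lg : Continuous lg := by
  unfold lg
  exact Continuous.log (by fun_prop) fun v => by positivity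

lemma continuous_lg_rpow (s : ℝ) : Continuous fun v => lg v ^ s :=
  continuous_lg.rpow_const fun v => Or.inl (lg_pos v).ne'

@[fun_prop]
lemma measurable_lg : Measurable lg := continuous_lg.measurable

lemma one_sub_exp_neg_pos {r : ℝ} (hr : 0 < r) : 0 < 1 - Real.exp (-r) := by
  have : Real.exp (-r) < 1 := by rw [← Real.exp_zero]; exact Real.exp_lt_exp.2 (by linarith)
  linarith

lemma one_sub_exp_neg_nonneg {r : ℝ} (hr : 0 ≤ r) : 0 ≤ 1 - Real.exp (-r) := by
  have : Real.exp (-r) ≤ 1 := Real.exp_le_one_iff.2 (by linarith)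
  linarith

lemma inv_one_sub_exp_neg_le {r : ℝ} (hr : 0 < r) : (1 - Real.exp (-r))⁻¹ ≤ 1 + r⁻¹ := by
  have h1 : (1 + r⁻¹) = ((r / (1 + r)))⁻¹ := by field_simp; ring
  rw [h1]
  apply inv_anti₀ (by positivity)
  have h2 : Real.exp (-r) ≤ (1 + r)⁻¹ := by
    rw [Real.exp_neg]
    exact inv_anti₀ (by positivity) (by linarith [Real.add_one_le_exp r])
  have h3 : r / (1 + r) = 1 - (1 + r)⁻¹ := by field_simp; ring
  linarith

/-! ### The regularized inverse distance -/

/-- `min ((1 - e^{-ε})⁻¹, (1 - e^{-r})⁻¹)`, written as in the regularized kernels. -/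
noncomputable def cut (ε r : ℝ) : ℝ :=
  (1 - Real.exp (-min ε r)) / (1 - Real.exp (-ε)) / (1 - Real.exp (-r))

lemma cut_eq {ε r : ℝ} (hε : 0 < ε) (hr : 0 < r) :
    cut ε r = min (1 - Real.exp (-ε))⁻¹ (1 - Real.exp (-r))⁻¹ := by
  have h1 := one_sub_exp_neg_pos hε
  have h2 := one_sub_exp_neg_pos hr
  rcases le_total ε r with h | h
  · have h3 : (1 - Real.exp (-r))⁻¹ ≤ (1 - Real.exp (-ε))⁻¹ :=
      inv_anti₀ h1 (by gcongr)
    rw [cut, min_eq_left h, div_self h1.ne', min_eq_right h3, one_div]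
  · have h3 : (1 - Real.exp (-ε))⁻¹ ≤ (1 - Real.exp (-r))⁻¹ :=
      inv_anti₀ h2 (by gcongr)
    rw [cut, min_eq_right h, min_eq_left h3]
    field_simp

lemma cut_pos {ε r : ℝ} (hε : 0 < ε) (hr : 0 < r) : 0 < cut ε r := by
  rw [cut_eq hε hr]
  exact lt_min (inv_pos.2 (one_sub_exp_neg_pos hε)) (inv_pos.2 (one_sub_exp_neg_pos hr))

lemma cut_le_left {ε r : ℝ} (hε : 0 < ε) (hr : 0 < r) : cut ε r ≤ (1 - Real.exp (-ε))⁻¹ := by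
  rw [cut_eq hε hr]; exact min_le_left _ _

lemma cut_le_right {ε r : ℝ} (hε : 0 < ε) (hr : 0 < r) : cut ε r ≤ (1 - Real.exp (-r))⁻¹ := by
  rw [cut_eq hε hr]; exact min_le_right _ _

lemma one_le_cut {ε r : ℝ} (hε : 0 < ε) (hr : 0 < r) : 1 ≤ cut ε r := by
  rw [cut_eq hε hr]
  refine le_min ?_ ?_
  · exact (one_le_inv₀ (one_sub_exp_neg_pos hε)).2 (by linarith [Real.exp_pos (-ε)])
  · exact (one_le_inv₀ (one_sub_exp_neg_pos hr)).2 (by linarith [Real.exp_pos (-r)])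

lemma cut_anti {ε ε' r : ℝ} (hε : 0 < ε) (h : ε ≤ ε') (hr : 0 < r) : cut ε' r ≤ cut ε r := by
  rw [cut_eq hε hr, cut_eq (hε.trans_le h) hr]
  refine min_le_min_right _ (inv_anti₀ (one_sub_exp_neg_pos hε) ?_)
  gcongr

lemma cut_mul_le {ε r : ℝ} (hε : 0 < ε) (hr : 0 < r) : cut ε r * (1 - Real.exp (-r)) ≤ 1 := by
  have h := one_sub_exp_neg_pos hr
  calc _ ≤ (1 - Real.exp (-r))⁻¹ * (1 - Real.exp (-r)) := by
        gcongr; exact cut_le_right hε hr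
    _ = 1 := inv_mul_cancel₀ h.ne'

/-- For $s\le1$ the zero of $e^{sr}-1$ at $r=0$ is dominated by $e^{sr}(1-e^{-r})$, which cancels
the singularity. The bound does not depend on $\varepsilon$, so increments of the weight see no
logarithm. -/
lemma cut_mul_exp_sub_le {ε r s : ℝ} (hε : 0 < ε) (hr : 0 < r) (hs : s ≤ 1) :
    cut ε r * (Real.exp (s * r) - 1) ≤ Real.exp (s * r) := by
  have h1 : Real.exp (s * r) - 1 ≤ Real.exp (s * r) * (1 - Real.exp (-r)) := by
    have : Real.exp (s * r) * Real.exp (-r) ≤ 1 := by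
      rw [← Real.exp_add]; exact Real.exp_le_one_iff.2 (by nlinarith)
    linarith
  calc _ ≤ cut ε r * (Real.exp (s * r) * (1 - Real.exp (-r))) := by
        gcongr; exact (cut_pos hε hr).le
    _ = Real.exp (s * r) * (cut ε r * (1 - Real.exp (-r))) := by ring
    _ ≤ Real.exp (s * r) * 1 := by gcongr; exact cut_mul_le hε hr
    _ = _ := mul_one _

lemma eps_pos {p : Params} (hp : p.Admissible) (x : ℝ) : 0 < p.eps x :=
  mul_pos hp.ε₀_pos (Real.exp_pos _)

namespace Admissible

lemma μ_pos {p : Params} (hp : p.Admissible) : 0 < p.μ := by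
  have h : 0 < p.μ * p.c₀ := hp.α_pos.trans hp.lt_μc₀
  exact pos_of_mul_pos_left h hp.c₀_pos.le

lemma rate_pos {p : Params} (hp : p.Admissible) : 0 < p.μ' / p.γ₀ :=
  div_pos (hp.μ_pos.trans hp.μ_lt_μ') hp.γ₀_pos

lemma a₁_pos {p : Params} (hp : p.Admissible) : 0 < p.a₁ :=
  div_pos (by linarith [hp.a_ge]) hp.c₀_pos

lemma m_pos {p : Params} (hp : p.Admissible) : 0 < p.m := hp.b_pos.trans hp.b_lt_m

end Admissible

lemma eps_anti {p : Params} (hp : p.Admissible) {x y : ℝ} (h : x ≤ y) : p.eps y ≤ p.eps x := by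
  unfold eps
  have := hp.rate_pos
  have h0 := hp.ε₀_pos
  have h2 : max p.a₁ x ≤ max p.a₁ y := max_le_max_left _ h
  gcongr ?_ * Real.exp ?_
  nlinarith

lemma continuous_eps (p : Params) : Continuous p.eps := by
  unfold eps; fun_prop

/-! ### The kernels as functions of a point and a distance -/

/-- The prefactor `4 n̄ lg(v)^{-3/2}`. -/
noncomputable def A (p : Params) (v : ℝ) : ℝ := 4 * p.nbar * lg v ^ (-(3 / 2) : ℝ)

/-- The rational factor of the kernel in terms of the smaller point and the distance. -/
noncomputable def quot (u r : ℝ) : ℝ :=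
  (Real.exp u + 2 * Real.exp (-r)) / (1 + Real.exp u + Real.exp (-r))

/-- The regularized kernel at `(v, v - r)`. -/
noncomputable def kd (p : Params) (v r : ℝ) : ℝ :=
  p.A v * lg (v - r) * quot (v - r) r * cut (p.eps v) r

/-- The regularized kernel at `(v, v + r)`. -/
noncomputable def ku (p : Params) (v r : ℝ) : ℝ :=
  p.A v * lg (v + r) * quot v r * Real.exp (-r) * cut (p.eps (v + r)) r

/-- The exponential weight, equivalent to the weight of the space `X`. -/
noncomputable def G (p : Params) (v : ℝ) : ℝ :=
  Real.exp (-p.α * v) + Real.exp (p.μ * p.c₀ * v)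

/-- A function which is comparable to the potential. -/
noncomputable def W (v : ℝ) : ℝ := lg v ^ (-(1 / 2) : ℝ) + lg v ^ (1 / 2 : ℝ)

lemma reg_sub (p : Params) (v : ℝ) {r : ℝ} (hr : 0 < r) :
    p.reg v (v - r) = cut (p.eps v) r * (1 - Real.exp (-r)) := by
  have h := one_sub_exp_neg_pos hr
  have h1 : max v (v - r) = v := max_eq_left (by linarith)
  have h2 : |v - (v - r)| = r := by rw [sub_sub_cancel]; exact abs_of_pos hr
  rw [reg, h1, h2, cut, div_mul_cancel₀ _ h.ne']

lemma reg_add (p : Params) (v : ℝ) {r : ℝ} (hr : 0 < r) :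
    p.reg v (v + r) = cut (p.eps (v + r)) r * (1 - Real.exp (-r)) := by
  have h := one_sub_exp_neg_pos hr
  have h1 : max v (v + r) = v + r := max_eq_right (by linarith)
  have h2 : |v - (v + r)| = r := by
    rw [show v - (v + r) = -r by ring, abs_neg]; exact abs_of_pos hr
  rw [reg, h1, h2, cut, div_mul_cancel₀ _ h.ne']

lemma K1eps_sub (p : Params) (v : ℝ) {r : ℝ} (hr : 0 < r) :
    p.K1eps v (v - r) = p.kd v r * Real.exp (-r) := by
  have h := one_sub_exp_neg_pos hr
  rw [K1eps, reg_sub p v hr, K1, kd, sub_sub_cancel, A, quot]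
  field_simp

lemma K2eps_sub (p : Params) (v : ℝ) {r : ℝ} (hr : 0 < r) :
    p.K2eps v (v - r) = p.kd v r * (1 - Real.exp (-r)) := by
  rw [K2eps, reg_sub p v hr, K2, kd, sub_sub_cancel, A, quot]
  ring

lemma K3eps_sub (p : Params) (v : ℝ) {r : ℝ} (hr : 0 < r) :
    p.K3eps v (v - r) = p.kd v r := by
  have h1 := K1eps_sub p v hr
  have h2 := K2eps_sub p v hr
  rw [K1eps] at h1
  rw [K2eps] at h2
  rw [K3eps, K3, if_pos (by linarith), add_mul, h1, h2]
  ring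

lemma K3eps_add (p : Params) (v : ℝ) {r : ℝ} (hr : 0 < r) :
    p.K3eps v (v + r) = p.ku v r := by
  have h := one_sub_exp_neg_pos hr
  rw [K3eps, K3, if_neg (by linarith), reg_add p v hr, Kup, ku, add_sub_cancel_left, A, quot]
  field_simp

/-! ### Pointwise bounds of the kernels -/

lemma A_pos {p : Params} (hp : p.Admissible) (v : ℝ) : 0 < p.A v :=
  mul_pos (by linarith [hp.nbar_pos]) (Real.rpow_pos_of_pos (lg_pos v) _)

lemma A_mul_lg (p : Params) (v : ℝ) : p.A v * lg v = 4 * p.nbar * lg v ^ (-(1 / 2) : ℝ) := by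
  have : lg v ^ (-(3 / 2) : ℝ) * lg v = lg v ^ (-(1 / 2) : ℝ) := by
    nth_rewrite 2 [← Real.rpow_one (lg v)]
    rw [← Real.rpow_add (lg_pos v)]; norm_num
  rw [A, mul_assoc, this]

lemma A_mul_lg_sq (p : Params) (v : ℝ) : p.A v * lg v ^ 2 = 4 * p.nbar * lg v ^ (1 / 2 : ℝ) := by
  have : lg v ^ (-(3 / 2) : ℝ) * lg v ^ 2 = lg v ^ (1 / 2 : ℝ) := by
    rw [← Real.rpow_natCast, ← Real.rpow_add (lg_pos v)]; norm_num
  rw [A, mul_assoc, this]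

lemma continuous_A (p : Params) : Continuous p.A :=
  (continuous_const).mul (continuous_lg_rpow _)

lemma quot_pos (u r : ℝ) : 0 < quot u r := by unfold quot; positivity

lemma quot_le_two (u r : ℝ) : quot u r ≤ 2 := by
  unfold quot
  rw [div_le_iff₀ (by positivity)]
  linarith [Real.exp_pos u]

lemma quot_le (u r : ℝ) : quot u r ≤ Real.exp u + 2 * Real.exp (-r) := by
  unfold quot
  apply div_le_self (by positivity)
  linarith [Real.exp_pos u, Real.exp_pos (-r)]

lemma kd_pos {p : Params} (hp : p.Admissible) (v : ℝ) {r : ℝ} (hr : 0 < r) : 0 < p.kd v r := by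
  have := A_pos hp v
  have := lg_pos (v - r)
  have := quot_pos (v - r) r
  have := cut_pos (eps_pos hp v) hr
  unfold kd; positivity

lemma ku_pos {p : Params} (hp : p.Admissible) (v : ℝ) {r : ℝ} (hr : 0 < r) : 0 < p.ku v r := by
  have := A_pos hp v
  have := lg_pos (v + r)
  have := quot_pos v r
  have := cut_pos (eps_pos hp (v + r)) hr
  unfold ku; positivity

lemma cut_eps_le {p : Params} (hp : p.Admissible) (v : ℝ) {r : ℝ} (hr : 0 < r) :
    cut (p.eps v) r ≤ cut (p.eps (v + r)) r :=
  cut_anti (eps_pos hp _) (eps_anti hp (by linarith)) hr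

lemma kd_le_quot {p : Params} (hp : p.Admissible) (v : ℝ) {r : ℝ} (hr : 0 < r) :
    p.kd v r ≤ p.A v * lg (v - r) * 2 * cut (p.eps v) r := by
  have := (A_pos hp v).le
  have := lg_nonneg (v - r)
  have := (cut_pos (eps_pos hp v) hr).le
  unfold kd
  gcongr
  exact quot_le_two _ _

/-- Write $1=e^{-r}+(1-e^{-r})$, which separates $K^1$ from $K^2$. Only the first part keeps the
singular factor; in the second it is cancelled. Moving the cut-off from $v$ to $v+r$ gives the same
singular factor as in `ku_le`. -/
lemma kd_le {p : Params} (hp : p.Admissible) (v : ℝ) {r : ℝ} (hr : 0 < r) :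
    p.kd v r ≤ 8 * p.nbar * lg v ^ (-(1 / 2) : ℝ) * (Real.exp (-r) * cut (p.eps (v + r)) r)
      + 2 * p.A v * lg (v - r) := by
  have hA := (A_pos hp v).le
  have hl := lg_nonneg (v - r)
  have hc := (cut_pos (eps_pos hp v) hr).le
  have h1 : p.kd v r * Real.exp (-r)
      ≤ 8 * p.nbar * lg v ^ (-(1 / 2) : ℝ) * (Real.exp (-r) * cut (p.eps (v + r)) r) := by
    calc p.kd v r * Real.exp (-r)
        ≤ (p.A v * lg (v - r) * 2 * cut (p.eps v) r) * Real.exp (-r) := by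
          gcongr; exact kd_le_quot hp v hr
      _ ≤ (p.A v * lg v * 2 * cut (p.eps (v + r)) r) * Real.exp (-r) := by
          have := lg_nonneg v
          gcongr
          · exact lg_mono (by linarith)
          · exact cut_eps_le hp v hr
      _ = _ := by rw [A_mul_lg]; ring
  have h2 : p.kd v r * (1 - Real.exp (-r)) ≤ 2 * p.A v * lg (v - r) := by
    calc p.kd v r * (1 - Real.exp (-r))
        ≤ (p.A v * lg (v - r) * 2 * cut (p.eps v) r) * (1 - Real.exp (-r)) := by
          have := (one_sub_exp_neg_pos hr).le
          gcongr; exact kd_le_quot hp v hr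
      _ = p.A v * lg (v - r) * 2 * (cut (p.eps v) r * (1 - Real.exp (-r))) := by ring
      _ ≤ p.A v * lg (v - r) * 2 * 1 := by
          gcongr; exact cut_mul_le (eps_pos hp v) hr
      _ = _ := by ring
  linarith

/-- For $v\le0$ the factor `quot` contributes $e^v+2e^{-r}$, which compensates for $\ell(v+r)\le
e^{v+r}$ as well as for $\ell(v+r)\le1+r$. For $v\ge0$ already $\ell(v)\ge\frac12$. -/
lemma lg_mul_quot_le (v : ℝ) {r : ℝ} (hr : 0 ≤ r) :
    lg (v + r) * quot v r ≤ 6 * (1 + r) * lg v := by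
  have hl := lg_nonneg (v + r)
  have hadd := lg_add_le v hr
  rcases le_total v 0 with hv | hv
  · have h1 : lg (v + r) ≤ 1 + r := by
      have := lg_le_exp v
      have : Real.exp v ≤ 1 := Real.exp_le_one_iff.2 hv
      linarith
    have h2 := lg_le_exp (v + r)
    have h3 := half_exp_le_lg hv
    calc lg (v + r) * quot v r ≤ lg (v + r) * (Real.exp v + 2 * Real.exp (-r)) := by
          gcongr; exact quot_le v r
      _ = lg (v + r) * Real.exp v + lg (v + r) * (2 * Real.exp (-r)) := by ring
      _ ≤ (1 + r) * Real.exp v + Real.exp (v + r) * (2 * Real.exp (-r)) := by gcongr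
      _ = (3 + r) * Real.exp v := by
          rw [Real.exp_add, Real.exp_neg]; field_simp; ring
      _ ≤ (3 + r) * (2 * lg v) := by gcongr; linarith
      _ ≤ _ := by nlinarith [lg_nonneg v]
  · have h1 := half_le_lg hv
    calc lg (v + r) * quot v r ≤ lg (v + r) * 2 := by gcongr; exact quot_le_two v r
      _ ≤ _ := by nlinarith

lemma ku_le {p : Params} (hp : p.Admissible) (v : ℝ) {r : ℝ} (hr : 0 < r) :
    p.ku v r ≤ 24 * p.nbar * lg v ^ (-(1 / 2) : ℝ)
      * ((1 + r) * Real.exp (-r) * cut (p.eps (v + r)) r) := by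
  have hA := (A_pos hp v).le
  have hc := (cut_pos (eps_pos hp (v + r)) hr).le
  calc p.ku v r = p.A v * (lg (v + r) * quot v r) * Real.exp (-r) * cut (p.eps (v + r)) r := by
        unfold ku; ring
    _ ≤ p.A v * (6 * (1 + r) * lg v) * Real.exp (-r) * cut (p.eps (v + r)) r := by
        gcongr ?_ * _ * _
        exact mul_le_mul_of_nonneg_left (lg_mul_quot_le v hr.le) hA
    _ = 6 * (p.A v * lg v) * ((1 + r) * Real.exp (-r) * cut (p.eps (v + r)) r) := by ring
    _ = _ := by rw [A_mul_lg]; ring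

/-! ### The weight -/

lemma G_pos (p : Params) (v : ℝ) : 0 < p.G v := by unfold G; positivity

lemma one_le_G {p : Params} (hp : p.Admissible) (v : ℝ) : 1 ≤ p.G v := by
  unfold G
  have h1 := hp.α_pos
  have h2 := hp.α_pos.trans hp.lt_μc₀
  rcases le_total v 0 with hv | hv
  · have : 1 ≤ Real.exp (-p.α * v) := Real.one_le_exp (by nlinarith)
    linarith [Real.exp_pos (p.μ * p.c₀ * v)]
  · have : 1 ≤ Real.exp (p.μ * p.c₀ * v) := Real.one_le_exp (by positivity)
    linarith [Real.exp_pos (-p.α * v)]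

lemma continuous_G (p : Params) : Continuous p.G := by unfold G; fun_prop

lemma continuous_W : Continuous W := (continuous_lg_rpow _).add (continuous_lg_rpow _)

lemma W_pos (v : ℝ) : 0 < W v := by
  have := lg_pos v
  unfold W; positivity

lemma two_le_W (v : ℝ) : 2 ≤ W v := by
  have h := lg_pos v
  have h1 : lg v ^ (-(1 / 2) : ℝ) * lg v ^ (1 / 2 : ℝ) = 1 := by
    rw [← Real.rpow_add h]; norm_num
  have h2 := Real.rpow_pos_of_pos h (1 / 2 : ℝ)
  have h3 := Real.rpow_pos_of_pos h (-(1 / 2) : ℝ)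
  unfold W
  nlinarith [sq_nonneg (lg v ^ (-(1 / 2) : ℝ) - lg v ^ (1 / 2 : ℝ))]

/-- A step to the left can only increase the $\alpha$-exponential, a step to the right only the
other one. -/
lemma G_sub_le {p : Params} (hp : p.Admissible) (v : ℝ) {r : ℝ} (hr : 0 ≤ r) :
    p.G (v - r) ≤ p.G v * Real.exp (p.α * r) := by
  have h1 := hp.α_pos
  have h2 := hp.α_pos.trans hp.lt_μc₀
  unfold G
  rw [add_mul, ← Real.exp_add, ← Real.exp_add]
  gcongr
  · linarith
  · nlinarith

lemma G_add_le {p : Params} (hp : p.Admissible) (v : ℝ) {r : ℝ} (hr : 0 ≤ r) :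
    p.G (v + r) ≤ p.G v * Real.exp (p.μ * p.c₀ * r) := by
  have h1 := hp.α_pos
  have h2 := hp.α_pos.trans hp.lt_μc₀
  unfold G
  rw [add_mul, ← Real.exp_add, ← Real.exp_add]
  gcongr
  · nlinarith
  · linarith

/-- Locally uniform exponential decay of the kernels against the weight. -/
lemma exists_kernel_bound {p : Params} (hp : p.Admissible) (R : ℝ) :
    ∃ C, 0 < C ∧ ∀ v, |v| ≤ R → ∀ r, 0 < r →
      p.kd v r * p.G (v - r) ≤ C * Real.exp (-(1 / 2) * r) ∧
      p.ku v r * p.G (v + r) ≤ C * Real.exp (-(1 / 2) * r) := by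
  obtain ⟨D, hD⟩ := isCompact_Icc.exists_bound_of_continuousOn
    (s := Icc (-R) R) ((continuous_A p).mul (continuous_G p)).continuousOn
  obtain ⟨D', hD'⟩ := isCompact_Icc.exists_bound_of_continuousOn
    (s := Icc (-R) R) ((continuous_lg_rpow (-(1/2))).mul (continuous_G p)).continuousOn
  -- For $r\le1$ the larger point is at most $R+1$ and the regularization bounds the singular
  -- factor; for $r\ge1$ the distance does.
  set B := (1 - Real.exp (-p.eps (R + 1)))⁻¹ + (1 - Real.exp (-1))⁻¹ with hB
  have hB1 := inv_pos.2 (one_sub_exp_neg_pos (eps_pos hp (R + 1)))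
  have hB2 := inv_pos.2 (one_sub_exp_neg_pos one_pos)
  have hBpos : 0 < B := by positivity
  have hcut : ∀ v, |v| ≤ R → ∀ r, 0 < r → cut (p.eps (v + r)) r ≤ B := by
    intro v hv r hr
    rcases le_total r 1 with h | h
    · have h2 : cut (p.eps (v + r)) r ≤ cut (p.eps (R + 1)) r :=
        cut_anti (eps_pos hp _) (eps_anti hp (by linarith [le_abs_self v])) hr
      linarith [cut_le_left (eps_pos hp (R + 1)) hr]
    · have h2 := cut_le_right (eps_pos hp (v + r)) hr
      have h3 : (1 - Real.exp (-r))⁻¹ ≤ (1 - Real.exp (-1))⁻¹ :=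
        inv_anti₀ (one_sub_exp_neg_pos one_pos) (by gcongr)
      linarith
  have hα := hp.α_pos
  have hα' := hp.α_lt
  have hκ := hp.μc₀_lt
  have hn := hp.nbar_pos
  -- The exponents left over are $-1+\alpha$ for `kd` and $\frac14-1+\mu c_0$ for `ku`, both at most
  -- $-\frac12$; the $\frac14$ pays for the factor $1+r$.
  refine ⟨2 * |D| * Real.exp R * B + 96 * p.nbar * |D'| * B + 1, by positivity, ?_⟩
  intro v hv r hr
  have hvI : v ∈ Icc (-R) R := abs_le.1 hv
  have hA := A_pos hp v
  have hG := G_pos p v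
  have hc := (cut_pos (eps_pos hp (v + r)) hr).le
  have e0 := Real.exp_pos (-(1 / 2) * r)
  constructor
  · have hAG : p.A v * p.G v ≤ |D| := (le_abs_self _).trans ((hD v hvI).trans (le_abs_self _))
    have hl : lg (v - r) ≤ Real.exp R * Real.exp (-r) := by
      refine (lg_le_exp _).trans ?_
      rw [← Real.exp_add]; gcongr; linarith [hvI.2]
    calc p.kd v r * p.G (v - r)
        ≤ (p.A v * lg (v - r) * 2 * cut (p.eps v) r) * (p.G v * Real.exp (p.α * r)) := by
          have := (G_pos p (v - r)).le
          have := cut_pos (eps_pos hp v) hr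
          have := lg_nonneg (v - r)
          gcongr
          · exact kd_le_quot hp v hr
          · exact G_sub_le hp v hr.le
      _ = (p.A v * p.G v) * lg (v - r) * 2 * cut (p.eps v) r * Real.exp (p.α * r) := by ring
      _ ≤ |D| * (Real.exp R * Real.exp (-r)) * 2 * B * Real.exp (p.α * r) := by
          have := lg_nonneg (v - r)
          have := cut_pos (eps_pos hp v) hr
          gcongr
          exact (cut_eps_le hp v hr).trans (hcut v hv r hr)
      _ = 2 * |D| * Real.exp R * B * Real.exp (-r + p.α * r) := by rw [Real.exp_add]; ring
      _ ≤ 2 * |D| * Real.exp R * B * Real.exp (-(1 / 2) * r) := by gcongr; nlinarith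
      _ ≤ _ := by gcongr; linarith [show 0 ≤ 96 * p.nbar * |D'| * B by positivity]
  · have hAG : lg v ^ (-(1 / 2) : ℝ) * p.G v ≤ |D'| :=
      (le_abs_self _).trans ((hD' v hvI).trans (le_abs_self _))
    have h1r : 1 + r ≤ 4 * Real.exp (r / 4) := by linarith [Real.add_one_le_exp (r / 4)]
    have hlp := Real.rpow_pos_of_pos (lg_pos v) (-(1 / 2) : ℝ)
    calc p.ku v r * p.G (v + r)
        ≤ (24 * p.nbar * lg v ^ (-(1 / 2) : ℝ)
          * ((1 + r) * Real.exp (-r) * cut (p.eps (v + r)) r))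
            * (p.G v * Real.exp (p.μ * p.c₀ * r)) := by
          have := (G_pos p (v + r)).le
          gcongr
          · exact ku_le hp v hr
          · exact G_add_le hp v hr.le
      _ = 24 * p.nbar * (lg v ^ (-(1 / 2) : ℝ) * p.G v)
          * ((1 + r) * Real.exp (-r) * cut (p.eps (v + r)) r) * Real.exp (p.μ * p.c₀ * r) := by ring
      _ ≤ 24 * p.nbar * |D'|
          * ((4 * Real.exp (r / 4)) * Real.exp (-r) * B) * Real.exp (p.μ * p.c₀ * r) := by
          gcongr
          exact hcut v hv r hr
      _ = 96 * p.nbar * |D'| * B * Real.exp (r / 4 + -r + p.μ * p.c₀ * r) := by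
          rw [Real.exp_add, Real.exp_add]; ring
      _ ≤ 96 * p.nbar * |D'| * B * Real.exp (-(1 / 2) * r) := by gcongr; nlinarith
      _ ≤ _ := by gcongr; linarith [show 0 ≤ 2 * |D| * Real.exp R * B by positivity]

/-! ### The full integral operator -/

lemma integrable_of_sub_add {E : Type*} [NormedAddCommGroup E] {f : ℝ → E} (v : ℝ)
    (h1 : IntegrableOn (fun r => f (v - r)) (Ioi 0))
    (h2 : IntegrableOn (fun r => f (v + r)) (Ioi 0)) : Integrable f := by
  have h3 : IntegrableOn (fun r => f (v + r)) (Iio 0) := by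
    have := (MeasurePreserving.integrableOn_comp_preimage (Measure.measurePreserving_neg
      (volume : Measure ℝ)) (MeasurableEquiv.neg ℝ).measurableEmbedding (f := fun r => f (v + r))
      (s := Iio 0)).1
    apply this
    have h4 : (Neg.neg : ℝ → ℝ) ⁻¹' Iio 0 = Ioi 0 := by ext x; simp
    rw [h4]
    simpa [Function.comp_def, sub_eq_add_neg] using h1
  have h5 : Integrable (fun r => f (v + r)) := by
    rw [← integrableOn_univ, ← Iic_union_Ioi (a := (0 : ℝ))]
    exact ((integrableOn_Iic_iff_integrableOn_Iio).2 h3).union h2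
  have := h5.comp_add_left (-v)
  simpa using this

section Operator

variable {E : Type*} [NormedAddCommGroup E] [NormedSpace ℝ E]

lemma integral_eq_sub_add {f : ℝ → E} (hf : Integrable f) (v : ℝ) :
    ∫ w, f w = (∫ r in Ioi (0 : ℝ), f (v - r)) + ∫ r in Ioi (0 : ℝ), f (v + r) := by
  have h5 : Integrable (fun r => f (v + r)) := hf.comp_add_left v
  rw [← integral_add_left_eq_self f v,
    ← intervalIntegral.integral_Iic_add_Ioi (b := 0) h5.integrableOn h5.integrableOn]
  congr 1
  have := integral_comp_neg_Ioi 0 (fun r => f (v + r))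
  rw [neg_zero] at this
  rw [← this]
  simp [sub_eq_add_neg]

/-- The integral operator with kernel `K^ε`. -/
noncomputable def Kop (p : Params) (ψ : ℝ → E) (v : ℝ) : E := ∫ w, p.K3eps v w • ψ w

lemma measurable_K3eps (p : Params) : Measurable fun z : ℝ × ℝ => p.K3eps z.1 z.2 := by
  unfold K3eps K3 K1 K2 Kup reg
  refine Measurable.mul (Measurable.ite (measurableSet_lt (by fun_prop) (by fun_prop)) ?_ ?_) ?_
  · fun_prop
  · fun_prop
  · have := (continuous_eps p).measurable
    fun_prop

@[fun_prop]
lemma measurable_K3eps_right (p : Params) (v : ℝ) : Measurable (p.K3eps v) :=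
  (measurable_K3eps p).comp (by fun_prop : Measurable fun w : ℝ => (v, w))

/-- Division by zero gives the value $0$ on the diagonal, so nonnegativity of the kernel needs no
exception there. -/
lemma K3eps_self (p : Params) (v : ℝ) : p.K3eps v v = 0 := by
  simp [K3eps, K3, Kup]

lemma K3eps_nonneg {p : Params} (hp : p.Admissible) (v w : ℝ) : 0 ≤ p.K3eps v w := by
  rcases lt_trichotomy w v with h | h | h
  · have := K3eps_sub p v (sub_pos.2 h)
    rw [sub_sub_cancel] at this
    rw [this]
    exact (kd_pos hp v (sub_pos.2 h)).le
  · rw [h, K3eps_self]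
  · have := K3eps_add p v (sub_pos.2 h)
    rw [add_sub_cancel] at this
    rw [this]
    exact (ku_pos hp v (sub_pos.2 h)).le

lemma integrableOn_exp_neg_half (c : ℝ) :
    IntegrableOn (fun r : ℝ => c * Real.exp (-(1 / 2) * r)) (Ioi 0) :=
  (exp_neg_integrableOn_Ioi 0 (by norm_num)).const_mul c

lemma integrable_K3eps_mul_G {p : Params} (hp : p.Admissible) (v : ℝ) :
    Integrable fun w => p.K3eps v w * p.G w := by
  obtain ⟨C, -, hC⟩ := exists_kernel_bound hp |v|
  have hm : Measurable fun w => p.K3eps v w * p.G w :=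
    (measurable_K3eps_right p v).mul (continuous_G p).measurable
  apply integrable_of_sub_add v
  · refine (integrableOn_exp_neg_half C).mono' (hm.comp (by fun_prop)).aestronglyMeasurable ?_
    filter_upwards [ae_restrict_mem measurableSet_Ioi] with r hr
    rw [Real.norm_of_nonneg (mul_nonneg (K3eps_nonneg hp _ _) (G_pos p _).le), K3eps_sub p v hr]
    exact (hC v le_rfl r hr).1
  · refine (integrableOn_exp_neg_half C).mono' (hm.comp (by fun_prop)).aestronglyMeasurable ?_
    filter_upwards [ae_restrict_mem measurableSet_Ioi] with r hr
    rw [Real.norm_of_nonneg (mul_nonneg (K3eps_nonneg hp _ _) (G_pos p _).le), K3eps_add p v hr]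
    exact (hC v le_rfl r hr).2

lemma integrable_K3eps_smul {p : Params} (hp : p.Admissible) (v : ℝ) {ψ : ℝ → E}
    (hm : AEStronglyMeasurable ψ) {M : ℝ} (hb : ∀ w, ‖ψ w‖ ≤ M * p.G w) :
    Integrable fun w => p.K3eps v w • ψ w := by
  refine ((integrable_K3eps_mul_G hp v).const_mul M).mono'
    ((measurable_K3eps_right p v).aestronglyMeasurable.smul hm) ?_
  filter_upwards with w
  rw [norm_smul, Real.norm_of_nonneg (K3eps_nonneg hp _ _)]
  have := mul_le_mul_of_nonneg_left (hb w) (K3eps_nonneg hp v w)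
  linarith

lemma integrable_K3eps {p : Params} (hp : p.Admissible) (v : ℝ) : Integrable (p.K3eps v) := by
  have := integrable_K3eps_smul hp v (ψ := fun _ => (1 : ℝ)) (M := 1)
    aestronglyMeasurable_const fun w => by simpa using one_le_G hp w
  simpa using this

lemma V_eq_integral {p : Params} (hp : p.Admissible) (v : ℝ) : p.V v = ∫ w, p.K3eps v w :=
  (integral_eq_sub_add (integrable_K3eps hp v) v).symm

lemma V_eq_Kop {p : Params} (hp : p.Admissible) (v : ℝ) : p.V v = p.Kop (fun _ => (1 : ℝ)) v := by
  simp [V_eq_integral hp, Kop]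

lemma V_nonneg {p : Params} (hp : p.Admissible) (v : ℝ) : 0 ≤ p.V v := by
  rw [V_eq_integral hp]; exact integral_nonneg fun w => K3eps_nonneg hp v w

lemma norm_Kop_le {p : Params} (hp : p.Admissible) (v : ℝ) {ψ : ℝ → E} {h : ℝ → ℝ}
    (hh : Integrable fun w => p.K3eps v w * h w) (hb : ∀ w, ‖ψ w‖ ≤ h w) :
    ‖p.Kop ψ v‖ ≤ p.Kop h v := by
  refine norm_integral_le_of_norm_le hh (ae_of_all _ fun w => ?_)
  rw [norm_smul, Real.norm_of_nonneg (K3eps_nonneg hp _ _)]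
  exact mul_le_mul_of_nonneg_left (hb w) (K3eps_nonneg hp v w)

lemma norm_Kop_le_mul {p : Params} (hp : p.Admissible) (v : ℝ) {ψ : ℝ → E} {M : ℝ}
    (hb : ∀ w, ‖ψ w‖ ≤ M * p.G w) : ‖p.Kop ψ v‖ ≤ M * p.Kop p.G v := by
  have h := norm_Kop_le hp v (h := fun w => M * p.G w)
    (by simpa [mul_left_comm] using (integrable_K3eps_mul_G hp v).const_mul M) hb
  refine h.trans_eq ?_
  simp only [Kop, smul_eq_mul]
  rw [← integral_const_mul]
  congr 1; ext w; ring

lemma continuous_cut_eps {p : Params} (hp : p.Admissible) (r : ℝ) :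
    Continuous fun v => cut (p.eps v) r := by
  have := continuous_eps p
  unfold cut
  refine Continuous.div_const (Continuous.div (by fun_prop) (by fun_prop) fun v => ?_) _
  exact (one_sub_exp_neg_pos (eps_pos hp v)).ne'

lemma continuous_quot : Continuous fun z : ℝ × ℝ => quot z.1 z.2 := by
  unfold quot
  exact Continuous.div (by fun_prop) (by fun_prop) fun v => by positivity

lemma continuous_kd {p : Params} (hp : p.Admissible) (r : ℝ) : Continuous fun v => p.kd v r := by
  have h1 := continuous_cut_eps hp r
  have h2 := continuous_A p
  have h3 := continuous_lg
  have h4 : Continuous fun v => quot (v - r) r :=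
    continuous_quot.comp (by fun_prop : Continuous fun v : ℝ => (v - r, r))
  unfold kd
  fun_prop

lemma continuous_ku {p : Params} (hp : p.Admissible) (r : ℝ) : Continuous fun v => p.ku v r := by
  have h1 : Continuous fun v => cut (p.eps (v + r)) r :=
    (continuous_cut_eps hp r).comp (by fun_prop : Continuous fun v => v + r)
  have h2 := continuous_A p
  have h3 := continuous_lg
  have h4 : Continuous fun v => quot v r :=
    continuous_quot.comp (by fun_prop : Continuous fun v : ℝ => (v, r))
  unfold ku
  fun_prop

lemma continuous_K3eps_add {p : Params} (hp : p.Admissible) {r : ℝ} (hr : r ≠ 0) :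
    Continuous fun v => p.K3eps v (v + r) := by
  rcases lt_or_gt_of_ne hr with h | h
  · have : (fun v => p.K3eps v (v + r)) = fun v => p.kd v (-r) := by
      ext v
      rw [← K3eps_sub p v (neg_pos.2 h), sub_neg_eq_add]
    rw [this]; exact continuous_kd hp _
  · have : (fun v => p.K3eps v (v + r)) = fun v => p.ku v r := by
      ext v
      rw [← K3eps_add p v h]
    rw [this]; exact continuous_ku hp _

lemma integrable_exp_neg_half_abs (c : ℝ) :
    Integrable fun r : ℝ => c * Real.exp (-(1 / 2) * |r|) := by
  refine Integrable.const_mul (integrable_of_sub_add 0 ?_ ?_) c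
  · refine (integrableOn_congr_fun (fun r hr => ?_) measurableSet_Ioi).1
      (exp_neg_integrableOn_Ioi 0 (by norm_num : (0 : ℝ) < 1 / 2))
    simp only [zero_sub, abs_neg]
    rw [abs_of_pos (mem_Ioi.1 hr)]
  · refine (integrableOn_congr_fun (fun r hr => ?_) measurableSet_Ioi).1
      (exp_neg_integrableOn_Ioi 0 (by norm_num : (0 : ℝ) < 1 / 2))
    simp only [zero_add]
    rw [abs_of_pos (mem_Ioi.1 hr)]

/-- In the variable $r=w-v$ the singularity stays at $r=0$, and for each other $r$ the integrand is
continuous in the parameters. Dominated convergence applies with the exponential majorant, which is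
uniform for $v$ near $v_0$. -/
lemma continuous_Kop {p : Params} (hp : p.Admissible) {T : Type*} [TopologicalSpace T]
    [FirstCountableTopology T] {Ψ : T → ℝ → E}
    (hc : Continuous fun x : T × ℝ => Ψ x.1 x.2) {M : ℝ} (hM : 0 ≤ M)
    (hb : ∀ t w, ‖Ψ t w‖ ≤ M * p.G w) :
    Continuous fun x : T × ℝ => p.Kop (Ψ x.1) x.2 := by
  have heq : (fun x : T × ℝ => p.Kop (Ψ x.1) x.2)
      = fun x : T × ℝ => ∫ r, p.K3eps x.2 (x.2 + r) • Ψ x.1 (x.2 + r) := by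
    ext x
    exact (integral_add_left_eq_self (fun w => p.K3eps x.2 w • Ψ x.1 w) x.2).symm
  rw [heq, continuous_iff_continuousAt]
  rintro ⟨t₀, v₀⟩
  obtain ⟨C, hC0, hC⟩ := exists_kernel_bound hp (|v₀| + 1)
  refine continuousAt_of_dominated (bound := fun r => M * C * Real.exp (-(1 / 2) * |r|)) ?_ ?_ ?_ ?_
  · refine Eventually.of_forall fun x => ?_
    refine ((measurable_K3eps_right p x.2).comp (by fun_prop)).aestronglyMeasurable.smul ?_
    exact (hc.comp (by fun_prop : Continuous fun r : ℝ => (x.1, x.2 + r))).aestronglyMeasurable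
  · have h1 : ∀ᶠ x : T × ℝ in 𝓝 (t₀, v₀), |x.2| ≤ |v₀| + 1 := by
      have : ContinuousAt (fun x : T × ℝ => |x.2|) (t₀, v₀) := by fun_prop
      filter_upwards [this.eventually (eventually_lt_nhds (lt_add_one |v₀|))] with x hx
      exact hx.le
    filter_upwards [h1] with x hx
    filter_upwards [compl_mem_ae_iff.2 (measure_singleton (0 : ℝ))] with r hr
    rw [norm_smul, Real.norm_of_nonneg (K3eps_nonneg hp _ _)]
    calc _ ≤ p.K3eps x.2 (x.2 + r) * (M * p.G (x.2 + r)) :=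
          mul_le_mul_of_nonneg_left (hb _ _) (K3eps_nonneg hp _ _)
      _ = M * (p.K3eps x.2 (x.2 + r) * p.G (x.2 + r)) := by ring
      _ ≤ M * (C * Real.exp (-(1 / 2) * |r|)) := by
          refine mul_le_mul_of_nonneg_left ?_ hM
          rcases lt_or_gt_of_ne hr with h | h
          · have h3 := (hC x.2 hx (-r) (neg_pos.2 h)).1
            rw [← K3eps_sub p x.2 (neg_pos.2 h), sub_neg_eq_add] at h3
            rwa [abs_of_neg h]
          · have h3 := (hC x.2 hx r h).2
            rw [← K3eps_add p x.2 h] at h3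
            rwa [abs_of_pos h]
      _ = _ := by ring
  · exact integrable_exp_neg_half_abs (M * C)
  · filter_upwards [compl_mem_ae_iff.2 (measure_singleton (0 : ℝ))] with r hr
    apply Continuous.continuousAt
    refine ((continuous_K3eps_add hp hr).comp continuous_snd).smul ?_
    exact hc.comp (by fun_prop : Continuous fun x : T × ℝ => (x.1, x.2 + r))

lemma continuous_Kop_const {p : Params} (hp : p.Admissible) {ψ : ℝ → E} (hc : Continuous ψ)
    {M : ℝ} (hM : 0 ≤ M) (hb : ∀ w, ‖ψ w‖ ≤ M * p.G w) : Continuous (p.Kop ψ) := by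
  have h := continuous_Kop hp (T := ℝ) (Ψ := fun _ => ψ) (by fun_prop) hM fun _ => hb
  exact h.comp (by fun_prop : Continuous fun v : ℝ => ((0 : ℝ), v))

lemma continuous_V {p : Params} (hp : p.Admissible) : Continuous p.V := by
  have h : p.V = p.Kop (fun _ => (1 : ℝ)) := funext (V_eq_Kop hp)
  rw [h]
  exact continuous_Kop_const hp continuous_const zero_le_one fun w => by
    simpa using one_le_G hp w

lemma continuous_Kop_G {p : Params} (hp : p.Admissible) : Continuous (p.Kop p.G) :=
  continuous_Kop_const hp (continuous_G p) zero_le_one fun w => by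
    rw [one_mul, Real.norm_of_nonneg (G_pos p w).le]

end Operator

/-! ### Upper bound of the potential -/

lemma lg_rpow_mul (v : ℝ) : lg v ^ (-(1 / 2) : ℝ) * (1 + lg v) = W v := by
  have : lg v ^ (-(1 / 2) : ℝ) * lg v = lg v ^ (1 / 2 : ℝ) := by
    nth_rewrite 2 [← Real.rpow_one (lg v)]
    rw [← Real.rpow_add (lg_pos v)]; norm_num
  rw [mul_add, this, mul_one, W]

lemma one_add_mul_exp_neg_le {r : ℝ} : (1 + r) * Real.exp (-r) ≤ 4 * Real.exp (-(3 / 4) * r) := by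
  have h1 : 1 + r ≤ 4 * Real.exp (r / 4) := by linarith [Real.add_one_le_exp (r / 4)]
  calc _ ≤ 4 * Real.exp (r / 4) * Real.exp (-r) := by gcongr
    _ = _ := by rw [mul_assoc, ← Real.exp_add]; ring_nf

lemma integral_exp_neg_half : ∫ r in Ioi (0 : ℝ), Real.exp (-(1 / 2) * r) = 2 := by
  rw [integral_exp_mul_Ioi (by norm_num)]; norm_num

/-- An integrable majorant of the regularized singularity. -/
lemma exists_cut_majorant {p : Params} (hp : p.Admissible) :
    ∃ C, 0 < C ∧ ∀ v, ∃ h : ℝ → ℝ, IntegrableOn h (Ioi 0) ∧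
      (∫ r in Ioi (0 : ℝ), h r) ≤ C * (1 + lg v) ∧
      ∀ r, 0 < r → (1 + r) * Real.exp (-r) * cut (p.eps (v + r)) r ≤ h r := by
  set m := p.μ' / p.γ₀ with hm
  have hmpos : 0 < m := hp.rate_pos
  have ha := hp.a₁_pos
  have hε := hp.ε₀_pos
  set q := Real.log (1 + p.ε₀⁻¹) with hq
  have hqpos : 0 < q := Real.log_pos (by linarith [inv_pos.2 hε])
  refine ⟨17 + 2 * (q + m * (p.a₁ + 1)) + 2 * m, by positivity, fun v => ?_⟩
  -- $D$ bounds the singular factor for all $r\le1$, and so does $2/r$. Switching from one to the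
  -- other at $r=1/D$ gives the integral $1+2\log D$ over $(0,1]$.
  set D := (1 - Real.exp (-p.eps (v + 1)))⁻¹ with hD
  have hD1 : 1 ≤ D := (one_le_inv₀ (one_sub_exp_neg_pos (eps_pos hp _))).2
    (by linarith [Real.exp_pos (-p.eps (v + 1))])
  have hDpos : 0 < D := by linarith
  have hDi : D⁻¹ ≤ 1 := inv_le_one_of_one_le₀ hD1
  have hDi0 : 0 < D⁻¹ := inv_pos.2 hDpos
  -- The regularization length decays only exponentially, so the logarithm of $D$ grows at most
  -- linearly in $\ell(v)$.
  have hlogD : Real.log D ≤ q + m * (p.a₁ + 1) + m * lg v := by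
    have h1 : D ≤ (1 + p.ε₀⁻¹) * Real.exp (m * max p.a₁ (v + 1)) := by
      refine (inv_one_sub_exp_neg_le (eps_pos hp _)).trans ?_
      rw [eps, mul_inv, ← Real.exp_neg]
      have : 1 ≤ Real.exp (m * max p.a₁ (v + 1)) :=
        Real.one_le_exp (mul_nonneg hmpos.le (ha.le.trans (le_max_left _ _)))
      rw [← hm, show -(-m * max p.a₁ (v + 1)) = m * max p.a₁ (v + 1) by ring]
      linarith
    have h2 := Real.log_le_log hDpos h1
    rw [Real.log_mul (by positivity) (by positivity), Real.log_exp] at h2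
    have h3 : max p.a₁ (v + 1) ≤ p.a₁ + 1 + lg v :=
      max_le (by linarith [lg_pos v]) (by linarith [self_le_lg v])
    nlinarith
  have i1 : IntegrableOn (fun _ : ℝ => D) (Ioc 0 D⁻¹) := by simp
  have i2 : IntegrableOn (fun r : ℝ => 2 * (1 / r)) (Ioc D⁻¹ 1) := by
    have : IntervalIntegrable (fun r : ℝ => 1 / r) volume D⁻¹ 1 := by
      refine intervalIntegral.intervalIntegrable_one_div (fun x hx => ?_) continuousOn_id
      rw [uIcc_of_le hDi] at hx
      exact (hDi0.trans_le hx.1).ne'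
    exact (((intervalIntegrable_iff_integrableOn_Ioc_of_le hDi).1 this)).const_mul 2
  have i3 : IntegrableOn (fun r : ℝ => 8 * Real.exp (-(1 / 2) * r)) (Ioi 0) :=
    integrableOn_exp_neg_half 8
  have j1 : IntegrableOn ((Ioc 0 D⁻¹).indicator fun _ : ℝ => D) (Ioi 0) :=
    ((integrable_indicator_iff measurableSet_Ioc).2 i1).integrableOn
  have j2 : IntegrableOn ((Ioc D⁻¹ 1).indicator fun r : ℝ => 2 * (1 / r)) (Ioi 0) :=
    ((integrable_indicator_iff measurableSet_Ioc).2 i2).integrableOn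
  refine ⟨fun r => (Ioc 0 D⁻¹).indicator (fun _ => D) r
    + (Ioc D⁻¹ 1).indicator (fun r => 2 * (1 / r)) r + 8 * Real.exp (-(1 / 2) * r),
    (j1.add j2).add i3, ?_, ?_⟩
  · have s1 : Ioi (0 : ℝ) ∩ Ioc 0 D⁻¹ = Ioc 0 D⁻¹ := inter_eq_right.2 Ioc_subset_Ioi_self
    have s2 : Ioi (0 : ℝ) ∩ Ioc D⁻¹ 1 = Ioc D⁻¹ 1 :=
      inter_eq_right.2 fun x hx => hDi0.trans hx.1
    have e1 := integral_add (j1.add j2) i3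
    simp only [Pi.add_apply] at e1
    beta_reduce
    rw [e1, integral_add j1 j2, setIntegral_indicator measurableSet_Ioc,
      setIntegral_indicator measurableSet_Ioc, s1, s2, integral_const_mul, integral_const_mul,
      integral_exp_neg_half, ← intervalIntegral.integral_of_le hDi,
      integral_one_div_of_pos hDi0 one_pos]
    simp only [integral_const, MeasurableSet.univ, measureReal_restrict_apply, univ_inter,
      Real.volume_real_Ioc, sub_zero, smul_eq_mul, one_div, inv_inv]
    rw [max_eq_left hDi0.le, inv_mul_cancel₀ hDpos.ne']
    have := lg_pos v
    nlinarith [mul_pos hqpos this, mul_pos hmpos this, mul_pos (mul_pos hmpos ha) this]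
  · intro r hr
    beta_reduce
    have hc := (cut_pos (eps_pos hp (v + r)) hr).le
    have e3 : 0 < 8 * Real.exp (-(1 / 2) * r) := by positivity
    rcases le_or_gt r 1 with h1 | h1
    · have hle1 : (1 + r) * Real.exp (-r) ≤ 1 := by
        calc (1 + r) * Real.exp (-r) ≤ Real.exp r * Real.exp (-r) := by
              gcongr; linarith [Real.add_one_le_exp r]
          _ = 1 := by rw [← Real.exp_add]; simp
      have hstart : (1 + r) * Real.exp (-r) * cut (p.eps (v + r)) r ≤ cut (p.eps (v + r)) r := by
        nlinarith
      rcases le_or_gt r D⁻¹ with h2 | h2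
      · have hA : cut (p.eps (v + r)) r ≤ D :=
          (cut_anti (eps_pos hp _) (eps_anti hp (by linarith)) hr).trans
            (cut_le_left (eps_pos hp (v + 1)) hr)
        rw [indicator_of_mem (show r ∈ Ioc 0 D⁻¹ from ⟨hr, h2⟩),
          indicator_of_notMem (show r ∉ Ioc D⁻¹ 1 from fun h => absurd h.1 (not_lt.2 h2))]
        linarith
      · have hA : cut (p.eps (v + r)) r ≤ 2 * (1 / r) := by
          refine (cut_le_right (eps_pos hp _) hr).trans ((inv_one_sub_exp_neg_le hr).trans ?_)
          have : 1 ≤ r⁻¹ := (one_le_inv₀ hr).2 h1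
          rw [one_div]; linarith
        rw [indicator_of_notMem (show r ∉ Ioc 0 D⁻¹ from fun h => absurd h.2 (not_le.2 h2)),
          indicator_of_mem (show r ∈ Ioc D⁻¹ 1 from ⟨h2, h1⟩)]
        linarith
    · have hA : cut (p.eps (v + r)) r ≤ 2 := by
        refine (cut_le_right (eps_pos hp _) hr).trans ((inv_one_sub_exp_neg_le hr).trans ?_)
        have : r⁻¹ ≤ 1 := inv_le_one_of_one_le₀ h1.le
        linarith
      rw [indicator_of_notMem (show r ∉ Ioc 0 D⁻¹ from fun h => absurd (h.2.trans hDi)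
        (not_le.2 h1)), indicator_of_notMem (show r ∉ Ioc D⁻¹ 1 from fun h => absurd h.2
        (not_le.2 h1))]
      have h4 : (1 + r) * Real.exp (-r) ≤ 4 * Real.exp (-(1 / 2) * r) :=
        one_add_mul_exp_neg_le.trans
          (mul_le_mul_of_nonneg_left (Real.exp_le_exp.2 (by linarith)) (by norm_num))
      have h5 : (1 + r) * Real.exp (-r) * cut (p.eps (v + r)) r
          ≤ 4 * Real.exp (-(1 / 2) * r) * 2 := mul_le_mul h4 hA hc (by positivity)
      linarith

/-- Use $\ell(v)$ up to $r=\max(v,0)\le\ell(v)$, and $e^{v-r}$ beyond; the tail integrates to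
$e^{\min(v,0)}\le2\ell(v)$. -/
lemma exists_lg_majorant (v : ℝ) : ∃ h : ℝ → ℝ, IntegrableOn h (Ioi 0) ∧
      (∫ r in Ioi (0 : ℝ), h r) ≤ lg v ^ 2 + 2 * lg v ∧ ∀ r, 0 < r → lg (v - r) ≤ h r := by
  set v' := max v 0 with hv'
  have h0 : 0 ≤ v' := le_max_right _ _
  have i1 : IntegrableOn (fun _ : ℝ => lg v) (Ioc 0 v') := by simp
  have i2 : IntegrableOn (fun r : ℝ => Real.exp v * Real.exp (-r)) (Ioi v') :=
    (integrableOn_exp_neg_Ioi v').const_mul _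
  have j1 : IntegrableOn ((Ioc 0 v').indicator fun _ : ℝ => lg v) (Ioi 0) :=
    ((integrable_indicator_iff measurableSet_Ioc).2 i1).integrableOn
  have j2 : IntegrableOn ((Ioi v').indicator fun r : ℝ => Real.exp v * Real.exp (-r)) (Ioi 0) :=
    ((integrable_indicator_iff measurableSet_Ioi).2 i2).integrableOn
  refine ⟨fun r => (Ioc 0 v').indicator (fun _ => lg v) r
    + (Ioi v').indicator (fun r => Real.exp v * Real.exp (-r)) r, j1.add j2, ?_, ?_⟩
  · have s1 : Ioi (0 : ℝ) ∩ Ioc 0 v' = Ioc 0 v' := inter_eq_right.2 Ioc_subset_Ioi_self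
    have s2 : Ioi (0 : ℝ) ∩ Ioi v' = Ioi v' :=
      inter_eq_right.2 fun x hx => h0.trans_lt hx
    rw [integral_add j1 j2, setIntegral_indicator measurableSet_Ioc,
      setIntegral_indicator measurableSet_Ioi, s1, s2, integral_const_mul, integral_exp_neg_Ioi]
    simp only [integral_const, MeasurableSet.univ, measureReal_restrict_apply, univ_inter,
      Real.volume_real_Ioc, sub_zero, smul_eq_mul]
    rw [max_eq_left h0, ← Real.exp_add]
    have h2 : v' ≤ lg v := max_le (self_le_lg v) (lg_nonneg v)
    have h3 : Real.exp (v + -v') ≤ 2 * lg v := by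
      rcases le_total v 0 with h | h
      · have := half_exp_le_lg h
        rw [hv', max_eq_right h]; simp; linarith
      · have := half_le_lg h
        rw [hv', max_eq_left h]; simp; linarith
    nlinarith [lg_nonneg v]
  · intro r hr
    beta_reduce
    rcases le_or_gt r v' with h | h
    · rw [indicator_of_mem (show r ∈ Ioc 0 v' from ⟨hr, h⟩),
        indicator_of_notMem (show r ∉ Ioi v' from not_lt.2 h), add_zero]
      exact lg_mono (by linarith)
    · rw [indicator_of_notMem (show r ∉ Ioc 0 v' from fun hh => absurd hh.2 (not_le.2 h)),
        indicator_of_mem (show r ∈ Ioi v' from h), zero_add, ← Real.exp_add]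
      exact lg_le_exp _

lemma integrableOn_kd {p : Params} (hp : p.Admissible) (v : ℝ) :
    IntegrableOn (p.kd v) (Ioi 0) := by
  have h := ((integrable_K3eps hp v).comp_sub_left v).integrableOn (s := Ioi 0)
  exact (integrableOn_congr_fun (fun r hr => K3eps_sub p v hr) measurableSet_Ioi).1 h

lemma integrableOn_ku {p : Params} (hp : p.Admissible) (v : ℝ) :
    IntegrableOn (p.ku v) (Ioi 0) := by
  have h := ((integrable_K3eps hp v).comp_add_left v).integrableOn (s := Ioi 0)
  exact (integrableOn_congr_fun (fun r hr => K3eps_add p v hr) measurableSet_Ioi).1 h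

lemma V_eq_kd_ku (p : Params) (v : ℝ) :
    p.V v = (∫ r in Ioi (0 : ℝ), p.kd v r) + ∫ r in Ioi (0 : ℝ), p.ku v r := by
  rw [V]
  congr 1
  · exact setIntegral_congr_fun measurableSet_Ioi fun r hr => K3eps_sub p v hr
  · exact setIntegral_congr_fun measurableSet_Ioi fun r hr => K3eps_add p v hr

/-- The singular parts carry $\ell^{-1/2}$ times an integral of order $1+\ell$, which is $W$. The
part without singularity carries $\ell^{-3/2}(\ell^2+2\ell)$, which is again of order $W$. -/
lemma exists_V_le {p : Params} (hp : p.Admissible) : ∃ C, 0 < C ∧ ∀ v, p.V v ≤ C * W v := by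
  obtain ⟨C, hC, hcut⟩ := exists_cut_majorant hp
  have hn := hp.nbar_pos
  refine ⟨32 * p.nbar * C + 16 * p.nbar, by positivity, fun v => ?_⟩
  obtain ⟨h, hi, hle, hh⟩ := hcut v
  obtain ⟨k, ki, kle, hk⟩ := exists_lg_majorant v
  set L := lg v ^ (-(1 / 2) : ℝ) with hL
  have hLpos : 0 < L := Real.rpow_pos_of_pos (lg_pos v) _
  have hA := A_pos hp v
  have h1 : ∫ r in Ioi (0 : ℝ), p.kd v r ≤ ∫ r in Ioi (0 : ℝ), (8 * p.nbar * L * h r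
      + 2 * p.A v * k r) := by
    refine setIntegral_mono_on (integrableOn_kd hp v)
      ((hi.const_mul _).add (ki.const_mul _)) measurableSet_Ioi fun r hr => ?_
    refine (kd_le hp v hr).trans ?_
    have hr' : 0 < r := hr
    have hc := (cut_pos (eps_pos hp (v + r)) hr').le
    gcongr
    · refine le_trans ?_ (hh r hr)
      have : Real.exp (-r) * cut (p.eps (v + r)) r ≥ 0 := by positivity
      nlinarith
    · exact hk r hr
  have h2 : ∫ r in Ioi (0 : ℝ), p.ku v r ≤ ∫ r in Ioi (0 : ℝ), 24 * p.nbar * L * h r := by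
    refine setIntegral_mono_on (integrableOn_ku hp v) (hi.const_mul _) measurableSet_Ioi
      fun r hr => ?_
    refine (ku_le hp v hr).trans ?_
    gcongr
    exact hh r hr
  rw [integral_add (hi.const_mul _) (ki.const_mul _), integral_const_mul,
    integral_const_mul] at h1
  rw [integral_const_mul] at h2
  rw [V_eq_kd_ku]
  have h3 : 32 * p.nbar * L * ∫ r in Ioi (0 : ℝ), h r ≤ 32 * p.nbar * C * W v := by
    calc _ ≤ 32 * p.nbar * L * (C * (1 + lg v)) := by gcongr
      _ = 32 * p.nbar * C * (L * (1 + lg v)) := by ring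
      _ = _ := by rw [hL, lg_rpow_mul]
  have h4 : 2 * p.A v * ∫ r in Ioi (0 : ℝ), k r ≤ 16 * p.nbar * W v := by
    calc _ ≤ 2 * p.A v * (lg v ^ 2 + 2 * lg v) := by gcongr
      _ = 2 * (p.A v * lg v ^ 2) + 4 * (p.A v * lg v) := by ring
      _ ≤ _ := by
        rw [A_mul_lg, A_mul_lg_sq, W]
        have := Real.rpow_pos_of_pos (lg_pos v) (1 / 2 : ℝ)
        nlinarith
  linarith

/-! ### The drift inequality -/

/-- With $y=e^{-r}$, the derivative of $(x+2y)/(1+x+y)$ in $x$ has the sign of $1-y\ge0$. -/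
lemma quot_mono {u u' r : ℝ} (h : u ≤ u') (hr : 0 ≤ r) : quot u r ≤ quot u' r := by
  have h1 : Real.exp u ≤ Real.exp u' := Real.exp_le_exp.2 h
  have h2 : Real.exp (-r) ≤ 1 := Real.exp_le_one_iff.2 (by linarith)
  have h3 := Real.exp_pos u
  have h4 := Real.exp_pos (-r)
  unfold quot
  rw [div_le_div_iff₀ (by positivity) (by positivity)]
  nlinarith

/-- The logarithmic derivative of $\ell$ at $z\le-1$ is at least $1/(1+e^z)\ge\frac23$, since
$e^z\le\frac12$. So $\ell(z)e^{-2z/3}$ increases there. -/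
lemma lg_le_mul_exp {x y : ℝ} (hxy : x ≤ y) (hy : y ≤ -1) :
    lg x ≤ lg y * Real.exp (-(2 / 3) * (y - x)) := by
  have hd : ∀ z : ℝ, HasDerivAt (fun z => lg z * Real.exp (-(2 / 3) * z))
      (Real.exp z / (1 + Real.exp z) * Real.exp (-(2 / 3) * z)
        + lg z * (Real.exp (-(2 / 3) * z) * (-(2 / 3) * 1))) z := fun z =>
    (((Real.hasDerivAt_exp z).const_add 1).log (by positivity)).mul
      (((hasDerivAt_id z).const_mul (-(2 / 3))).exp)
  have hmono : MonotoneOn (fun z => lg z * Real.exp (-(2 / 3) * z)) (Iic (-1)) := by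
    refine monotoneOn_of_deriv_nonneg (convex_Iic _)
      (fun z _ => (hd z).continuousAt.continuousWithinAt)
      (fun z _ => (hd z).differentiableAt.differentiableWithinAt) fun z hz => ?_
    rw [interior_Iic] at hz
    rw [(hd z).deriv]
    have h1 : Real.exp z ≤ 1 / 2 := by
      have h2 : Real.exp z ≤ Real.exp (-1) := Real.exp_le_exp.2 (le_of_lt hz)
      have h3 : (2 : ℝ) ≤ Real.exp 1 := by linarith [Real.add_one_le_exp (1 : ℝ)]
      rw [Real.exp_neg] at h2
      have h4 : (Real.exp 1)⁻¹ ≤ 2⁻¹ := inv_anti₀ (by norm_num) h3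
      linarith
    have h5 : 2 / 3 * lg z ≤ Real.exp z / (1 + Real.exp z) := by
      rw [le_div_iff₀ (by positivity)]
      have := lg_le_exp z
      have := lg_pos z
      nlinarith [Real.exp_pos z]
    have h6 := Real.exp_pos (-(2 / 3) * z)
    nlinarith
  have h := hmono (hxy.trans hy : x ≤ -1) hy hxy
  beta_reduce at h
  have h7 : lg x = lg x * Real.exp (-(2 / 3) * x) * Real.exp (2 / 3 * x) := by
    rw [mul_assoc, ← Real.exp_add]; ring_nf; simp
  rw [h7]
  calc _ ≤ lg y * Real.exp (-(2 / 3) * y) * Real.exp (2 / 3 * x) := by gcongr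
    _ = _ := by rw [mul_assoc, ← Real.exp_add]; ring_nf

/-- The two target points are $2r$ apart, so the ratio of the values of $\ell$ is at most
$e^{-4r/3}$. One factor $e^{-r}$ is already present in `ku`, and $e^{-r/3}$ remains. This surplus
beats the growth $e^{\alpha r}$ of the weight, as $\alpha<\frac13$. -/
lemma kd_le_ku_mul {p : Params} (hp : p.Admissible) {v r : ℝ} (hr : 0 < r) (hv : v + r ≤ -1) :
    p.kd v r ≤ p.ku v r * Real.exp (-(1 / 3) * r) := by
  have hA := (A_pos hp v).le
  have hc := (cut_pos (eps_pos hp v) hr).le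
  have hc' := (cut_pos (eps_pos hp (v + r)) hr).le
  have hq := (quot_pos (v - r) r).le
  have hq' := (quot_pos v r).le
  have hl := lg_nonneg (v + r)
  have h1 := lg_le_mul_exp (show v - r ≤ v + r by linarith) hv
  calc p.kd v r ≤ p.A v * (lg (v + r) * Real.exp (-(2 / 3) * (v + r - (v - r)))) * quot v r
        * cut (p.eps (v + r)) r := by
        unfold kd
        gcongr
        · exact quot_mono (by linarith) hr.le
        · exact cut_eps_le hp v hr
    _ = p.A v * lg (v + r) * quot v r * Real.exp (-r + -(1 / 3) * r) * cut (p.eps (v + r)) r := by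
        ring_nf
    _ = _ := by rw [Real.exp_add, ku]; ring

lemma integrableOn_kd_mul {p : Params} (hp : p.Admissible) (v : ℝ) :
    IntegrableOn (fun r => p.kd v r * (p.G (v - r) - p.G v)) (Ioi 0) := by
  have h := ((integrable_K3eps_mul_G hp v).comp_sub_left v).integrableOn (s := Ioi 0)
  have h2 := (integrableOn_congr_fun (g := fun r => p.kd v r * p.G (v - r)) (fun r hr => by
    beta_reduce; rw [K3eps_sub p v hr]) measurableSet_Ioi).1 h
  refine (h2.sub ((integrableOn_kd hp v).mul_const (p.G v))).congr (ae_of_all _ fun r => ?_)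
  simp only [Pi.sub_apply]; ring

lemma integrableOn_ku_mul {p : Params} (hp : p.Admissible) (v : ℝ) :
    IntegrableOn (fun r => p.ku v r * (p.G (v + r) - p.G v)) (Ioi 0) := by
  have h := ((integrable_K3eps_mul_G hp v).comp_add_left v).integrableOn (s := Ioi 0)
  have h2 := (integrableOn_congr_fun (g := fun r => p.ku v r * p.G (v + r)) (fun r hr => by
    beta_reduce; rw [K3eps_add p v hr]) measurableSet_Ioi).1 h
  refine (h2.sub ((integrableOn_ku hp v).mul_const (p.G v))).congr (ae_of_all _ fun r => ?_)
  simp only [Pi.sub_apply]; ring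

/-- Using $V=K1$, only increments of $G$ occur; they vanish at $r=0$ and absorb the singularity of
the kernel. -/
lemma Kop_G_sub {p : Params} (hp : p.Admissible) (v : ℝ) :
    p.Kop p.G v - p.V v * p.G v = ∫ r in Ioi (0 : ℝ),
      (p.kd v r * (p.G (v - r) - p.G v) + p.ku v r * (p.G (v + r) - p.G v)) := by
  have h1 := integrable_K3eps_mul_G hp v
  have h2 := (integrable_K3eps hp v).mul_const (p.G v)
  rw [integral_add (integrableOn_kd_mul hp v) (integrableOn_ku_mul hp v), V_eq_integral hp,
    ← integral_mul_const, Kop]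
  simp only [smul_eq_mul]
  have h3 := integral_eq_sub_add (h1.sub h2) v
  simp only [Pi.sub_apply] at h3
  rw [← integral_sub h1 h2, h3]
  congr 1
  · refine setIntegral_congr_fun measurableSet_Ioi fun r hr => ?_
    simp only [K3eps_sub p v hr]; ring
  · refine setIntegral_congr_fun measurableSet_Ioi fun r hr => ?_
    simp only [K3eps_add p v hr]; ring

/-- This bounds the loss from jumps to the right on the exponential that grows at $+\infty$. It is
free of $\varepsilon$ and only of order $\ell^{-1/2}$. -/
lemma ku_mul_exp_sub_le {p : Params} (hp : p.Admissible) (v : ℝ) {r : ℝ} (hr : 0 < r) :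
    p.ku v r * (Real.exp (p.μ * p.c₀ * r) - 1)
      ≤ 96 * p.nbar * lg v ^ (-(1 / 2) : ℝ) * Real.exp (-(1 / 2) * r) := by
  have hκ := hp.μc₀_lt
  have hκ' := hp.α_pos.trans hp.lt_μc₀
  have hn := hp.nbar_pos
  have hL := Real.rpow_pos_of_pos (lg_pos v) (-(1 / 2) : ℝ)
  have h0 : 0 ≤ Real.exp (p.μ * p.c₀ * r) - 1 := by
    have := Real.one_le_exp (show 0 ≤ p.μ * p.c₀ * r by positivity); linarith
  calc _ ≤ 24 * p.nbar * lg v ^ (-(1 / 2) : ℝ) * ((1 + r) * Real.exp (-r)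
        * cut (p.eps (v + r)) r) * (Real.exp (p.μ * p.c₀ * r) - 1) := by
        gcongr; exact ku_le hp v hr
    _ = 24 * p.nbar * lg v ^ (-(1 / 2) : ℝ) * ((1 + r) * Real.exp (-r))
        * (cut (p.eps (v + r)) r * (Real.exp (p.μ * p.c₀ * r) - 1)) := by ring
    _ ≤ 24 * p.nbar * lg v ^ (-(1 / 2) : ℝ) * (4 * Real.exp (-(3 / 4) * r))
        * Real.exp (p.μ * p.c₀ * r) := by
        refine mul_le_mul ?_ (cut_mul_exp_sub_le (eps_pos hp _) hr (by linarith)) ?_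
          (by positivity)
        · gcongr _ * ?_
          exact one_add_mul_exp_neg_le
        · exact mul_nonneg (cut_pos (eps_pos hp _) hr).le h0
    _ = 96 * p.nbar * lg v ^ (-(1 / 2) : ℝ)
        * Real.exp (-(3 / 4) * r + p.μ * p.c₀ * r) := by rw [Real.exp_add]; ring
    _ ≤ _ := by gcongr; nlinarith

lemma G_sub_sub_le {p : Params} (hp : p.Admissible) (v : ℝ) {r : ℝ} (hr : 0 < r) :
    p.G (v - r) - p.G v ≤ Real.exp (-p.α * v) * (Real.exp (p.α * r) - 1) := by
  have h : Real.exp (p.μ * p.c₀ * (v - r)) ≤ Real.exp (p.μ * p.c₀ * v) := by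
    have := hp.α_pos.trans hp.lt_μc₀
    gcongr; linarith
  have h2 : Real.exp (-p.α * (v - r)) = Real.exp (-p.α * v) * Real.exp (p.α * r) := by
    rw [← Real.exp_add]; ring_nf
  unfold G
  rw [h2]; linarith

/-! ### The drift at $-\infty$. -/

/-- The part of the drift that decides at `-∞`. -/
lemma exists_left_bracket {p : Params} (hp : p.Admissible) :
    ∃ c, 0 < c ∧ ∀ v, v ≤ -2 → ∀ r, 0 < r →
      p.kd v r * (Real.exp (p.α * r) - 1) - p.ku v r * (1 - Real.exp (-(p.α * r)))
        ≤ (Icc (1 / 2) 1).indicator (fun _ => -(c * lg v ^ (-(1 / 2) : ℝ))) r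
          + 96 * p.nbar * Real.exp (-r) := by
  have hα := hp.α_pos
  have hα' := hp.α_lt
  have hn := hp.nbar_pos
  -- The gap in the rates: $e^{-r/3}(e^{\alpha r}-1)=(1-e^{-\alpha r})e^{-sr}$, so the bracket is at
  -- most $-\mathtt{ku}\,(1-e^{-\alpha r})(1-e^{-sr})$.
  set s := 1 / 3 - p.α with hs
  have hspos : 0 < s := by linarith
  have hc1 := one_sub_exp_neg_pos (show 0 < p.α * (1 / 2) by positivity)
  have hc2 := one_sub_exp_neg_pos (show 0 < s * (1 / 2) by positivity)
  -- On $[\frac12,1]$ `quot` is at least $\frac23e^{-1}$ and $e^{-r}$ is at least $e^{-1}$; the last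
  -- two factors are the increasing ones taken at $r=\frac12$.
  refine ⟨4 * p.nbar * (2 / 3 * Real.exp (-1)) * Real.exp (-1)
    * (1 - Real.exp (-(p.α * (1 / 2)))) * (1 - Real.exp (-(s * (1 / 2)))), by positivity, ?_⟩
  intro v hv r hr
  set L := lg v ^ (-(1 / 2) : ℝ) with hL
  have hLpos : 0 < L := Real.rpow_pos_of_pos (lg_pos v) _
  have hkd := (kd_pos hp v hr).le
  have hku := (ku_pos hp v hr).le
  have hαr : 0 ≤ Real.exp (p.α * r) - 1 := by
    have := Real.one_le_exp (show 0 ≤ p.α * r by positivity); linarith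
  have hαr' := one_sub_exp_neg_nonneg (show 0 ≤ p.α * r by positivity)
  have e0 : 0 < 96 * p.nbar * Real.exp (-r) := by positivity
  have hA := A_pos hp v
  rcases le_or_gt (v + r) (-1) with h | h
  · have hmain : p.kd v r * (Real.exp (p.α * r) - 1) - p.ku v r * (1 - Real.exp (-(p.α * r)))
        ≤ -(p.ku v r * (1 - Real.exp (-(p.α * r))) * (1 - Real.exp (-(s * r)))) := by
      have h1 : p.kd v r * (Real.exp (p.α * r) - 1)
          ≤ p.ku v r * Real.exp (-(1 / 3) * r) * (Real.exp (p.α * r) - 1) := by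
        gcongr; exact kd_le_ku_mul hp hr h
      have h2 : Real.exp (-(1 / 3) * r) * (Real.exp (p.α * r) - 1)
          = (1 - Real.exp (-(p.α * r))) * Real.exp (-(s * r)) := by
        rw [mul_sub, sub_mul, ← Real.exp_add, ← Real.exp_add, hs]; ring_nf
      rw [mul_assoc, h2] at h1
      linarith
    have hneg : 0 ≤ p.ku v r * (1 - Real.exp (-(p.α * r))) * (1 - Real.exp (-(s * r))) :=
      mul_nonneg (mul_nonneg hku hαr') (one_sub_exp_neg_nonneg (by positivity))
    by_cases hI : r ∈ Icc (1 / 2 : ℝ) 1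
    · rw [indicator_of_mem hI]
      have hkul : 4 * p.nbar * L * (2 / 3 * Real.exp (-1)) * Real.exp (-1) ≤ p.ku v r := by
        have hq : 2 / 3 * Real.exp (-1) ≤ quot v r := by
          have h1 : Real.exp v ≤ 1 := Real.exp_le_one_iff.2 (by linarith)
          have h2 : Real.exp (-r) ≤ 1 := Real.exp_le_one_iff.2 (by linarith)
          have h3 : Real.exp (-1) ≤ Real.exp (-r) := Real.exp_le_exp.2 (by linarith [hI.2])
          unfold quot
          rw [le_div_iff₀ (by positivity)]
          nlinarith [Real.exp_pos v, Real.exp_pos (-1), Real.exp_pos (-r)]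
        have hq0 := quot_pos v r
        have hl0 := lg_nonneg v
        have hl1 := lg_nonneg (v + r)
        calc 4 * p.nbar * L * (2 / 3 * Real.exp (-1)) * Real.exp (-1)
            = p.A v * lg v * (2 / 3 * Real.exp (-1)) * Real.exp (-1) * 1 := by
              rw [A_mul_lg]; ring
          _ ≤ p.A v * lg (v + r) * quot v r * Real.exp (-r) * cut (p.eps (v + r)) r := by
              gcongr
              · exact lg_mono (by linarith)
              · exact hI.2
              · exact one_le_cut (eps_pos hp _) hr
          _ = _ := rfl
      have h3 : 1 - Real.exp (-(p.α * (1 / 2))) ≤ 1 - Real.exp (-(p.α * r)) := by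
        gcongr; exact hI.1
      have h4 : 1 - Real.exp (-(s * (1 / 2))) ≤ 1 - Real.exp (-(s * r)) := by
        gcongr; exact hI.1
      have h5 := mul_le_mul (mul_le_mul hkul h3 hc1.le hku) h4 hc2.le (mul_nonneg hku hαr')
      linarith
    · rw [indicator_of_notMem hI]
      linarith
  -- Now $r>-1-v$. The `ku` term is dropped by its sign. In the `kd` term part of the decay
  -- $e^{-2r+\alpha r}$ is traded for $e^{(v+1)/2}$, which compensates the growth of
  -- $L\le2e^{-v/2}$.
  · have hI : r ∉ Icc (1 / 2 : ℝ) 1 := fun hI => by linarith [hI.2]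
    rw [indicator_of_notMem hI, zero_add]
    have hLe : L * Real.exp (v / 2) ≤ 2 := by
      have h1 : L ≤ (Real.exp v / 2) ^ (-(1 / 2) : ℝ) :=
        Real.rpow_le_rpow_of_nonpos (by positivity) (half_exp_le_lg (by linarith)) (by norm_num)
      have h2 : (Real.exp v / 2) ^ (-(1 / 2) : ℝ) ≤ 2 * Real.exp (-(v / 2)) := by
        rw [Real.div_rpow (Real.exp_pos v).le zero_le_two, ← Real.exp_mul,
          Real.rpow_neg zero_le_two, div_inv_eq_mul, mul_comm, show v * -(1 / 2) = -(v / 2) by ring]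
        gcongr
        calc (2 : ℝ) ^ (1 / 2 : ℝ) ≤ 2 ^ (1 : ℝ) :=
              Real.rpow_le_rpow_of_exponent_le one_le_two (by norm_num)
          _ = 2 := Real.rpow_one 2
      calc L * Real.exp (v / 2) ≤ 2 * Real.exp (-(v / 2)) * Real.exp (v / 2) := by
            gcongr; exact h1.trans h2
        _ = 2 := by rw [mul_assoc, ← Real.exp_add]; simp
    have hexp2 : Real.exp (1 / 2) ≤ 2 := by
      have h1 : Real.exp (1 / 2) ^ 2 ≤ 2 ^ 2 := by
        rw [← Real.exp_nat_mul]
        have := Real.exp_one_lt_d9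
        norm_num
        linarith
      exact le_of_sq_le_sq h1 (by norm_num)
    have hkd2 : p.kd v r * (Real.exp (p.α * r) - 1) ≤ 96 * p.nbar * Real.exp (-r) := by
      have hl : lg (v - r) ≤ 2 * lg v * Real.exp (-r) := by
        have := half_exp_le_lg (show v ≤ 0 by linarith)
        refine (lg_le_exp _).trans ?_
        rw [sub_eq_add_neg, Real.exp_add]
        gcongr; linarith
      have hq : quot (v - r) r ≤ 3 * Real.exp (-r) := by
        refine (quot_le _ _).trans ?_
        have : Real.exp v ≤ 1 := Real.exp_le_one_iff.2 (by linarith)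
        rw [sub_eq_add_neg, Real.exp_add]
        nlinarith [Real.exp_pos (-r)]
      have hq0 := (quot_pos (v - r) r).le
      have hl0 := lg_nonneg v
      have hl1 := lg_nonneg (v - r)
      calc p.kd v r * (Real.exp (p.α * r) - 1)
          = p.A v * lg (v - r) * quot (v - r) r * (cut (p.eps v) r * (Real.exp (p.α * r) - 1)) := by
            unfold kd; ring
        _ ≤ p.A v * (2 * lg v * Real.exp (-r)) * (3 * Real.exp (-r)) * Real.exp (p.α * r) := by
            gcongr
            · exact mul_nonneg (cut_pos (eps_pos hp v) hr).le hαr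
            · exact cut_mul_exp_sub_le (eps_pos hp v) hr (by linarith)
        _ = 6 * (p.A v * lg v) * Real.exp (-r + -r + p.α * r) := by
            rw [Real.exp_add, Real.exp_add]; ring
        _ = 24 * p.nbar * L * Real.exp (-r + -r + p.α * r) := by rw [A_mul_lg]; ring
        _ ≤ 24 * p.nbar * L * Real.exp (v / 2 + 1 / 2 + -r) := by
            gcongr _ * Real.exp ?_
            nlinarith
        _ = 24 * p.nbar * (L * Real.exp (v / 2)) * Real.exp (1 / 2) * Real.exp (-r) := by
            rw [Real.exp_add, Real.exp_add]; ring
        _ ≤ 24 * p.nbar * 2 * 2 * Real.exp (-r) := by gcongr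
        _ = _ := by ring
    have : 0 ≤ p.ku v r * (1 - Real.exp (-(p.α * r))) := mul_nonneg hku hαr'
    linarith

lemma integrableOn_exp_neg_one (c : ℝ) : IntegrableOn (fun r : ℝ => c * Real.exp (-r)) (Ioi 0) :=
  (integrableOn_exp_neg_Ioi 0).const_mul c

lemma tendsto_lg_rpow_atBot : Tendsto (fun v => lg v ^ (-(1 / 2) : ℝ)) atBot atTop := by
  have h : Tendsto (fun v : ℝ => Real.exp (-(1 / 2) * v)) atBot atTop :=
    Real.tendsto_exp_atTop.comp (tendsto_id.const_mul_atBot_of_neg (by norm_num))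
  refine tendsto_atTop_mono (fun v => ?_) h
  have := Real.rpow_le_rpow_of_nonpos (lg_pos v) (lg_le_exp v) (by norm_num : -(1 / 2 : ℝ) ≤ 0)
  rwa [← Real.exp_mul, mul_comm] at this

lemma tendsto_lg_rpow_atTop : Tendsto (fun v => lg v ^ (1 / 2 : ℝ)) atTop atTop :=
  (tendsto_rpow_atTop (by norm_num)).comp (tendsto_atTop_mono self_le_lg tendsto_id)

lemma W_le_of_lg_le {v : ℝ} (h : lg v ≤ 1) : W v ≤ 2 * lg v ^ (-(1 / 2) : ℝ) := by
  have := Real.rpow_le_rpow_of_exponent_ge (lg_pos v) h (by norm_num : -(1 / 2 : ℝ) ≤ 1 / 2)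
  unfold W; linarith

lemma W_le_of_le_lg {v : ℝ} (h : 1 ≤ lg v) : W v ≤ 2 * lg v ^ (1 / 2 : ℝ) := by
  have := Real.rpow_le_rpow_of_exponent_le h (by norm_num : -(1 / 2 : ℝ) ≤ 1 / 2)
  unfold W; linarith

lemma exists_drift_atBot {p : Params} (hp : p.Admissible) :
    ∃ c, 0 < c ∧ ∀ᶠ v in atBot, p.Kop p.G v - p.V v * p.G v ≤ -(c * (W v * p.G v)) := by
  obtain ⟨c, hc, hbr⟩ := exists_left_bracket hp
  have hn := hp.nbar_pos
  have hα := hp.α_pos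
  have hκ := hp.α_pos.trans hp.lt_μc₀
  -- The window has length $\frac12$ and yields $-\frac c2L$. Two errors of at most $\frac c8L$
  -- leave $-\frac c4L$, to be compared with $WG\le4Le^{-\alpha v}$.
  refine ⟨c / 16, by positivity, ?_⟩
  have hsmall : Tendsto (fun v : ℝ => 192 * p.nbar * Real.exp ((p.μ * p.c₀ + p.α) * v))
      atBot (𝓝 (192 * p.nbar * 0)) :=
    (Real.tendsto_exp_atBot.comp (tendsto_id.const_mul_atBot (by positivity))).const_mul _
  rw [mul_zero] at hsmall
  filter_upwards [eventually_le_atBot (-2 : ℝ),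
    hsmall.eventually (eventually_le_nhds (show (0 : ℝ) < c / 8 by positivity)),
    tendsto_lg_rpow_atBot.eventually (eventually_ge_atTop (96 * p.nbar / (c / 8)))] with v hv h1 h2
  set L := lg v ^ (-(1 / 2) : ℝ) with hL
  have hLpos : 0 < L := Real.rpow_pos_of_pos (lg_pos v) _
  rw [div_le_iff₀ (by positivity)] at h2
  have i1 : IntegrableOn ((Icc (1 / 2 : ℝ) 1).indicator fun _ : ℝ => -(c * L)) (Ioi 0) :=
    ((integrable_indicator_iff measurableSet_Icc).2 continuous_const.integrableOn_Icc).integrableOn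
  have i2 : IntegrableOn (fun r : ℝ => 96 * p.nbar * Real.exp (-r)) (Ioi 0) :=
    integrableOn_exp_neg_one _
  have i3 := integrableOn_exp_neg_half (96 * p.nbar * L)
  have i12 := integral_add i1 i2
  have i123 := integral_add ((i1.add i2).const_mul (Real.exp (-p.α * v)))
    (i3.const_mul (Real.exp (p.μ * p.c₀ * v)))
  simp only [Pi.add_apply] at i12 i123
  have hint := Kop_G_sub hp v
  have hle : p.Kop p.G v - p.V v * p.G v ≤ Real.exp (-p.α * v) * (-(c / 2) * L + 96 * p.nbar)
      + Real.exp (p.μ * p.c₀ * v) * (192 * p.nbar * L) := by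
    calc p.Kop p.G v - p.V v * p.G v
        ≤ ∫ r in Ioi (0 : ℝ), (Real.exp (-p.α * v) * ((Icc (1 / 2) 1).indicator
            (fun _ => -(c * L)) r + 96 * p.nbar * Real.exp (-r))
            + Real.exp (p.μ * p.c₀ * v) * (96 * p.nbar * L * Real.exp (-(1 / 2) * r))) := by
          rw [hint]
          refine setIntegral_mono_on ((integrableOn_kd_mul hp v).add (integrableOn_ku_mul hp v))
            (((i1.add i2).const_mul _).add (i3.const_mul _)) measurableSet_Ioi fun r hr => ?_
          have g1 := mul_le_mul_of_nonneg_left (G_sub_sub_le hp v hr) (kd_pos hp v hr).le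
          have g2 := mul_le_mul_of_nonneg_left (hbr v hv r hr) (Real.exp_pos (-p.α * v)).le
          have g3 := mul_le_mul_of_nonneg_left (ku_mul_exp_sub_le hp v hr)
            (Real.exp_pos (p.μ * p.c₀ * v)).le
          have g4 : p.G (v + r) - p.G v
              = -(Real.exp (-p.α * v) * (1 - Real.exp (-(p.α * r))))
                + Real.exp (p.μ * p.c₀ * v) * (Real.exp (p.μ * p.c₀ * r) - 1) := by
            unfold G
            rw [mul_add, mul_add, Real.exp_add, Real.exp_add, neg_mul p.α r]; ring
          rw [g4]
          linarith
      _ = _ := by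
          rw [i123, integral_const_mul, integral_const_mul, i12, integral_const_mul,
            integral_const_mul, integral_exp_neg_half, integral_exp_neg_Ioi_zero,
            setIntegral_indicator measurableSet_Icc, inter_eq_right.2 (fun x hx => by
              have := hx.1; simp only [mem_Ioi]; linarith)]
          simp only [integral_const, MeasurableSet.univ, measureReal_restrict_apply, univ_inter,
            Real.volume_real_Icc, smul_eq_mul]
          rw [max_eq_left (by norm_num)]
          ring
  have hGle : p.G v ≤ 2 * Real.exp (-p.α * v) := by
    have : Real.exp (p.μ * p.c₀ * v) ≤ Real.exp (-p.α * v) := by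
      apply Real.exp_le_exp.2; nlinarith
    unfold G; linarith
  have hlg : lg v ≤ 1 := (lg_le_exp v).trans (Real.exp_le_one_iff.2 (by linarith))
  have hWle := W_le_of_lg_le hlg
  have hWG : W v * p.G v ≤ 4 * L * Real.exp (-p.α * v) := by
    calc _ ≤ (2 * L) * (2 * Real.exp (-p.α * v)) :=
          mul_le_mul hWle hGle (G_pos p v).le (by positivity)
      _ = _ := by ring
  have hk : Real.exp (p.μ * p.c₀ * v) * (192 * p.nbar * L) ≤ Real.exp (-p.α * v) * (c / 8 * L) := by
    have : Real.exp (p.μ * p.c₀ * v)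
        = Real.exp (-p.α * v) * Real.exp ((p.μ * p.c₀ + p.α) * v) := by
      rw [← Real.exp_add]; congr 1; ring
    rw [this, mul_assoc]
    refine mul_le_mul_of_nonneg_left ?_ (Real.exp_pos _).le
    calc _ = 192 * p.nbar * Real.exp ((p.μ * p.c₀ + p.α) * v) * L := by ring
      _ ≤ _ := by gcongr
  have e0 := Real.exp_pos (-p.α * v)
  have hm : Real.exp (-p.α * v) * (-(c / 2) * L + 96 * p.nbar)
      ≤ Real.exp (-p.α * v) * (-(3 * c / 8) * L) := by
    gcongr; linarith
  have hf : c / 16 * (W v * p.G v) ≤ c / 16 * (4 * L * Real.exp (-p.α * v)) := by gcongr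
  linarith

/-! ### The drift at $+\infty$. -/

lemma integrable_of_le_exp_abs {f : ℝ → ℝ} (hf : AEStronglyMeasurable f) {C s : ℝ} (hs : 0 < s)
    (hb : ∀ w, ‖f w‖ ≤ C * Real.exp (-(s * |w|))) : Integrable f := by
  refine Integrable.mono' (Integrable.const_mul (integrable_of_sub_add 0 ?_ ?_) C) hf
    (ae_of_all _ hb)
  · refine (integrableOn_congr_fun (fun r hr => ?_) measurableSet_Ioi).1
      (exp_neg_integrableOn_Ioi 0 hs)
    simp only [zero_sub, abs_neg]
    rw [abs_of_pos (mem_Ioi.1 hr), neg_mul]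
  · refine (integrableOn_congr_fun (fun r hr => ?_) measurableSet_Ioi).1
      (exp_neg_integrableOn_Ioi 0 hs)
    simp only [zero_add]
    rw [abs_of_pos (mem_Ioi.1 hr), neg_mul]

lemma integrable_lg_mul_exp {s : ℝ} (hs : 0 < s) (hs1 : s < 1 / 2) :
    Integrable fun w => lg w * Real.exp (-(s * w)) := by
  have hc : Continuous fun w => lg w * Real.exp (-(s * w)) := by
    have := continuous_lg
    fun_prop
  refine integrable_of_le_exp_abs hc.aestronglyMeasurable (C := 1 + 2 / s)
    (by positivity : 0 < s / 2) fun w => ?_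
  rw [Real.norm_of_nonneg (mul_nonneg (lg_nonneg _) (Real.exp_pos _).le)]
  rcases le_total w 0 with h | h
  · rw [abs_of_nonpos h]
    calc lg w * Real.exp (-(s * w)) ≤ Real.exp w * Real.exp (-(s * w)) := by
          gcongr; exact lg_le_exp w
      _ = Real.exp (w + -(s * w)) := (Real.exp_add _ _).symm
      _ ≤ 1 * Real.exp (-(s / 2 * -w)) := by rw [one_mul]; gcongr; nlinarith
      _ ≤ _ := by gcongr; linarith [show 0 < 2 / s by positivity]
  · rw [abs_of_nonneg h]
    have h1 : w ≤ 2 / s * Real.exp (s / 2 * w) := by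
      have := Real.add_one_le_exp (s / 2 * w)
      have h2 : w = 2 / s * (s / 2 * w) := by field_simp
      nth_rewrite 1 [h2]
      gcongr; linarith
    have h3 : lg w ≤ (1 + 2 / s) * Real.exp (s / 2 * w) := by
      have := Real.one_le_exp (show 0 ≤ s / 2 * w by positivity)
      linarith [lg_le_add_one h]
    calc _ ≤ (1 + 2 / s) * Real.exp (s / 2 * w) * Real.exp (-(s * w)) := by gcongr
      _ = _ := by rw [mul_assoc, ← Real.exp_add]; ring_nf

/-- The pointwise form of the drift inequality for large arguments. -/
lemma drift_integrand_le {p : Params} (hp : p.Admissible) {v : ℝ} (hv : 1 ≤ v) {r : ℝ}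
    (hr : 0 < r) :
    p.kd v r * (p.G (v - r) - p.G v) + p.ku v r * (p.G (v + r) - p.G v)
      ≤ Real.exp (p.μ * p.c₀ * v) * ((Icc (v / 4) (v / 2)).indicator
          (fun _ => -(p.A v * (v / 2) * (1 / 3) * (1 - Real.exp (-(p.μ * p.c₀ * (1 / 4)))))) r
            + 96 * p.nbar * Real.exp (-(1 / 2) * r))
          + (8 * p.nbar * Real.exp (-(1 / 2) * r)
            + 8 * p.nbar * (lg (v - r) * Real.exp (-(p.α * (v - r))))) := by
  have hn := hp.nbar_pos
  have hα := hp.α_pos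
  have hα' := hp.α_lt
  have hκ := hp.α_pos.trans hp.lt_μc₀
  set k := p.μ * p.c₀ with hk
  have hc3 := one_sub_exp_neg_pos (show 0 < k * (1 / 4) by positivity)
  set c3 := 1 - Real.exp (-(k * (1 / 4))) with hc3d
  have hlg1 : 1 ≤ lg v := hv.trans (self_le_lg v)
  set L := lg v ^ (-(1 / 2) : ℝ) with hL
  have hLpos : 0 < L := Real.rpow_pos_of_pos (lg_pos v) _
  have hL1 : L ≤ 1 := Real.rpow_le_one_of_one_le_of_nonpos hlg1 (by norm_num)
  have hA := A_pos hp v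
  have hA1 : p.A v ≤ 4 * p.nbar := by
    have : lg v ^ (-(3 / 2) : ℝ) ≤ 1 := Real.rpow_le_one_of_one_le_of_nonpos hlg1 (by norm_num)
    unfold A; nlinarith
  have heα : Real.exp (-p.α * v) ≤ 1 := Real.exp_le_one_iff.2 (by nlinarith)
  have hr0 : 0 < r := hr
  have hkd := (kd_pos hp v hr).le
  have hαr : 0 ≤ Real.exp (p.α * r) - 1 := by
    have := Real.one_le_exp (show 0 ≤ p.α * r by positivity); linarith
  have hkr := one_sub_exp_neg_nonneg (show 0 ≤ k * r by positivity)
  have g3 : p.ku v r * (Real.exp (k * r) - 1) ≤ 96 * p.nbar * Real.exp (-(1 / 2) * r) := by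
    refine (ku_mul_exp_sub_le hp v hr).trans ?_
    refine mul_le_mul_of_nonneg_right ?_ (Real.exp_pos _).le
    exact mul_le_of_le_one_right (by positivity) hL1
  -- The gain is kept only for $v/4\le r\le v/2$. There $\ell(v-r)\ge v/2$, `quot` is at least
  -- $\frac13$, and the increment of the weight is bounded below because $r\ge\frac14$.
  have g5 : -(p.kd v r * (1 - Real.exp (-(k * r))))
      ≤ (Icc (v / 4) (v / 2)).indicator
        (fun _ => -(p.A v * (v / 2) * (1 / 3) * c3)) r := by
    by_cases hI : r ∈ Icc (v / 4) (v / 2)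
    · rw [indicator_of_mem hI, neg_le_neg_iff]
      have hl : v / 2 ≤ lg (v - r) := by linarith [self_le_lg (v - r), hI.2]
      have hq : 1 / 3 ≤ quot (v - r) r := by
        have h1 : 1 ≤ Real.exp (v - r) := Real.one_le_exp (by linarith [hI.2])
        have h2 : Real.exp (-r) ≤ 1 := Real.exp_le_one_iff.2 (by linarith)
        unfold quot
        rw [le_div_iff₀ (by positivity)]
        linarith [Real.exp_pos (-r)]
      have hq0 := quot_pos (v - r) r
      have hl0 := lg_nonneg (v - r)
      have hc : c3 ≤ 1 - Real.exp (-(k * r)) := by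
        rw [hc3d]; gcongr; linarith [hI.1]
      calc p.A v * (v / 2) * (1 / 3) * c3
          = p.A v * (v / 2) * (1 / 3) * 1 * c3 := by ring
        _ ≤ p.A v * lg (v - r) * quot (v - r) r * cut (p.eps v) r
            * (1 - Real.exp (-(k * r))) := by
          gcongr
          exact one_le_cut (eps_pos hp v) hr0
        _ = _ := rfl
    · rw [indicator_of_notMem hI, neg_nonpos]
      exact mul_nonneg hkd hkr
  have g6 : Real.exp (-p.α * v) * (p.kd v r * (Real.exp (p.α * r) - 1))
      ≤ 8 * p.nbar * Real.exp (-(1 / 2) * r)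
      + 8 * p.nbar * (lg (v - r) * Real.exp (-(p.α * (v - r)))) := by
    have hl0 := lg_nonneg (v - r)
    have t1 : p.kd v r * (Real.exp (p.α * r) - 1)
        ≤ 8 * p.nbar * L * Real.exp (-r) * Real.exp (p.α * r)
          + 2 * p.A v * lg (v - r) * Real.exp (p.α * r) := by
      calc p.kd v r * (Real.exp (p.α * r) - 1)
          ≤ (8 * p.nbar * L * (Real.exp (-r) * cut (p.eps (v + r)) r)
            + 2 * p.A v * lg (v - r)) * (Real.exp (p.α * r) - 1) := by
            gcongr; exact kd_le hp v hr0
        _ = 8 * p.nbar * L * Real.exp (-r)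
            * (cut (p.eps (v + r)) r * (Real.exp (p.α * r) - 1))
            + 2 * p.A v * lg (v - r) * (Real.exp (p.α * r) - 1) := by ring
        _ ≤ _ := by
            gcongr
            · exact cut_mul_exp_sub_le (eps_pos hp _) hr0 (by linarith)
            · linarith
    have t2 : Real.exp (-p.α * v) * (8 * p.nbar * L * Real.exp (-r) * Real.exp (p.α * r))
        ≤ 8 * p.nbar * Real.exp (-(1 / 2) * r) := by
      calc _ ≤ 1 * (8 * p.nbar * 1 * Real.exp (-r) * Real.exp (p.α * r)) := by gcongr
        _ = 8 * p.nbar * Real.exp (-r + p.α * r) := by rw [Real.exp_add]; ring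
        _ ≤ _ := by gcongr; nlinarith
    have t3 : Real.exp (-p.α * v) * (2 * p.A v * lg (v - r) * Real.exp (p.α * r))
        ≤ 8 * p.nbar * (lg (v - r) * Real.exp (-(p.α * (v - r)))) := by
      have : Real.exp (-p.α * v) * Real.exp (p.α * r) = Real.exp (-(p.α * (v - r))) := by
        rw [← Real.exp_add]; ring_nf
      calc _ = 2 * p.A v * (lg (v - r)
            * (Real.exp (-p.α * v) * Real.exp (p.α * r))) := by ring
        _ ≤ 2 * (4 * p.nbar) * (lg (v - r) * Real.exp (-(p.α * (v - r)))) := by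
            rw [this]; gcongr
        _ = _ := by ring
    have t4 := mul_le_mul_of_nonneg_left t1 (Real.exp_pos (-p.α * v)).le
    linarith
  have g7 : p.G (v - r) - p.G v = Real.exp (-p.α * v) * (Real.exp (p.α * r) - 1)
      - Real.exp (k * v) * (1 - Real.exp (-(k * r))) := by
    have s1 : Real.exp (-p.α * (v - r)) = Real.exp (-p.α * v) * Real.exp (p.α * r) := by
      rw [← Real.exp_add]; congr 1; ring
    have s2 : Real.exp (k * (v - r)) = Real.exp (k * v) * Real.exp (-(k * r)) := by
      rw [← Real.exp_add]; congr 1; ring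
    rw [G, G, ← hk, s1, s2]
    ring
  have g8 : p.G (v + r) - p.G v ≤ Real.exp (k * v) * (Real.exp (k * r) - 1) := by
    have : Real.exp (-p.α * (v + r)) ≤ Real.exp (-p.α * v) :=
      Real.exp_le_exp.2 (by nlinarith)
    unfold G
    rw [mul_sub, ← Real.exp_add, ← hk, mul_add k]
    linarith
  have g9 := mul_le_mul_of_nonneg_left g8 (ku_pos hp v hr).le
  have g10 := mul_le_mul_of_nonneg_left (add_le_add g5 g3) (Real.exp_pos (k * v)).le
  rw [g7]
  linarith

lemma exists_drift_atTop {p : Params} (hp : p.Admissible) :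
    ∃ c C, 0 < c ∧ 0 ≤ C ∧
      ∀ᶠ v in atTop, p.Kop p.G v - p.V v * p.G v ≤ -(c * (W v * p.G v)) + C := by
  have hn := hp.nbar_pos
  have hα := hp.α_pos
  have hα' := hp.α_lt
  have hκ := hp.α_pos.trans hp.lt_μc₀
  set k := p.μ * p.c₀ with hk
  have hc3 := one_sub_exp_neg_pos (show 0 < k * (1 / 4) by positivity)
  set c3 := 1 - Real.exp (-(k * (1 / 4))) with hc3d
  -- The window has length $v/4$, so the gain is $A(v)v^2c_3/24$; and $A(v)v^2\ge\bar
  -- n\,\ell(v)^{1/2}$ because $\ell(v)\le2v$.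
  set c4 := p.nbar * c3 / 24 with hc4
  have hc4pos : 0 < c4 := by positivity
  set J := ∫ w, lg w * Real.exp (-(p.α * w)) with hJ
  have hJint := integrable_lg_mul_exp hα (by linarith)
  have hJ0 : 0 ≤ J := integral_nonneg fun w => mul_nonneg (lg_nonneg _) (Real.exp_pos _).le
  -- The additive constant collects the effect of left jumps on $e^{-\alpha v}$, whose increase has
  -- a bounded integral for $v\ge1$. Half of $c_4$ absorbs the loss from right jumps, and
  -- $WG\le4Se^{kv}$ turns the other half into $c_4/8$.
  refine ⟨c4 / 8, 16 * p.nbar + 8 * p.nbar * J, by positivity, by positivity, ?_⟩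
  filter_upwards [eventually_ge_atTop (1 : ℝ), tendsto_lg_rpow_atTop.eventually
    (eventually_ge_atTop (192 * p.nbar / (c4 / 2)))] with v hv h2
  rw [div_le_iff₀ (by positivity)] at h2
  have hlg1 : 1 ≤ lg v := hv.trans (self_le_lg v)
  set S := lg v ^ (1 / 2 : ℝ) with hS
  have hSpos : 0 < S := Real.rpow_pos_of_pos (lg_pos v) _
  have hA := A_pos hp v
  have hJv : IntegrableOn (fun r => lg (v - r) * Real.exp (-(p.α * (v - r)))) (Ioi 0) :=
    (hJint.comp_sub_left v).integrableOn
  have hJle : ∫ r in Ioi (0 : ℝ), lg (v - r) * Real.exp (-(p.α * (v - r))) ≤ J := by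
    rw [hJ, ← integral_sub_left_eq_self (fun w => lg w * Real.exp (-(p.α * w))) volume v]
    exact setIntegral_le_integral (hJint.comp_sub_left v) (ae_of_all _ fun r =>
      mul_nonneg (lg_nonneg _) (Real.exp_pos _).le)
  have i1 : IntegrableOn ((Icc (v / 4) (v / 2)).indicator
      fun _ : ℝ => -(p.A v * (v / 2) * (1 / 3) * c3)) (Ioi 0) :=
    ((integrable_indicator_iff measurableSet_Icc).2 continuous_const.integrableOn_Icc).integrableOn
  have i2 := integrableOn_exp_neg_half (96 * p.nbar)
  have i3 := integrableOn_exp_neg_half (8 * p.nbar)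
  have i4 := hJv.const_mul (8 * p.nbar)
  have e12 := integral_add i1 i2
  have e34 := integral_add i3 i4
  have e1234 := integral_add ((i1.add i2).const_mul (Real.exp (k * v))) (i3.add i4)
  simp only [Pi.add_apply] at e12 e34 e1234
  have hle : p.Kop p.G v - p.V v * p.G v ≤ Real.exp (k * v) * (-c4 * S + 192 * p.nbar)
      + (16 * p.nbar + 8 * p.nbar * J) := by
    calc p.Kop p.G v - p.V v * p.G v
        ≤ ∫ r in Ioi (0 : ℝ), (Real.exp (k * v) * ((Icc (v / 4) (v / 2)).indicator
            (fun _ => -(p.A v * (v / 2) * (1 / 3) * c3)) r + 96 * p.nbar * Real.exp (-(1 / 2) * r))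
            + (8 * p.nbar * Real.exp (-(1 / 2) * r)
              + 8 * p.nbar * (lg (v - r) * Real.exp (-(p.α * (v - r)))))) := by
          rw [Kop_G_sub hp v]
          refine setIntegral_mono_on ((integrableOn_kd_mul hp v).add (integrableOn_ku_mul hp v))
            (((i1.add i2).const_mul _).add (i3.add i4)) measurableSet_Ioi fun r hr => ?_
          exact drift_integrand_le hp hv hr
      _ ≤ _ := by
          rw [e1234, integral_const_mul, e12, e34, integral_const_mul, integral_const_mul,
            integral_const_mul, integral_exp_neg_half,
            setIntegral_indicator measurableSet_Icc, inter_eq_right.2 (fun x hx => by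
              have := hx.1; simp only [mem_Ioi]; linarith)]
          have hvol : ∫ _ in Icc (v / 4) (v / 2), -(p.A v * (v / 2) * (1 / 3) * c3)
              ≤ -c4 * S := by
            simp only [integral_const, MeasurableSet.univ, measureReal_restrict_apply, univ_inter,
              Real.volume_real_Icc, smul_eq_mul]
            rw [max_eq_left (by linarith)]
            have h1 : lg v ≤ 2 * v := by linarith [lg_le_add_one (show 0 ≤ v by linarith)]
            have h3 : lg v ^ 2 ≤ 4 * v ^ 2 := by nlinarith
            have h4 : 4 * p.nbar * S ≤ p.A v * (4 * v ^ 2) := by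
              rw [hS, ← A_mul_lg_sq]; gcongr
            have h5 := mul_le_mul_of_nonneg_right h4 hc3.le
            rw [hc4]
            linarith
          have hJ' := mul_le_mul_of_nonneg_left hJle (show 0 ≤ 8 * p.nbar by positivity)
          have hv' := mul_le_mul_of_nonneg_left hvol (Real.exp_pos (k * v)).le
          linarith
  have hGle : p.G v ≤ 2 * Real.exp (k * v) := by
    have : Real.exp (-p.α * v) ≤ Real.exp (k * v) := by
      apply Real.exp_le_exp.2; nlinarith
    unfold G; linarith
  have hWle := W_le_of_le_lg hlg1
  have hWG : W v * p.G v ≤ 4 * S * Real.exp (k * v) := by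
    calc _ ≤ (2 * S) * (2 * Real.exp (k * v)) :=
          mul_le_mul hWle hGle (G_pos p v).le (by positivity)
      _ = _ := by ring
  have hm : Real.exp (k * v) * (-c4 * S + 192 * p.nbar) ≤ Real.exp (k * v) * (-(c4 / 2) * S) := by
    gcongr; linarith
  have hf : c4 / 8 * (W v * p.G v) ≤ c4 / 8 * (4 * S * Real.exp (k * v)) := by gcongr
  linarith

/-- The drift inequality for the weight `G`. -/
theorem exists_drift {p : Params} (hp : p.Admissible) :
    ∃ c C, 0 < c ∧ 0 ≤ C ∧ ∀ v, p.Kop p.G v ≤ p.V v * p.G v - c * (W v * p.G v) + C := by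
  obtain ⟨c₁, hc₁, h₁⟩ := exists_drift_atBot hp
  obtain ⟨c₂, C₂, hc₂, hC₂, h₂⟩ := exists_drift_atTop hp
  obtain ⟨R₁, hR₁⟩ := eventually_atBot.1 h₁
  obtain ⟨R₂, hR₂⟩ := eventually_atTop.1 h₂
  set c := min c₁ c₂ with hc
  have hcont : Continuous fun v => p.Kop p.G v - p.V v * p.G v + c * (W v * p.G v) := by
    have := continuous_Kop_G hp
    have := continuous_V hp
    have := continuous_W
    have := continuous_G p
    fun_prop
  -- Between the two asymptotic regions continuity on a compact interval supplies the constant.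
  obtain ⟨D, hD⟩ := isCompact_Icc.exists_bound_of_continuousOn
    (s := Icc R₁ R₂) hcont.continuousOn
  refine ⟨c, C₂ + |D|, lt_min hc₁ hc₂, by positivity, fun v => ?_⟩
  have hWG := mul_pos (W_pos v) (G_pos p v)
  have hcl := mul_le_mul_of_nonneg_right (min_le_left c₁ c₂) hWG.le
  have hcr := mul_le_mul_of_nonneg_right (min_le_right c₁ c₂) hWG.le
  have hD0 := abs_nonneg D
  rcases le_total v R₁ with h | h
  · linarith [hR₁ v h]
  · rcases le_total R₂ v with h' | h'
    · linarith [hR₂ v h']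
    · have h3 := (le_abs_self _).trans ((hD v ⟨h, h'⟩).trans (le_abs_self D))
      linarith

/-! ### The splitting of the integral operator -/

@[fun_prop]
lemma measurable_K1eps_right (p : Params) (v : ℝ) : Measurable (p.K1eps v) := by
  have := (continuous_eps p).measurable
  unfold K1eps K1 reg
  fun_prop

@[fun_prop]
lemma measurable_K2eps_right (p : Params) (v : ℝ) : Measurable (p.K2eps v) := by
  have := (continuous_eps p).measurable
  unfold K2eps K2 reg
  fun_prop

lemma K1eps_sub_nonneg {p : Params} (hp : p.Admissible) (v : ℝ) {r : ℝ} (hr : 0 < r) :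
    0 ≤ p.K1eps v (v - r) := by
  rw [K1eps_sub p v hr]
  exact mul_nonneg (kd_pos hp v hr).le (Real.exp_pos _).le

lemma K1eps_sub_le {p : Params} (hp : p.Admissible) (v : ℝ) {r : ℝ} (hr : 0 < r) :
    p.K1eps v (v - r) ≤ p.K3eps v (v - r) := by
  rw [K1eps_sub p v hr, K3eps_sub p v hr]
  exact mul_le_of_le_one_right (kd_pos hp v hr).le (Real.exp_le_one_iff.2 (by linarith))

lemma K2eps_sub_nonneg {p : Params} (hp : p.Admissible) (v : ℝ) {r : ℝ} (hr : 0 < r) :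
    0 ≤ p.K2eps v (v - r) := by
  rw [K2eps_sub p v hr]
  exact mul_nonneg (kd_pos hp v hr).le (one_sub_exp_neg_pos hr).le

lemma K2eps_sub_le {p : Params} (hp : p.Admissible) (v : ℝ) {r : ℝ} (hr : 0 < r) :
    p.K2eps v (v - r) ≤ p.K3eps v (v - r) := by
  rw [K2eps_sub p v hr, K3eps_sub p v hr]
  exact mul_le_of_le_one_right (kd_pos hp v hr).le (by linarith [Real.exp_pos (-r)])

lemma integrableOn_K3eps_sub_mul_G {p : Params} (hp : p.Admissible) (v : ℝ) :
    IntegrableOn (fun r => p.K3eps v (v - r) * p.G (v - r)) (Ioi 0) :=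
  ((integrable_K3eps_mul_G hp v).comp_sub_left v).integrableOn

lemma integrableOn_K3eps_add_mul_G {p : Params} (hp : p.Admissible) (v : ℝ) :
    IntegrableOn (fun r => p.K3eps v (v + r) * p.G (v + r)) (Ioi 0) :=
  ((integrable_K3eps_mul_G hp v).comp_add_left v).integrableOn

lemma integrableOn_K1eps_sub_mul_G {p : Params} (hp : p.Admissible) (v : ℝ) :
    IntegrableOn (fun r => p.K1eps v (v - r) * p.G (v - r)) (Ioi 0) := by
  have hG := (continuous_G p).measurable
  refine (integrableOn_K3eps_sub_mul_G hp v).mono'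
    (by fun_prop : Measurable fun r => p.K1eps v (v - r) * p.G (v - r)).aestronglyMeasurable ?_
  filter_upwards [ae_restrict_mem measurableSet_Ioi] with r hr
  have h1 := K1eps_sub_nonneg hp v hr
  rw [Real.norm_of_nonneg (mul_nonneg h1 (G_pos p _).le)]
  exact mul_le_mul_of_nonneg_right (K1eps_sub_le hp v hr) (G_pos p _).le

lemma integrableOn_K2eps_sub_mul_G {p : Params} (hp : p.Admissible) (v : ℝ) :
    IntegrableOn (fun r => p.K2eps v (v - r) * p.G (v - r)) (Ioi 0) := by
  have hG := (continuous_G p).measurable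
  refine (integrableOn_K3eps_sub_mul_G hp v).mono'
    (by fun_prop : Measurable fun r => p.K2eps v (v - r) * p.G (v - r)).aestronglyMeasurable ?_
  filter_upwards [ae_restrict_mem measurableSet_Ioi] with r hr
  have h1 := K2eps_sub_nonneg hp v hr
  rw [Real.norm_of_nonneg (mul_nonneg h1 (G_pos p _).le)]
  exact mul_le_mul_of_nonneg_right (K2eps_sub_le hp v hr) (G_pos p _).le

lemma integrableOn_smul_of_le_G {p : Params} {S : Set ℝ} {k g : ℝ → ℝ} (hk : Measurable k)
    (hg : Measurable g) (hi : IntegrableOn (fun r => k r * p.G (g r)) S) {ψ : ℝ → ℂ}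
    (hψ : Continuous ψ) {M : ℝ} (hb : ∀ w, ‖ψ w‖ ≤ M * p.G w) :
    IntegrableOn (fun r => k r • ψ (g r)) S := by
  refine (hi.norm.const_mul M).mono'
    (hk.aestronglyMeasurable.smul (hψ.measurable.comp hg).aestronglyMeasurable)
    (ae_of_all _ fun r => ?_)
  rw [norm_smul, norm_mul, Real.norm_of_nonneg (G_pos p _).le]
  have := mul_le_mul_of_nonneg_left (hb (g r)) (norm_nonneg (k r))
  linarith

lemma continuous_setIntegral_smul {p : Params} {S : Set ℝ} {k g : ℝ → ℝ} (hk : Measurable k)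
    (hg : Measurable g) (hi : IntegrableOn (fun r => k r * p.G (g r)) S) {ψ : ℝ → ℝ → ℂ}
    (hψ : Continuous fun x : ℝ × ℝ => ψ x.1 x.2) {M : ℝ} (hb : ∀ s w, ‖ψ s w‖ ≤ M * p.G w) :
    Continuous fun s => ∫ r in S, k r • ψ s (g r) := by
  refine continuous_of_dominated (bound := fun r => M * ‖k r * p.G (g r)‖) (fun s => ?_)
    (fun s => ae_of_all _ fun r => ?_) (hi.norm.const_mul M) (ae_of_all _ fun r => ?_)
  · have : Continuous (ψ s) := hψ.comp (by fun_prop : Continuous fun w : ℝ => (s, w))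
    exact hk.aestronglyMeasurable.smul (this.measurable.comp hg).aestronglyMeasurable
  · rw [norm_smul, norm_mul, Real.norm_of_nonneg (G_pos p _).le]
    have := mul_le_mul_of_nonneg_left (hb s (g r)) (norm_nonneg (k r))
    linarith
  · have h : Continuous fun s => ψ s (g r) :=
      hψ.comp (by fun_prop : Continuous fun s : ℝ => (s, g r))
    exact h.const_smul (k r)

lemma integrableOn_mul_exp_neg {S : Set ℝ} (hS : S ⊆ Ioi 0) (hSm : MeasurableSet S) {k h : ℝ → ℝ}
    (hi : IntegrableOn (fun r => k r * h r) S) :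
    IntegrableOn (fun r => k r * Real.exp (-r) * h r) S := by
  have := hi.mul_bdd (c := 1) (g := fun r => Real.exp (-r))
    (by fun_prop : Measurable fun r : ℝ => Real.exp (-r)).aestronglyMeasurable (by
      filter_upwards [ae_restrict_mem hSm] with r hr
      rw [Real.norm_of_nonneg (Real.exp_pos _).le]
      exact Real.exp_le_one_iff.2 (by have := hS hr; simp only [mem_Ioi] at this; linarith))
  refine this.congr (ae_of_all _ fun r => ?_)
  beta_reduce; ring

/-- Only continuity in time at fixed $v$ is needed for the time integrals; the branches of the
splitting are then fixed. -/
lemma continuous_Ku {p : Params} (hp : p.Admissible) {ψ : ℝ → ℝ → ℂ}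
    (hψ : Continuous fun x : ℝ × ℝ => ψ x.1 x.2) {M : ℝ} (hb : ∀ s w, ‖ψ s w‖ ≤ M * p.G w)
    (v : ℝ) : Continuous fun s => p.Ku (ψ s) v := by
  have I1 := integrableOn_K1eps_sub_mul_G hp v
  have I2 := integrableOn_K2eps_sub_mul_G hp v
  have I3 := integrableOn_K3eps_add_mul_G hp v
  have hsub : ∀ {x : ℝ}, 0 ≤ x → Ioi x ⊆ Ioi (0 : ℝ) := fun h => Ioi_subset_Ioi h
  unfold Ku
  refine Continuous.add (Continuous.add (Continuous.add ?_ ?_) ?_) ?_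
  · split_ifs with h
    · have h0 : 0 ≤ -v - p.b := by linarith
      refine Continuous.add (Continuous.add (Continuous.add ?_ ?_) ?_) ?_
      · exact continuous_setIntegral_smul (by fun_prop) (by fun_prop)
          (I1.mono_set Ioc_subset_Ioi_self) hψ hb
      · exact continuous_setIntegral_smul (by fun_prop) (by fun_prop)
          (integrableOn_mul_exp_neg (hsub h0) measurableSet_Ioi (I1.mono_set (hsub h0))) hψ hb
      · exact continuous_setIntegral_smul (by fun_prop) (by fun_prop)
          (I3.mono_set Ioc_subset_Ioi_self) hψ hb
      · exact continuous_setIntegral_smul (by fun_prop) (by fun_prop)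
          (integrableOn_mul_exp_neg (hsub h0) measurableSet_Ioi (I3.mono_set (hsub h0))) hψ hb
    · exact continuous_const
  · split_ifs with h1 h2 h3 h3 <;> try exact continuous_const
    · exact ((((continuous_setIntegral_smul (by fun_prop) (by fun_prop)
        (integrableOn_mul_exp_neg subset_rfl measurableSet_Ioi I1) hψ hb).add
        (continuous_setIntegral_smul (by fun_prop) (by fun_prop)
          (I1.mono_set Ioc_subset_Ioi_self) hψ hb)).add
        (continuous_setIntegral_smul (by fun_prop) (by fun_prop)
        (integrableOn_mul_exp_neg subset_rfl measurableSet_Ioi I3) hψ hb))).add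
        (continuous_setIntegral_smul (by fun_prop) (by fun_prop) I3 hψ hb)
    · exact ((((continuous_setIntegral_smul (by fun_prop) (by fun_prop)
        (integrableOn_mul_exp_neg subset_rfl measurableSet_Ioi I1) hψ hb).add
        continuous_const).add
        (continuous_setIntegral_smul (by fun_prop) (by fun_prop)
        (integrableOn_mul_exp_neg subset_rfl measurableSet_Ioi I3) hψ hb))).add
        continuous_const
    · exact (((continuous_const.add
        (continuous_setIntegral_smul (by fun_prop) (by fun_prop)
          (I1.mono_set Ioc_subset_Ioi_self) hψ hb)).add continuous_const)).add
        (continuous_setIntegral_smul (by fun_prop) (by fun_prop) I3 hψ hb)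
  · split_ifs with h
    · exact continuous_setIntegral_smul (by fun_prop) (by fun_prop)
        (I2.mono_set Ioc_subset_Ioi_self) hψ hb
    · exact continuous_const
  · split_ifs with h
    · exact continuous_setIntegral_smul (by fun_prop) (by fun_prop)
        (I2.mono_set Ioc_subset_Ioi_self) hψ hb
    · exact continuous_const

lemma setIntegral_Ioc_add_Ioi {f : ℝ → ℂ} (hf : IntegrableOn f (Ioi 0)) {x : ℝ} (hx : 0 ≤ x) :
    (∫ r in Ioc 0 x, f r) + ∫ r in Ioi x, f r = ∫ r in Ioi (0 : ℝ), f r := by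
  rw [← setIntegral_union Ioc_disjoint_Ioi_same measurableSet_Ioi
    (hf.mono_set Ioc_subset_Ioi_self) (hf.mono_set (Ioi_subset_Ioi hx)), Ioc_union_Ioi_eq_Ioi hx]

lemma setIntegral_exp_neg_add {S : Set ℝ} (hS : S ⊆ Ioi 0) (hSm : MeasurableSet S) {k : ℝ → ℝ}
    {φ : ℝ → ℂ} (hf : IntegrableOn (fun r => k r • φ r) S) :
    (∫ r in S, (k r * Real.exp (-r)) • φ r) + ∫ r in S, (k r * (1 - Real.exp (-r))) • φ r
      = ∫ r in S, k r • φ r := by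
  have h1 : IntegrableOn (fun r => (k r * Real.exp (-r)) • φ r) S := by
    have := hf.bdd_mul (c := 1) (f := fun r => ((Real.exp (-r) : ℝ) : ℂ))
      (by fun_prop : Measurable fun r : ℝ => ((Real.exp (-r) : ℝ) : ℂ)).aestronglyMeasurable (by
        filter_upwards [ae_restrict_mem hSm] with r hr
        rw [Complex.norm_real, Real.norm_of_nonneg (Real.exp_pos _).le]
        exact Real.exp_le_one_iff.2 (by have := hS hr; simp only [mem_Ioi] at this; linarith))
    refine this.congr (ae_of_all _ fun r => ?_)
    simp only [Complex.real_smul, Complex.ofReal_mul]; ring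
  have h2 : IntegrableOn (fun r => (k r * (1 - Real.exp (-r))) • φ r) S := by
    refine (hf.sub h1).congr (ae_of_all _ fun r => ?_)
    simp only [Pi.sub_apply, ← sub_smul]; congr 1; ring
  rw [← integral_add h1 h2]
  congr 1; ext r
  rw [← add_smul]; congr 1; ring

/-- The cut-offs only distribute mass: $e^{-r}+(1-e^{-r})=1$, and each split integral recombines at
$r_0$, $v$ or $v-a_1$. These splitting points are nonnegative in their branches because
$0<b_0'<m_0'$ and $2a_1<m_0'$. From here on only the sum $K$ matters. -/
lemma Ku_add_Kb {p : Params} (hp : p.Admissible) {ψ : ℝ → ℂ} (hψ : Continuous ψ) {M : ℝ}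
    (hb : ∀ w, ‖ψ w‖ ≤ M * p.G w) (v : ℝ) : p.Ku ψ v + p.Kb ψ v = p.Kop ψ v := by
  have I1 : IntegrableOn (fun r => p.K1eps v (v - r) • ψ (v - r)) (Ioi 0) :=
    integrableOn_smul_of_le_G (by fun_prop) (by fun_prop)
      (integrableOn_K1eps_sub_mul_G hp v) hψ hb
  have I2 : IntegrableOn (fun r => p.K2eps v (v - r) • ψ (v - r)) (Ioi 0) :=
    integrableOn_smul_of_le_G (by fun_prop) (by fun_prop)
      (integrableOn_K2eps_sub_mul_G hp v) hψ hb
  have I3 : IntegrableOn (fun r => p.K3eps v (v + r) • ψ (v + r)) (Ioi 0) :=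
    integrableOn_smul_of_le_G (by fun_prop) (by fun_prop)
      (integrableOn_K3eps_add_mul_G hp v) hψ hb
  have hK : p.Kop ψ v = (∫ r in Ioi (0 : ℝ), p.K1eps v (v - r) • ψ (v - r))
      + (∫ r in Ioi (0 : ℝ), p.K2eps v (v - r) • ψ (v - r))
      + ∫ r in Ioi (0 : ℝ), p.K3eps v (v + r) • ψ (v + r) := by
    rw [Kop, integral_eq_sub_add (integrable_K3eps_smul hp v hψ.aestronglyMeasurable hb) v,
      ← integral_add I1 I2]
    congr 1
    refine setIntegral_congr_fun measurableSet_Ioi fun r hr => ?_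
    rw [← add_smul, K3eps_sub p v hr, K1eps_sub p v hr, K2eps_sub p v hr]
    congr 1; ring
  have hm := hp.m_pos
  have hb0 := hp.b_pos
  have hbm := hp.b_lt_m
  have ham := hp.a₁_lt_m
  have ha := hp.a₁_pos
  rw [hK, Ku, Kb]
  rcases lt_or_ge v (-p.b) with h | h
  · have h0 : 0 ≤ -v - p.b := by linarith
    have hs : Ioi (-v - p.b) ⊆ Ioi (0 : ℝ) := Ioi_subset_Ioi h0
    have e1 := setIntegral_Ioc_add_Ioi I1 h0
    have e2 := setIntegral_Ioc_add_Ioi I2 h0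
    have e3 := setIntegral_Ioc_add_Ioi I3 h0
    have f1 := setIntegral_exp_neg_add hs measurableSet_Ioi (I1.mono_set hs)
    have f3 := setIntegral_exp_neg_add hs measurableSet_Ioi (I3.mono_set hs)
    rw [if_pos h, if_pos h, if_neg (not_le.2 h), if_neg (not_le.2 h),
      if_neg (show ¬ p.m < v by linarith), if_neg (show ¬ p.m < v by linarith)]
    rcases lt_or_ge v (-p.m) with h' | h'
    · rw [if_pos h', if_pos h', if_neg (fun hh => absurd hh.1 (not_le.2 h'))]
      linear_combination e1 + e2 + e3 + f1 + f3
    · rw [if_neg (not_lt.2 h'), if_neg (not_lt.2 h'), if_pos ⟨h', by linarith⟩]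
      linear_combination e1 + e3 + f1 + f3
  · rw [if_neg (not_lt.2 h), if_neg (not_lt.2 h), if_pos h, if_pos h,
      if_neg (show ¬ v < -p.m by linarith), if_neg (show ¬ v < -p.m by linarith)]
    rcases le_or_gt v p.m with h' | h'
    · have f1 := setIntegral_exp_neg_add subset_rfl measurableSet_Ioi I1
      have f3 := setIntegral_exp_neg_add subset_rfl measurableSet_Ioi I3
      simp only [if_pos h', if_neg (not_lt.2 h'), if_pos (show -p.m ≤ v ∧ v ≤ p.m from
        ⟨by linarith, h'⟩)]
      linear_combination f1 + f3
    · have e1 := setIntegral_Ioc_add_Ioi I1 (show 0 ≤ v by linarith)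
      have e2 := setIntegral_Ioc_add_Ioi I2 (show 0 ≤ v - p.a₁ by linarith)
      simp only [if_pos h', if_neg (not_le.2 h'), if_neg (show ¬ (-p.m ≤ v ∧ v ≤ p.m) from
        fun hh => absurd hh.2 (not_le.2 h'))]
      linear_combination e1 + e2

/-- The pieces need not be inspected again: $K_b=K-K_u$, and both terms on the right are continuous
in time. -/
lemma continuous_Kb {p : Params} (hp : p.Admissible) {ψ : ℝ → ℝ → ℂ}
    (hψ : Continuous fun x : ℝ × ℝ => ψ x.1 x.2) {M : ℝ} (hM : 0 ≤ M)
    (hb : ∀ s w, ‖ψ s w‖ ≤ M * p.G w) (v : ℝ) : Continuous fun s => p.Kb (ψ s) v := by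
  have h : (fun s => p.Kb (ψ s) v) = fun s => p.Kop (ψ s) v - p.Ku (ψ s) v := by
    ext s
    have hc : Continuous (ψ s) := hψ.comp (by fun_prop : Continuous fun w : ℝ => (s, w))
    rw [← Ku_add_Kb hp hc (hb s) v]; ring
  rw [h]
  exact ((continuous_Kop hp hψ hM hb).comp (by fun_prop : Continuous fun s : ℝ => (s, v))).sub
    (continuous_Ku hp hψ hb v)

/-! ### The space `X` in terms of the weight `G` -/

lemma Γt_pos (p : Params) (v : ℝ) : 0 < p.Γt v := by
  have : 0 < lg v ^ (-p.α) := Real.rpow_pos_of_pos (lg_pos v) _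
  have h2 : 0 < p.f v := this.trans_le (le_max_left _ _)
  unfold Γt; positivity

lemma lg_zero : lg 0 = Real.log 2 := by rw [lg, Real.exp_zero]; norm_num

/-- Together with `Γt_le_G` this lets $G$ replace the weight of $X$. The comparison holds because
$\frac12e^v\le\ell(v)\le e^v$ for $v\le0$ and $\ell(v)\ge\frac12$ for $v\ge0$. -/
lemma G_le_Γt {p : Params} (hp : p.Admissible) (v : ℝ) : p.G v ≤ 2 * p.Γt v := by
  have hα := hp.α_pos
  have hκ := hp.α_pos.trans hp.lt_μc₀
  have hμ := hp.μ_pos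
  have ha : 0 < p.a := by linarith [hp.a_ge]
  have hexp1 : 1 ≤ Real.exp (p.μ * max p.a (p.c₀ * v)) :=
    Real.one_le_exp (mul_nonneg hμ.le (ha.le.trans (le_max_left _ _)))
  have hexp2 : Real.exp (p.μ * p.c₀ * v) ≤ Real.exp (p.μ * max p.a (p.c₀ * v)) := by
    apply Real.exp_le_exp.2
    rw [mul_assoc]
    exact mul_le_mul_of_nonneg_left (le_max_right _ _) hμ.le
  have hlog2 : Real.log 2 ≤ 1 := by
    have := lg_le_exp 0
    rwa [lg_zero, Real.exp_zero] at this
  have hf1 : 1 ≤ p.f v := by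
    have h2 : 1 ≤ Real.log 2 ^ (-p.α) :=
      Real.one_le_rpow_of_pos_of_le_one_of_nonpos (Real.log_pos one_lt_two) hlog2 (by linarith)
    exact h2.trans (le_max_right _ _)
  have hf2 : Real.exp (-p.α * v) ≤ p.f v := by
    have h := Real.rpow_le_rpow_of_nonpos (lg_pos v) (lg_le_exp v) (by linarith : -p.α ≤ 0)
    rw [← Real.exp_mul, mul_comm] at h
    exact h.trans (le_max_left _ _)
  unfold G Γt
  nlinarith [Real.exp_pos (-p.α * v), Real.exp_pos (p.μ * p.c₀ * v)]

lemma Γt_le_G {p : Params} (hp : p.Admissible) (v : ℝ) :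
    p.Γt v ≤ 2 * Real.exp (p.μ * p.a) * p.G v := by
  have hα := hp.α_pos
  have hα1 := hp.α_lt
  have hκ := hp.α_pos.trans hp.lt_μc₀
  have hμ := hp.μ_pos
  have hc := hp.c₀_pos
  have ha : 0 < p.a := by linarith [hp.a_ge]
  have htwo : (1 / 2 : ℝ) ^ (-p.α) ≤ 2 := by
    rw [one_div, Real.inv_rpow zero_le_two, Real.rpow_neg zero_le_two, inv_inv]
    calc (2 : ℝ) ^ p.α ≤ 2 ^ (1 : ℝ) :=
          Real.rpow_le_rpow_of_exponent_le one_le_two (by linarith)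
      _ = 2 := Real.rpow_one 2
  have hlog2 : Real.log 2 ^ (-p.α) ≤ 2 := by
    refine le_trans (Real.rpow_le_rpow_of_nonpos (by norm_num) ?_ (by linarith)) htwo
    rw [← lg_zero]; exact half_le_lg le_rfl
  unfold Γt f
  rcases le_total v 0 with hv | hv
  · have h1 : max p.a (p.c₀ * v) = p.a := max_eq_left (by nlinarith)
    have he : 1 ≤ Real.exp (-p.α * v) := Real.one_le_exp (by nlinarith)
    have hf : max (lg v ^ (-p.α)) (Real.log 2 ^ (-p.α)) ≤ 2 * Real.exp (-p.α * v) := by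
      refine max_le ?_ (by linarith)
      calc lg v ^ (-p.α) ≤ (Real.exp v * (1 / 2)) ^ (-p.α) :=
            Real.rpow_le_rpow_of_nonpos (by positivity)
              (by linarith [half_exp_le_lg hv]) (by linarith)
        _ = Real.exp (-p.α * v) * (1 / 2) ^ (-p.α) := by
            rw [Real.mul_rpow (Real.exp_pos v).le (by norm_num), ← Real.exp_mul, mul_comm v]
        _ ≤ _ := by nlinarith
    rw [h1]
    calc _ ≤ 2 * Real.exp (-p.α * v) * Real.exp (p.μ * p.a) := by gcongr
      _ ≤ 2 * p.G v * Real.exp (p.μ * p.a) := by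
          gcongr; unfold G; linarith [Real.exp_pos (p.μ * p.c₀ * v)]
      _ = _ := by ring
  · have hf : max (lg v ^ (-p.α)) (Real.log 2 ^ (-p.α)) ≤ 2 :=
      max_le ((Real.rpow_le_rpow_of_nonpos (by norm_num) (half_le_lg hv)
        (by linarith)).trans htwo) hlog2
    have h1 : p.μ * max p.a (p.c₀ * v) ≤ p.μ * p.a + p.μ * p.c₀ * v := by
      have : max p.a (p.c₀ * v) ≤ p.a + p.c₀ * v :=
        max_le (by nlinarith [mul_nonneg hc.le hv]) (by linarith)
      nlinarith
    calc _ ≤ 2 * Real.exp (p.μ * p.a + p.μ * p.c₀ * v) := by gcongr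
      _ = 2 * Real.exp (p.μ * p.a) * Real.exp (p.μ * p.c₀ * v) := by rw [Real.exp_add]; ring
      _ ≤ _ := by gcongr; unfold G; linarith [Real.exp_pos (-p.α * v)]

lemma normX_le {p : Params} (hp : p.Admissible) {h : ℝ → ℂ} {M : ℝ} (hM : 0 ≤ M)
    (hb : ∀ v, ‖h v‖ ≤ M * p.G v) : p.normX h ≤ ENNReal.ofReal (2 * M) := by
  refine iSup_le fun v => ENNReal.ofReal_le_ofReal ?_
  rw [div_le_iff₀ (Γt_pos p v)]
  calc _ ≤ M * p.G v := hb v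
    _ ≤ M * (2 * p.Γt v) := by gcongr; exact G_le_Γt hp v
    _ = _ := by ring

lemma norm_le_of_normX_le {p : Params} (hp : p.Admissible) {h : ℝ → ℂ} {b : ℝ≥0∞} (hb : b ≠ ⊤)
    (hle : p.normX h ≤ b) (v : ℝ) :
    ‖h v‖ ≤ b.toReal * (2 * Real.exp (p.μ * p.a)) * p.G v := by
  have h1 : ENNReal.ofReal (‖h v‖ / p.Γt v) ≤ b :=
    (le_iSup (fun v => ENNReal.ofReal (‖h v‖ / p.Γt v)) v).trans hle
  have h2 := (ENNReal.ofReal_le_iff_le_toReal hb).1 h1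
  rw [div_le_iff₀ (Γt_pos p v)] at h2
  calc _ ≤ b.toReal * p.Γt v := h2
    _ ≤ b.toReal * (2 * Real.exp (p.μ * p.a) * p.G v) := by gcongr; exact Γt_le_G hp v
    _ = _ := by ring

lemma mem_X_iff {p : Params} (hp : p.Admissible) {h : ℝ → ℂ} :
    h ∈ p.X ↔ Continuous h ∧ ∃ M, 0 ≤ M ∧ ∀ v, ‖h v‖ ≤ M * p.G v := by
  constructor
  · rintro ⟨hc, hb⟩
    exact ⟨hc, _, by positivity, norm_le_of_normX_le hp hb.ne le_rfl⟩
  · rintro ⟨hc, M, hM, hb⟩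
    exact ⟨hc, (normX_le hp hM hb).trans_lt ENNReal.ofReal_lt_top⟩

lemma normSup_lt_top_iff {p : Params} (hp : p.Admissible) {ψ : ℝ → ℝ → ℂ} :
    p.normSup ψ < ⊤ ↔ ∃ M, 0 ≤ M ∧ ∀ t, 0 ≤ t → ∀ v, ‖ψ t v‖ ≤ M * p.G v := by
  constructor
  · intro h
    refine ⟨_, by positivity, fun t ht => norm_le_of_normX_le hp h.ne ?_⟩
    exact le_iSup₂ (f := fun t (_ : t ∈ Ici (0 : ℝ)) => p.normX (ψ t)) t ht
  · rintro ⟨M, hM, hb⟩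
    exact (iSup₂_le fun t ht => normX_le hp hM (hb t ht)).trans_lt
      (ENNReal.ofReal_lt_top (r := 2 * M))

/-! ### The Duhamel map -/

/-- As $V\le DW$, the gain $cWG$ contains a fraction $\theta VG$. The additive constant is absorbed
into $l$ by means of $G\ge1$. -/
lemma exists_contraction_const {p : Params} (hp : p.Admissible) :
    ∃ q l : ℝ, 0 ≤ q ∧ q < 1 ∧ 0 ≤ l ∧ ∀ v, p.Kop p.G v ≤ q * ((p.V v + l) * p.G v) := by
  obtain ⟨c, C, hc, hC, hd⟩ := exists_drift hp
  obtain ⟨D, hD, hV⟩ := exists_V_le hp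
  set θ := min (c / D) (1 / 2) with hθ
  have hθ0 : 0 < θ := lt_min (by positivity) (by norm_num)
  have hθ1 : θ ≤ 1 / 2 := min_le_right _ _
  -- The choice $l=2C$ suffices because $\theta\le\frac12$ gives $(1-\theta)\,2C\ge C$.
  refine ⟨1 - θ, 2 * C, by linarith, by linarith, by positivity, fun v => ?_⟩
  have hG := one_le_G hp v
  have h1 : θ * p.V v ≤ c * W v := by
    calc θ * p.V v ≤ c / D * (D * W v) := by
          have := V_nonneg hp v
          gcongr
          · exact min_le_left _ _
          · exact hV v
      _ = c * W v := by field_simp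
  have h2 := mul_le_mul_of_nonneg_right h1 (G_pos p v).le
  have h3 : C ≤ (1 - θ) * (2 * C) * p.G v := by
    have : C * 1 ≤ C * p.G v := by gcongr
    have h4 : 0 ≤ C * p.G v := by positivity
    nlinarith
  have := hd v
  nlinarith

lemma exists_decay_const {p : Params} (hp : p.Admissible) :
    ∃ d C : ℝ, 0 < d ∧ 0 ≤ C ∧ ∀ v, p.Kop p.G v ≤ (p.V v - d) * p.G v + C := by
  obtain ⟨c, C, hc, hC, hd⟩ := exists_drift hp
  refine ⟨c, C, hc, hC, fun v => (hd v).trans ?_⟩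
  have h1 : 1 * p.G v ≤ W v * p.G v := by
    have := G_pos p v
    gcongr
    linarith [two_le_W v]
  nlinarith

/-- The hypothesis says that $H$ is a supersolution of $y'=-ay+\|k\|$. The majorant
$e^{-(t-s)a}(aH+H')$ is the derivative of $e^{-(t-s)a}H(s)$, so it integrates exactly. No bound on
$a$ enters, which is what makes the unbounded potential harmless. -/
lemma norm_integral_exp_smul_le {k : ℝ → ℂ} {a t : ℝ} (ht : 0 ≤ t) {H H' : ℝ → ℝ}
    (hd : ∀ s, HasDerivAt H (H' s) s) (hc : Continuous H')
    (hk : ∀ s ∈ Icc 0 t, ‖k s‖ ≤ a * H s + H' s) :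
    ‖∫ s in (0 : ℝ)..t, Real.exp (-(t - s) * a) • k s‖ ≤ H t - Real.exp (-t * a) * H 0 := by
  have hcH : Continuous H := continuous_iff_continuousAt.2 fun s => (hd s).continuousAt
  have hcont : Continuous fun s => Real.exp (-(t - s) * a) * (a * H s + H' s) := by fun_prop
  have hder : ∀ s, HasDerivAt (fun s => Real.exp (-(t - s) * a) * H s)
      (Real.exp (-(t - s) * a) * (a * H s + H' s)) s := by
    intro s
    have h1 : HasDerivAt (fun s : ℝ => -(t - s) * a) a s := by
      have := (((hasDerivAt_id s).const_sub t).neg).mul_const a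
      simpa using this
    exact (h1.exp.mul (hd s)).congr_deriv (by ring)
  have hint := intervalIntegral.integral_eq_sub_of_hasDerivAt (a := 0) (b := t)
    (fun s _ => hder s) (hcont.intervalIntegrable 0 t)
  refine (intervalIntegral.norm_integral_le_of_norm_le ht (ae_of_all _ fun s hs => ?_)
    (hcont.intervalIntegrable 0 t)).trans_eq ?_
  · rw [norm_smul, Real.norm_of_nonneg (Real.exp_pos _).le]
    gcongr
    exact hk s (Ioc_subset_Icc_self hs)
  · rw [hint]; simp

/-- The right hand side of the Duhamel-integrated equation. -/
noncomputable def duhamel (p : Params) (ψ₀ : ℝ → ℂ) (ψ : ℝ → ℝ → ℂ) (t v : ℝ) : ℂ :=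
  Real.exp (-t * p.V v) • ψ₀ v
    + ∫ s in (0 : ℝ)..t, Real.exp (-(t - s) * p.V v) • p.Kop (ψ s) v

/-- The supersolution is $H(s)=qD\,G(v)e^{ls}$: it satisfies $VH+H'=(V+l)H$, which dominates
$De^{ls}KG$ by the choice of $q$ and $l$. -/
lemma norm_duhamel_sub_le {p : Params} (hp : p.Admissible) {q l : ℝ}
    (hq : ∀ v, p.Kop p.G v ≤ q * ((p.V v + l) * p.G v)) (hq0 : 0 ≤ q) {ψ₀ : ℝ → ℂ}
    {ψ φ : ℝ → ℝ → ℂ} {t v D : ℝ} (ht : 0 ≤ t) (hD : 0 ≤ D)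
    (hψ : ∀ s ∈ Icc 0 t, Integrable fun w => p.K3eps v w • ψ s w)
    (hφ : ∀ s ∈ Icc 0 t, Integrable fun w => p.K3eps v w • φ s w)
    (hψi : IntervalIntegrable (fun s => Real.exp (-(t - s) * p.V v) • p.Kop (ψ s) v) volume 0 t)
    (hφi : IntervalIntegrable (fun s => Real.exp (-(t - s) * p.V v) • p.Kop (φ s) v) volume 0 t)
    (hb : ∀ s ∈ Icc 0 t, ∀ w, ‖ψ s w - φ s w‖ ≤ D * Real.exp (l * s) * p.G w) :
    ‖p.duhamel ψ₀ ψ t v - p.duhamel ψ₀ φ t v‖ ≤ q * D * Real.exp (l * t) * p.G v := by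
  have h1 : p.duhamel ψ₀ ψ t v - p.duhamel ψ₀ φ t v
      = ∫ s in (0 : ℝ)..t, Real.exp (-(t - s) * p.V v) • (p.Kop (ψ s) v - p.Kop (φ s) v) := by
    rw [duhamel, duhamel, add_sub_add_left_eq_sub, ← intervalIntegral.integral_sub hψi hφi]
    simp only [smul_sub]
  have hd : ∀ s, HasDerivAt (fun s => q * D * p.G v * Real.exp (l * s))
      (q * D * p.G v * (l * Real.exp (l * s))) s := fun s => by
    have h := (((hasDerivAt_id s).const_mul l).exp).const_mul (q * D * p.G v)
    simpa [mul_comm] using h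
  rw [h1]
  refine (norm_integral_exp_smul_le ht hd (by fun_prop) fun s hs => ?_).trans ?_
  · have h2 : p.Kop (ψ s) v - p.Kop (φ s) v = p.Kop (fun w => ψ s w - φ s w) v := by
      simp only [Kop]
      rw [← integral_sub (hψ s hs) (hφ s hs)]
      simp only [smul_sub]
    rw [h2]
    calc _ ≤ D * Real.exp (l * s) * p.Kop p.G v := norm_Kop_le_mul hp v (hb s hs)
      _ ≤ D * Real.exp (l * s) * (q * ((p.V v + l) * p.G v)) := by gcongr; exact hq v
      _ = _ := by ring
  · have : 0 ≤ Real.exp (-t * p.V v) * (q * D * p.G v * Real.exp (l * 0)) := by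
      have := G_pos p v
      positivity
    linarith

lemma continuous_duhamel {p : Params} (hp : p.Admissible) {ψ₀ : ℝ → ℂ} (h₀ : Continuous ψ₀)
    {ψ : ℝ → ℝ → ℂ} (hK : Continuous fun x : ℝ × ℝ => p.Kop (ψ x.1) x.2) :
    Continuous fun x : ℝ × ℝ => p.duhamel ψ₀ ψ x.1 x.2 := by
  have hV := continuous_V hp
  unfold duhamel
  refine Continuous.add (by fun_prop) ?_
  refine intervalIntegral.continuous_parametric_intervalIntegral_of_continuous
    (f := fun (x : ℝ × ℝ) s => Real.exp (-(x.1 - s) * p.V x.2) • p.Kop (ψ s) x.2) ?_ (by fun_prop)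
  have h1 : Continuous fun y : (ℝ × ℝ) × ℝ => p.Kop (ψ y.2) y.1.2 :=
    hK.comp (by fun_prop : Continuous fun y : (ℝ × ℝ) × ℝ => (y.2, y.1.2))
  have h2 : Continuous fun y : (ℝ × ℝ) × ℝ => Real.exp (-(y.1.1 - y.2) * p.V y.1.2) := by fun_prop
  exact h2.smul h1

/-! ### Picard iteration on bounded continuous functions, after division by $e^{lt}G$. -/

section FixedPoint

open BoundedContinuousFunction

/-- The family of functions coded by a bounded continuous function. -/
noncomputable def family (p : Params) (l : ℝ) (F : BoundedContinuousFunction (ℝ × ℝ) ℂ)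
    (s w : ℝ) : ℂ :=
  (Real.exp (l * s) * p.G w) • F (s, w)

lemma continuous_family (p : Params) (l : ℝ) (F : BoundedContinuousFunction (ℝ × ℝ) ℂ) :
    Continuous fun x : ℝ × ℝ => p.family l F x.1 x.2 := by
  have := continuous_G p
  unfold family
  fun_prop

lemma norm_family_le (p : Params) (l : ℝ) (F : BoundedContinuousFunction (ℝ × ℝ) ℂ) (s w : ℝ) :
    ‖p.family l F s w‖ ≤ ‖F‖ * Real.exp (l * s) * p.G w := by
  have hG := G_pos p w
  rw [family, norm_smul, Real.norm_of_nonneg (by positivity)]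
  have := mul_le_mul_of_nonneg_left (F.norm_coe_le_norm (s, w))
    (show 0 ≤ Real.exp (l * s) * p.G w by positivity)
  linarith

/-- The factor $e^{ls}$ is unbounded in $s$ in general, so it is pulled out first; the rest is
bounded by $\|F\|G$. -/
lemma continuous_Kop_family {p : Params} (hp : p.Admissible) (l : ℝ)
    (F : BoundedContinuousFunction (ℝ × ℝ) ℂ) :
    Continuous fun x : ℝ × ℝ => p.Kop (p.family l F x.1) x.2 := by
  have h1 : (fun x : ℝ × ℝ => p.Kop (p.family l F x.1) x.2)
      = fun x : ℝ × ℝ => Real.exp (l * x.1) • p.Kop (p.family 0 F x.1) x.2 := by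
    ext x
    simp only [Kop]
    rw [← integral_smul]
    congr 1; ext w
    simp only [family, zero_mul, Real.exp_zero, one_mul]
    rw [smul_smul, smul_smul, smul_smul]
    congr 1; ring
  rw [h1]
  have h2 : Continuous fun x : ℝ × ℝ => Real.exp (l * x.1) := by fun_prop
  refine h2.smul (continuous_Kop hp (continuous_family p 0 F) (norm_nonneg F) fun s w => ?_)
  simpa using norm_family_le p 0 F s w

lemma integrable_K3eps_family {p : Params} (hp : p.Admissible) (l : ℝ)
    (F : BoundedContinuousFunction (ℝ × ℝ) ℂ) (v s : ℝ) :
    Integrable fun w => p.K3eps v w • p.family l F s w := by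
  refine integrable_K3eps_smul hp v ?_ (norm_family_le p l F s)
  exact ((continuous_family p l F).comp
    (by fun_prop : Continuous fun w : ℝ => (s, w))).aestronglyMeasurable

lemma intervalIntegrable_family {p : Params} (hp : p.Admissible) (l : ℝ)
    (F : BoundedContinuousFunction (ℝ × ℝ) ℂ) (v t : ℝ) :
    IntervalIntegrable (fun s => Real.exp (-(t - s) * p.V v) • p.Kop (p.family l F s) v)
      volume 0 t := by
  apply Continuous.intervalIntegrable
  have : Continuous fun s => p.Kop (p.family l F s) v :=
    (continuous_Kop_family hp l F).comp (by fun_prop : Continuous fun s : ℝ => (s, v))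
  have h2 : Continuous fun s => Real.exp (-(t - s) * p.V v) := by fun_prop
  exact h2.smul this

lemma norm_duhamel_family_sub_le {p : Params} (hp : p.Admissible) {q l : ℝ}
    (hq : ∀ v, p.Kop p.G v ≤ q * ((p.V v + l) * p.G v)) (hq0 : 0 ≤ q) (ψ₀ : ℝ → ℂ)
    (F F' : BoundedContinuousFunction (ℝ × ℝ) ℂ) {t : ℝ} (ht : 0 ≤ t) (v : ℝ) :
    ‖p.duhamel ψ₀ (p.family l F) t v - p.duhamel ψ₀ (p.family l F') t v‖
      ≤ q * ‖F - F'‖ * Real.exp (l * t) * p.G v := by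
  refine norm_duhamel_sub_le hp hq hq0 ht (norm_nonneg _)
    (fun s _ => integrable_K3eps_family hp l F v s)
    (fun s _ => integrable_K3eps_family hp l F' v s) (intervalIntegrable_family hp l F v t)
    (intervalIntegrable_family hp l F' v t) fun s _ w => ?_
  have h := norm_family_le p l (F - F') s w
  rwa [family, BoundedContinuousFunction.sub_apply, smul_sub] at h

/-- The coded function of a Duhamel right hand side. -/
noncomputable def duhamelCode (p : Params) (l : ℝ) (ψ₀ : ℝ → ℂ)
    (F : BoundedContinuousFunction (ℝ × ℝ) ℂ) (x : ℝ × ℝ) : ℂ :=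
  (Real.exp (-(l * max x.1 0)) * (p.G x.2)⁻¹) • p.duhamel ψ₀ (p.family l F) (max x.1 0) x.2

lemma continuous_duhamelCode {p : Params} (hp : p.Admissible) (l : ℝ) {ψ₀ : ℝ → ℂ}
    (h₀ : Continuous ψ₀) (F : BoundedContinuousFunction (ℝ × ℝ) ℂ) :
    Continuous (p.duhamelCode l ψ₀ F) := by
  have h1 : Continuous fun x : ℝ × ℝ => (p.G x.2)⁻¹ :=
    ((continuous_G p).comp continuous_snd).inv₀ fun x => (G_pos p x.2).ne'
  have h2 : Continuous fun x : ℝ × ℝ => p.duhamel ψ₀ (p.family l F) (max x.1 0) x.2 :=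
    (continuous_duhamel hp h₀ (continuous_Kop_family hp l F)).comp
      (by fun_prop : Continuous fun x : ℝ × ℝ => (max x.1 0, x.2))
  unfold duhamelCode
  fun_prop

lemma norm_duhamelCode_sub_le {p : Params} (hp : p.Admissible) {q l : ℝ}
    (hq : ∀ v, p.Kop p.G v ≤ q * ((p.V v + l) * p.G v)) (hq0 : 0 ≤ q) (ψ₀ : ℝ → ℂ)
    (F F' : BoundedContinuousFunction (ℝ × ℝ) ℂ) (x : ℝ × ℝ) :
    ‖p.duhamelCode l ψ₀ F x - p.duhamelCode l ψ₀ F' x‖ ≤ q * ‖F - F'‖ := by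
  have hG := G_pos p x.2
  rw [duhamelCode, duhamelCode, ← smul_sub, norm_smul, Real.norm_of_nonneg (by positivity)]
  have h := norm_duhamel_family_sub_le hp hq hq0 ψ₀ F F' (le_max_right x.1 0) x.2
  calc _ ≤ (Real.exp (-(l * max x.1 0)) * (p.G x.2)⁻¹)
        * (q * ‖F - F'‖ * Real.exp (l * max x.1 0) * p.G x.2) := by gcongr
    _ = q * ‖F - F'‖ := by rw [Real.exp_neg]; field_simp

lemma norm_duhamelCode_le {p : Params} (hp : p.Admissible) {q l : ℝ} (hl : 0 ≤ l)
    (hq : ∀ v, p.Kop p.G v ≤ q * ((p.V v + l) * p.G v)) (hq0 : 0 ≤ q) {ψ₀ : ℝ → ℂ} {M : ℝ}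
    (hb : ∀ v, ‖ψ₀ v‖ ≤ M * p.G v) (F : BoundedContinuousFunction (ℝ × ℝ) ℂ) (x : ℝ × ℝ) :
    ‖p.duhamelCode l ψ₀ F x‖ ≤ M + q * ‖F‖ := by
  have hG := G_pos p x.2
  have h1 := norm_duhamelCode_sub_le hp hq hq0 ψ₀ F 0 x
  have h2 : ‖p.duhamelCode l ψ₀ 0 x‖ ≤ M := by
    have h3 : p.duhamel ψ₀ (p.family l 0) (max x.1 0) x.2
        = Real.exp (-max x.1 0 * p.V x.2) • ψ₀ x.2 := by
      simp [duhamel, family, Kop]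
    have hV := V_nonneg hp x.2
    have hm := le_max_right x.1 0
    have e1 : Real.exp (-(l * max x.1 0)) ≤ 1 :=
      Real.exp_le_one_iff.2 (by have := mul_nonneg hl hm; linarith)
    have e2 : Real.exp (-max x.1 0 * p.V x.2) ≤ 1 :=
      Real.exp_le_one_iff.2 (by have := mul_nonneg hm hV; linarith)
    rw [duhamelCode, h3, norm_smul, norm_smul, Real.norm_of_nonneg (by positivity),
      Real.norm_of_nonneg (Real.exp_pos _).le]
    calc _ ≤ (1 * (p.G x.2)⁻¹) * (1 * (M * p.G x.2)) := by gcongr; exact hb _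
      _ = M := by field_simp
  rw [sub_zero] at h1
  have h4 := norm_sub_norm_le (p.duhamelCode l ψ₀ F x) (p.duhamelCode l ψ₀ 0 x)
  linarith

/-- The Duhamel map stays below the time dependent supersolution. -/
lemma norm_duhamel_le_supersolution {p : Params} (hp : p.Admissible) {d C : ℝ} (hd : 0 < d)
    (hC : ∀ v, p.Kop p.G v ≤ (p.V v - d) * p.G v + C) {ψ₀ : ℝ → ℂ} {M : ℝ} (hM : 0 ≤ M)
    (h₀ : ∀ v, ‖ψ₀ v‖ ≤ M * p.G v) {ψ : ℝ → ℝ → ℂ} {t : ℝ} (ht : 0 ≤ t)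
    (hb : ∀ s, 0 ≤ s → ∀ w, ‖ψ s w‖
      ≤ M * (Real.exp (-(d * s)) * p.G w + C / d * (1 - Real.exp (-(d * s))))) (v : ℝ) :
    ‖p.duhamel ψ₀ ψ t v‖
      ≤ M * (Real.exp (-(d * t)) * p.G v + C / d * (1 - Real.exp (-(d * t)))) := by
  have hder : ∀ s, HasDerivAt
      (fun s => M * (Real.exp (-(d * s)) * p.G v + C / d * (1 - Real.exp (-(d * s)))))
      (M * (Real.exp (-(d * s)) * (-d) * p.G v + C / d * (d * Real.exp (-(d * s))))) s := fun s => by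
    have h1 : HasDerivAt (fun s : ℝ => Real.exp (-(d * s))) (Real.exp (-(d * s)) * (-d)) s := by
      have := ((hasDerivAt_id s).const_mul d).neg.exp
      simpa using this
    exact (((h1.mul_const (p.G v)).add ((h1.const_sub 1).const_mul (C / d))).const_mul M).congr_deriv
      (by ring)
  have hint := norm_integral_exp_smul_le (k := fun s => p.Kop (ψ s) v) (a := p.V v) ht hder
    (by fun_prop) (fun s hs => by
      set e := Real.exp (-(d * s)) with he
      have he0 : 0 < e := Real.exp_pos _
      have i1 := (integrable_K3eps_mul_G hp v).const_mul (M * e)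
      have i2 := (integrable_K3eps hp v).const_mul (M * (C / d * (1 - e)))
      have hi : Integrable fun w => p.K3eps v w * (M * (e * p.G w + C / d * (1 - e))) := by
        refine (i1.add i2).congr (ae_of_all _ fun w => ?_)
        simp only [Pi.add_apply]; ring
      have hval : p.Kop (fun w => M * (e * p.G w + C / d * (1 - e))) v
          = M * e * p.Kop p.G v + M * (C / d * (1 - e)) * p.V v := by
        rw [V_eq_integral hp, Kop, Kop, ← integral_const_mul, ← integral_const_mul]
        simp only [smul_eq_mul]
        rw [← integral_add i1 i2]
        congr 1; ext w; ring
      refine (norm_Kop_le hp v hi (hb s hs.1)).trans ?_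
      rw [hval]
      have h5 : M * e * p.Kop p.G v ≤ M * e * ((p.V v - d) * p.G v + C) := by
        gcongr; exact hC v
      have h6 : C / d * (d * e) = C * e := by field_simp
      rw [h6]
      linarith)
  have h7 : ‖Real.exp (-t * p.V v) • ψ₀ v‖ ≤ Real.exp (-t * p.V v) * (M * p.G v) := by
    rw [norm_smul, Real.norm_of_nonneg (Real.exp_pos _).le]
    gcongr; exact h₀ v
  rw [duhamel]
  refine (norm_add_le _ _).trans ?_
  simp only [mul_zero, neg_zero, Real.exp_zero, one_mul, sub_self, add_zero] at hint
  linarith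

/-- Existence of a jointly continuous and uniformly bounded solution of the Duhamel equation. -/
theorem exists_duhamel_fixedPoint {p : Params} (hp : p.Admissible) {ψ₀ : ℝ → ℂ}
    (h₀ : ψ₀ ∈ p.X) : ∃ ψ : ℝ → ℝ → ℂ, (Continuous fun x : ℝ × ℝ => ψ x.1 x.2) ∧
      (∃ M, 0 ≤ M ∧ ∀ t v, ‖ψ t v‖ ≤ M * p.G v) ∧
      ∀ t, 0 ≤ t → ∀ v, ψ t v = p.duhamel ψ₀ ψ t v := by
  obtain ⟨hc₀, M, hM, hb⟩ := (mem_X_iff hp).1 h₀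
  obtain ⟨q, l, hq0, hq1, hl, hq⟩ := exists_contraction_const hp
  obtain ⟨d, C, hd, hC0, hC⟩ := exists_decay_const hp
  let Φ : BoundedContinuousFunction (ℝ × ℝ) ℂ → BoundedContinuousFunction (ℝ × ℝ) ℂ := fun F =>
    BoundedContinuousFunction.ofNormedAddCommGroup (p.duhamelCode l ψ₀ F)
      (continuous_duhamelCode hp l hc₀ F) (M + q * ‖F‖) (norm_duhamelCode_le hp hl hq hq0 hb F)
  have hΦ : ContractingWith ⟨q, hq0⟩ Φ := by
    refine ⟨by exact_mod_cast hq1, LipschitzWith.of_dist_le_mul fun F F' => ?_⟩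
    rw [BoundedContinuousFunction.dist_le (by positivity)]
    intro x
    rw [dist_eq_norm, dist_eq_norm]
    exact norm_duhamelCode_sub_le hp hq hq0 ψ₀ F F' x
  have hfam : ∀ F t v, 0 ≤ t → p.family l (Φ F) t v = p.duhamel ψ₀ (p.family l F) t v := by
    intro F t v ht
    have hG := G_pos p v
    change (Real.exp (l * t) * p.G v) • p.duhamelCode l ψ₀ F (t, v) = _
    rw [duhamelCode, max_eq_left ht, smul_smul]
    have : Real.exp (l * t) * p.G v * (Real.exp (-(l * t)) * (p.G v)⁻¹) = 1 := by
      rw [Real.exp_neg]; field_simp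
    rw [this, one_smul]
  set F := ContractingWith.fixedPoint Φ hΦ with hF
  have hfix : Φ F = F := hΦ.fixedPoint_isFixedPt
  -- The contraction alone allows growth like $e^{lt}$. The bound by the supersolution is a closed
  -- condition, holds for $0$ and is preserved by the map, hence passes to the fixed point.
  let S : Set (BoundedContinuousFunction (ℝ × ℝ) ℂ) := {F | ∀ t, 0 ≤ t → ∀ v, ‖p.family l F t v‖
    ≤ M * (Real.exp (-(d * t)) * p.G v + C / d * (1 - Real.exp (-(d * t))))}
  have hS : IsClosed S := by
    have : S = ⋂ (t : ℝ) (_ : 0 ≤ t) (v : ℝ), {F | ‖p.family l F t v‖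
        ≤ M * (Real.exp (-(d * t)) * p.G v + C / d * (1 - Real.exp (-(d * t))))} := by
      ext F; simp [S]
    rw [this]
    refine isClosed_iInter fun t => isClosed_iInter fun _ => isClosed_iInter fun v => ?_
    refine isClosed_le ?_ continuous_const
    have h1 : Continuous fun F : BoundedContinuousFunction (ℝ × ℝ) ℂ => F (t, v) :=
      continuous_eval_const (t, v)
    unfold family
    fun_prop
  have hiter : ∀ n : ℕ, Φ^[n] 0 ∈ S := by
    intro n
    induction n with
    | zero =>
      intro t ht v
      have hG := G_pos p v
      have he := one_sub_exp_neg_nonneg (show 0 ≤ d * t by positivity)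
      simp only [Function.iterate_zero, id_eq, family, BoundedContinuousFunction.coe_zero,
        Pi.zero_apply, smul_zero, norm_zero]
      positivity
    | succ n ih =>
      rw [Function.iterate_succ_apply']
      intro t ht v
      rw [hfam _ t v ht]
      exact norm_duhamel_le_supersolution hp hd hC hM hb ht ih v
  have hFS : F ∈ S := hS.mem_of_tendsto (hΦ.tendsto_iterate_fixedPoint 0)
    (Eventually.of_forall hiter)
  -- Freezing the solution at negative times makes continuity and the bound hold for all real $t$.
  refine ⟨fun t v => p.family l F (max t 0) v, ?_, ⟨M * (1 + C / d), by positivity,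
    fun t v => ?_⟩, fun t ht v => ?_⟩
  · exact (continuous_family p l F).comp
      (by fun_prop : Continuous fun x : ℝ × ℝ => (max x.1 0, x.2))
  · refine (hFS _ (le_max_right t 0) v).trans ?_
    have h1 := one_sub_exp_neg_nonneg (mul_nonneg hd.le (le_max_right t 0))
    have h2 := Real.exp_pos (-(d * max t 0))
    have hG := one_le_G hp v
    rw [mul_assoc]
    gcongr
    have h3 : 0 ≤ C / d := by positivity
    have h4 : C / d * (1 - Real.exp (-(d * max t 0))) ≤ C / d * 1 := by gcongr; linarith
    have h5 : Real.exp (-(d * max t 0)) * p.G v ≤ 1 * p.G v := by gcongr; linarith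
    nlinarith
  · have h1 : p.family l F t v = p.duhamel ψ₀ (p.family l F) t v := by
      rw [← hfam F t v ht, hfix]
    beta_reduce
    rw [max_eq_left ht, h1, duhamel, duhamel]
    congr 1
    refine intervalIntegral.integral_congr fun s hs => ?_
    rw [uIcc_of_le ht] at hs
    simp only [max_eq_left hs.1]

end FixedPoint

/-! ### Return to the split equation, and uniqueness. -/

/-- A jointly continuous bounded family satisfying the compact form of the equation is a solution
in the sense of `IsDuhamelSolution`. -/
lemma isDuhamelSolution_of_fixedPoint {p : Params} (hp : p.Admissible) {ψ₀ : ℝ → ℂ}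
    {ψ : ℝ → ℝ → ℂ} (hc : Continuous fun x : ℝ × ℝ => ψ x.1 x.2) {M : ℝ} (hM : 0 ≤ M)
    (hb : ∀ t v, ‖ψ t v‖ ≤ M * p.G v)
    (he : ∀ t, 0 ≤ t → ∀ v, ψ t v = p.duhamel ψ₀ ψ t v) : p.IsDuhamelSolution ψ₀ ψ := by
  have hct : ∀ t, Continuous (ψ t) := fun t =>
    hc.comp (by fun_prop : Continuous fun w : ℝ => (t, w))
  have hexp : ∀ t v, Continuous fun s => Real.exp (-(t - s) * p.V v) := fun t v => by fun_prop
  have i1 : ∀ t v, IntervalIntegrable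
      (fun s => Real.exp (-(t - s) * p.V v) • p.Ku (ψ s) v) volume 0 t := fun t v =>
    ((hexp t v).smul (continuous_Ku hp hc hb v)).intervalIntegrable _ _
  have i2 : ∀ t v, IntervalIntegrable
      (fun s => Real.exp (-(t - s) * p.V v) • p.Kb (ψ s) v) volume 0 t := fun t v =>
    ((hexp t v).smul (continuous_Kb hp hc hM hb v)).intervalIntegrable _ _
  refine ⟨fun t _ => (mem_X_iff hp).2 ⟨hct t, M, hM, hb t⟩, fun t _ v => i1 t v,
    fun t _ v => i2 t v, fun t ht v => ?_⟩
  rw [he t ht v, duhamel, add_assoc, ← intervalIntegral.integral_add (i1 t v) (i2 t v)]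
  congr 2
  ext s
  rw [← smul_add, Ku_add_Kb hp (hct s) (hb s)]

/-- Uniqueness of uniformly bounded solutions of the Duhamel equation. -/
theorem IsDuhamelSolution.unique {p : Params} (hp : p.Admissible) {ψ₀ : ℝ → ℂ}
    {ψ φ : ℝ → ℝ → ℂ} (hψ : p.IsDuhamelSolution ψ₀ ψ) (hφ : p.IsDuhamelSolution ψ₀ φ)
    (hψb : p.normSup ψ < ⊤) (hφb : p.normSup φ < ⊤) {t : ℝ} (ht : 0 ≤ t) : φ t = ψ t := by
  obtain ⟨q, l, hq0, hq1, hl, hq⟩ := exists_contraction_const hp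
  have key : ∀ {χ : ℝ → ℝ → ℂ}, p.IsDuhamelSolution ψ₀ χ → p.normSup χ < ⊤ →
      ∃ M, 0 ≤ M ∧ (∀ s, 0 ≤ s → ∀ w, ‖χ s w‖ ≤ M * p.G w) ∧
      (∀ s, 0 ≤ s → ∀ v, Integrable fun w => p.K3eps v w • χ s w) ∧
      (∀ t, 0 ≤ t → ∀ v, IntervalIntegrable
        (fun s => Real.exp (-(t - s) * p.V v) • p.Kop (χ s) v) volume 0 t) ∧
      ∀ t, 0 ≤ t → ∀ v, χ t v = p.duhamel ψ₀ χ t v := by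
    intro χ hχ hχb
    obtain ⟨M, hM, hb⟩ := (normSup_lt_top_iff hp).1 hχb
    have hsum : ∀ t v, ∀ s ∈ uIoc 0 t, 0 ≤ t → Real.exp (-(t - s) * p.V v) • p.Ku (χ s) v
        + Real.exp (-(t - s) * p.V v) • p.Kb (χ s) v
        = Real.exp (-(t - s) * p.V v) • p.Kop (χ s) v := by
      intro t v s hs ht
      rw [uIoc_of_le ht] at hs
      rw [← smul_add, Ku_add_Kb hp (hχ.mem_X s hs.1.le).1 (hb s hs.1.le)]
    refine ⟨M, hM, hb, fun s hs v => integrable_K3eps_smul hp v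
      (hχ.mem_X s hs).1.aestronglyMeasurable (hb s hs), fun t ht v => ?_, fun t ht v => ?_⟩
    · exact ((hχ.integrable_Ku t ht v).add (hχ.integrable_Kb t ht v)).congr fun s hs =>
        hsum t v s hs ht
    · rw [hχ.eqn t ht v, add_assoc, ← intervalIntegral.integral_add (hχ.integrable_Ku t ht v)
        (hχ.integrable_Kb t ht v), duhamel]
      congr 1
      exact intervalIntegral.integral_congr_ae (ae_of_all _ fun s hs => hsum t v s hs ht)
  obtain ⟨M, hM, hMb, hMi, hMii, hMe⟩ := key hψ hψb
  obtain ⟨N, hN, hNb, hNi, hNii, hNe⟩ := key hφ hφb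
  -- Arbitrary solutions are not known to be jointly continuous, so they are not codes of bounded
  -- continuous functions. The contraction estimate is therefore iterated by hand, starting from the
  -- uniform bounds.
  have hiter : ∀ n : ℕ, ∀ t, 0 ≤ t → ∀ v,
      ‖φ t v - ψ t v‖ ≤ q ^ n * (M + N) * Real.exp (l * t) * p.G v := by
    intro n
    induction n with
    | zero =>
      intro t ht v
      have hG := G_pos p v
      have h1 : 1 ≤ Real.exp (l * t) := Real.one_le_exp (by positivity)
      calc _ ≤ ‖φ t v‖ + ‖ψ t v‖ := norm_sub_le _ _
        _ ≤ N * p.G v + M * p.G v := add_le_add (hNb t ht v) (hMb t ht v)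
        _ = q ^ 0 * (M + N) * 1 * p.G v := by ring
        _ ≤ _ := by gcongr
    | succ n ih =>
      intro t ht v
      rw [hMe t ht v, hNe t ht v]
      have h := norm_duhamel_sub_le hp hq hq0 (ψ₀ := ψ₀) (ψ := φ) (φ := ψ) (t := t) (v := v)
        (D := q ^ n * (M + N)) ht (by positivity) (fun s hs => hNi s hs.1 v)
        (fun s hs => hMi s hs.1 v) (hNii t ht v) (hMii t ht v) fun s hs w => ih s hs.1 w
      rw [pow_succ]
      linarith
  ext v
  have hlim : Tendsto (fun n : ℕ => q ^ n * (M + N) * Real.exp (l * t) * p.G v) atTop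
      (𝓝 (0 * (M + N) * Real.exp (l * t) * p.G v)) :=
    (((tendsto_pow_atTop_nhds_zero_of_lt_one hq0 hq1).mul_const _).mul_const _).mul_const _
  rw [zero_mul, zero_mul, zero_mul] at hlim
  have h0 : ‖φ t v - ψ t v‖ ≤ 0 := ge_of_tendsto' hlim fun n => hiter n t ht v
  exact sub_eq_zero.1 (norm_le_zero_iff.1 h0)

end Params

/-! ### The semigroup of a self-adjoint operator given by its resolvent -/

/-- The function `x ↦ exp (-t (1/x - 1))` on `[0, 1]`, for `t > 0`. -/
noncomputable def resolventExp (t x : ℝ) : ℝ :=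
  if t ≤ 0 then 1 else Real.exp t * expNegInvGlue (x / t)

/-- `expNegInvGlue (x / t)` is $e^{-t/x}$ for $x>0$ and $0$ for $x\le0$, so the function is
continuous through $x=0$, a point the spectrum may contain. At $t=0$ this fails to give the
identity, hence the separate branch. -/
lemma continuous_resolventExp (t : ℝ) : Continuous (resolventExp t) := by
  unfold resolventExp
  split_ifs
  · exact continuous_const
  · exact continuous_const.mul
      ((expNegInvGlue.contDiff (n := 0)).continuous.comp (continuous_id.div_const t))

lemma resolventExp_of_nonpos {t : ℝ} (ht : t ≤ 0) (x : ℝ) : resolventExp t x = 1 := if_pos ht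

lemma resolventExp_of_pos {t x : ℝ} (ht : 0 ≤ t) (hx : 0 < x) :
    resolventExp t x = Real.exp (-(t * (x⁻¹ - 1))) := by
  rcases ht.eq_or_lt with h | h
  · rw [← h, resolventExp_of_nonpos le_rfl]; simp
  · rw [resolventExp, if_neg (not_le.2 h), expNegInvGlue, if_neg (not_le.2 (div_pos hx h)),
      ← Real.exp_add]
    congr 1
    rw [inv_div]; field_simp; ring

lemma resolventExp_zero {t : ℝ} (ht : 0 < t) : resolventExp t 0 = 0 := by
  rw [resolventExp, if_neg (not_le.2 ht), zero_div, expNegInvGlue.zero, mul_zero]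

lemma resolventExp_add {s t x : ℝ} (hs : 0 ≤ s) (ht : 0 ≤ t) (hx : 0 ≤ x) :
    resolventExp (s + t) x = resolventExp s x * resolventExp t x := by
  rcases hx.eq_or_lt with h | h
  · rw [← h]
    rcases hs.eq_or_lt with h1 | h1
    · rw [← h1, zero_add, resolventExp_of_nonpos le_rfl, one_mul]
    · rw [resolventExp_zero (by linarith), resolventExp_zero h1, zero_mul]
  · rw [resolventExp_of_pos hs h, resolventExp_of_pos ht h, resolventExp_of_pos (by linarith) h,
      ← Real.exp_add]
    congr 1; ring

lemma abs_resolventExp_le_one {t x : ℝ} (ht : 0 ≤ t) (hx : 0 ≤ x) (hx1 : x ≤ 1) :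
    |resolventExp t x| ≤ 1 := by
  rcases hx.eq_or_lt with h | h
  · rcases ht.eq_or_lt with h1 | h1
    · rw [← h1, resolventExp_of_nonpos le_rfl, abs_one]
    · rw [← h, resolventExp_zero h1, abs_zero]; exact zero_le_one
  · rw [resolventExp_of_pos ht h, abs_of_pos (Real.exp_pos _), Real.exp_le_one_iff]
    have : 1 ≤ x⁻¹ := (one_le_inv₀ h).2 hx1
    nlinarith

lemma exp_neg_sub_exp_neg_le {a b : ℝ} (ha : 0 ≤ a) (hb : 0 ≤ b) :
    |Real.exp (-a) - Real.exp (-b)| ≤ |a - b| := by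
  wlog h : a ≤ b generalizing a b
  · rw [abs_sub_comm, abs_sub_comm a]
    exact this hb ha (le_of_not_ge h)
  · have h1 : Real.exp (-b) ≤ Real.exp (-a) := Real.exp_le_exp.2 (by linarith)
    rw [abs_of_nonneg (by linarith), abs_of_nonpos (by linarith)]
    have h2 : Real.exp (-b) = Real.exp (-a) * Real.exp (-(b - a)) := by
      rw [← Real.exp_add]; congr 1; ring
    have h3 := Real.add_one_le_exp (-(b - a))
    have h4 : Real.exp (-a) ≤ 1 := Real.exp_le_one_iff.2 (by linarith)
    rw [h2]
    nlinarith [Real.exp_pos (-a)]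

/-- The time derivative contains the unbounded factor $x^{-1}-1$; multiplied by $x$ it becomes
$1-x\le1$. This gives Lipschitz continuity in time on the range of the resolvent. -/
lemma abs_resolventExp_sub_mul_le {s t x : ℝ} (hs : 0 ≤ s) (ht : 0 ≤ t) (hx : 0 ≤ x)
    (hx1 : x ≤ 1) : |(resolventExp t x - resolventExp s x) * x| ≤ |t - s| := by
  rcases hx.eq_or_lt with h | h
  · rw [← h, mul_zero, abs_zero]; exact abs_nonneg _
  · have hl : 0 ≤ x⁻¹ - 1 := by linarith [(one_le_inv₀ h).2 hx1]
    rw [resolventExp_of_pos hs h, resolventExp_of_pos ht h, abs_mul, abs_of_pos h]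
    calc _ ≤ |t * (x⁻¹ - 1) - s * (x⁻¹ - 1)| * x :=
          mul_le_mul_of_nonneg_right
            (exp_neg_sub_exp_neg_le (by positivity) (by positivity)) h.le
      _ = |t - s| * (1 - x) := by
          rw [← sub_mul, abs_mul, abs_of_nonneg hl]; field_simp
      _ ≤ |t - s| := mul_le_of_le_one_right (abs_nonneg _) (by linarith)

/-- The difference between a difference quotient of the semigroup and its limit. -/
noncomputable def resolventQuot (h x : ℝ) : ℝ := h⁻¹ * (resolventExp h x * x - x) + (1 - x)

lemma continuous_resolventQuot (h : ℝ) : Continuous (resolventQuot h) := by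
  have := continuous_resolventExp h
  unfold resolventQuot; fun_prop

/-- Put $l=x^{-1}-1$, so $xl=1-x\in[0,1]$. With $0\le h^{-1}(e^{-hl}-1)+l\le\min(l,hl^2)$, one
factor $x$ gives a uniform bound and two give $O(h)$. This is the pair of bounds that a density
argument needs. -/
lemma resolventQuot_bounds {h x : ℝ} (hh : 0 < h) (hx : 0 ≤ x) (hx1 : x ≤ 1) :
    |resolventQuot h x| ≤ 1 ∧ |resolventQuot h x * x| ≤ h := by
  rcases hx.eq_or_lt with h0 | h0
  · rw [← h0]; simp [resolventQuot, hh.le]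
  · set l := x⁻¹ - 1 with hl
    have hl0 : 0 ≤ l := by linarith [(one_le_inv₀ h0).2 hx1]
    have hxl : x * l = 1 - x := by rw [hl]; field_simp
    have hq : resolventQuot h x = x * (h⁻¹ * (Real.exp (-(h * l)) - 1) + l) := by
      rw [resolventQuot, resolventExp_of_pos hh.le h0, ← hl, mul_add, hxl]; ring
    have hy : 0 ≤ h * l := by positivity
    have e1 : 1 - h * l ≤ Real.exp (-(h * l)) := by linarith [Real.add_one_le_exp (-(h * l))]
    have e2 : Real.exp (-(h * l)) ≤ 1 - h * l + (h * l) ^ 2 := by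
      rw [Real.exp_neg]
      have h3 : (Real.exp (h * l))⁻¹ ≤ (1 + h * l)⁻¹ :=
        inv_anti₀ (by positivity) (by linarith [Real.add_one_le_exp (h * l)])
      refine h3.trans ?_
      rw [inv_le_iff_one_le_mul₀ (by positivity)]
      nlinarith [pow_nonneg hy 3]
    have e3 : Real.exp (-(h * l)) ≤ 1 := Real.exp_le_one_iff.2 (by linarith)
    have b1 : 0 ≤ h⁻¹ * (Real.exp (-(h * l)) - 1) + l := by
      have : h⁻¹ * (-(h * l)) ≤ h⁻¹ * (Real.exp (-(h * l)) - 1) := by gcongr; linarith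
      have h4 : h⁻¹ * (-(h * l)) = -l := by field_simp
      linarith
    have b2 : h⁻¹ * (Real.exp (-(h * l)) - 1) + l ≤ l := by
      have : h⁻¹ * (Real.exp (-(h * l)) - 1) ≤ 0 :=
        mul_nonpos_of_nonneg_of_nonpos (by positivity) (by linarith)
      linarith
    have b3 : h⁻¹ * (Real.exp (-(h * l)) - 1) + l ≤ h * l ^ 2 := by
      have : h⁻¹ * (Real.exp (-(h * l)) - 1) ≤ h⁻¹ * (-(h * l) + (h * l) ^ 2) := by
        gcongr; linarith
      have h4 : h⁻¹ * (-(h * l) + (h * l) ^ 2) = -l + h * l ^ 2 := by field_simp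
      linarith
    rw [hq, abs_of_nonneg (by positivity), abs_of_nonneg (by positivity)]
    constructor
    · calc _ ≤ x * l := by gcongr
        _ ≤ 1 := by linarith
    · calc _ ≤ x * (h * l ^ 2) * x := by gcongr
        _ = h * (x * l) ^ 2 := by ring
        _ = h * (1 - x) ^ 2 := by rw [hxl]
        _ ≤ h * 1 := by gcongr; nlinarith
        _ = h := mul_one h

/-! ### Functional calculus of an injective positive contraction. -/

section Abstract

variable {H : Type*} [NormedAddCommGroup H] [InnerProductSpace ℂ H]

lemma tendsto_zero_of_dense {ι : Type*} {l : Filter ι} {B : ι → H →L[ℂ] H} {c : ℝ}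
    (hB : ∀ᶠ i in l, ‖B i‖ ≤ c) {s : Set H} (hs : Dense s)
    (h : ∀ x ∈ s, Tendsto (fun i => B i x) l (𝓝 0)) (x : H) :
    Tendsto (fun i => B i x) l (𝓝 0) := by
  rw [Metric.tendsto_nhds]
  intro ε hε
  obtain ⟨y, hy, hxy⟩ := Metric.mem_closure_iff.1 (hs x) (ε / 2 / (|c| + 1)) (by positivity)
  filter_upwards [hB, Metric.tendsto_nhds.1 (h y hy) (ε / 2) (by positivity)] with i h1 h2
  rw [dist_zero_right] at h2 ⊢
  rw [dist_eq_norm] at hxy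
  have h3 : B i x = B i y + B i (x - y) := by rw [← map_add]; congr 1; abel
  have h4 : ‖B i (x - y)‖ ≤ (|c| + 1) * ‖x - y‖ := by
    refine (ContinuousLinearMap.le_opNorm _ _).trans ?_
    gcongr
    linarith [le_abs_self c]
  have h5 : (|c| + 1) * ‖x - y‖ < ε / 2 := by
    rw [lt_div_iff₀ (by positivity)] at hxy
    linarith
  calc ‖B i x‖ ≤ ‖B i y‖ + ‖B i (x - y)‖ := by rw [h3]; exact norm_add_le _ _
    _ < ε := by linarith

variable [CompleteSpace H]

/-- The semigroup generated by `1 - R⁻¹`. -/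
noncomputable def resolventSemigroup (R : H →L[ℂ] H) (t : ℝ) : H →L[ℂ] H :=
  cfc (resolventExp t) R

variable {R : H →L[ℂ] H}

lemma spectrum_bounds (hR : R.IsPositive) (hR1 : ‖R‖ ≤ 1) {x : ℝ} (hx : x ∈ spectrum ℝ R) :
    0 ≤ x ∧ x ≤ 1 := by
  refine ⟨spectrum_nonneg_of_nonneg (R.nonneg_iff_isPositive.2 hR) hx, ?_⟩
  have h1 := spectrum.norm_le_norm_mul_of_mem hx
  have h2 : ‖(1 : H →L[ℂ] H)‖ ≤ 1 := ContinuousLinearMap.norm_id_le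
  calc x ≤ ‖x‖ := le_abs_self x
    _ ≤ ‖R‖ * ‖(1 : H →L[ℂ] H)‖ := h1
    _ ≤ 1 * 1 := by gcongr
    _ = 1 := one_mul 1

lemma resolventSemigroup_zero (hR : R.IsPositive) : resolventSemigroup R 0 = 1 := by
  have h : resolventExp 0 = 1 := funext fun x => resolventExp_of_nonpos le_rfl x
  rw [resolventSemigroup, h, cfc_one ℝ R hR.isSelfAdjoint]

lemma resolventSemigroup_add (hR : R.IsPositive) (hR1 : ‖R‖ ≤ 1) {s t : ℝ} (hs : 0 ≤ s)
    (ht : 0 ≤ t) :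
    resolventSemigroup R (s + t) = resolventSemigroup R s * resolventSemigroup R t := by
  rw [resolventSemigroup, resolventSemigroup, resolventSemigroup,
    ← cfc_mul _ _ R (continuous_resolventExp s).continuousOn
      (continuous_resolventExp t).continuousOn]
  exact cfc_congr fun x hx => resolventExp_add hs ht (spectrum_bounds hR hR1 hx).1

lemma norm_resolventSemigroup_le (hR : R.IsPositive) (hR1 : ‖R‖ ≤ 1) {t : ℝ} (ht : 0 ≤ t) :
    ‖resolventSemigroup R t‖ ≤ 1 :=
  norm_cfc_le zero_le_one fun _ hx =>
    abs_resolventExp_le_one ht (spectrum_bounds hR hR1 hx).1 (spectrum_bounds hR hR1 hx).2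

lemma resolventSemigroup_mul (hR : R.IsPositive) (t : ℝ) :
    resolventSemigroup R t * R = cfc (fun x => resolventExp t x * x) R := by
  rw [cfc_mul (resolventExp t) (fun x => x) R (continuous_resolventExp t).continuousOn
    (by fun_prop),
    cfc_id' ℝ R hR.isSelfAdjoint, resolventSemigroup]

lemma resolventSemigroup_comm (hR : R.IsPositive) (t : ℝ) :
    resolventSemigroup R t * R = R * resolventSemigroup R t := by
  have h : R * resolventSemigroup R t = cfc (fun x => x * resolventExp t x) R := by
    rw [cfc_mul (fun x => x) (resolventExp t) R (by fun_prop)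
      (continuous_resolventExp t).continuousOn,
      cfc_id' ℝ R hR.isSelfAdjoint, resolventSemigroup]
  rw [h, resolventSemigroup_mul hR]
  simp only [mul_comm]

lemma dense_range_of_injective (hR : R.IsPositive) (hinj : ∀ x, R x = 0 → x = 0) :
    Dense (range R) := by
  have h : (LinearMap.range (R : H →ₗ[ℂ] H)).topologicalClosure = ⊤ := by
    rw [Submodule.topologicalClosure_eq_top_iff, Submodule.eq_bot_iff]
    intro x hx
    apply hinj
    have h1 := hx (R (R x)) ⟨R x, rfl⟩
    rw [hR.inner_left_eq_inner_right] at h1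
    exact inner_self_eq_zero.1 h1
  have h2 := Submodule.dense_iff_topologicalClosure_eq_top.2 h
  exact (LinearMap.coe_range (R : H →ₗ[ℂ] H)) ▸ h2

/-- The operators are uniformly bounded and Lipschitz in time on the range of $R$, which is dense
because $R$ is self-adjoint and injective. -/
lemma continuousOn_resolventSemigroup (hR : R.IsPositive) (hR1 : ‖R‖ ≤ 1)
    (hinj : ∀ x, R x = 0 → x = 0) (ψ : H) :
    ContinuousOn (fun t => resolventSemigroup R t ψ) (Ici 0) := by
  intro s hs
  have hs0 : 0 ≤ s := hs
  have key := tendsto_zero_of_dense (l := 𝓝[Ici 0] s)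
    (B := fun t => resolventSemigroup R t - resolventSemigroup R s) (c := 2) (by
      filter_upwards [self_mem_nhdsWithin] with t ht
      refine (norm_sub_le _ _).trans ?_
      linarith [norm_resolventSemigroup_le hR hR1 ht, norm_resolventSemigroup_le hR hR1 hs0])
    (dense_range_of_injective hR hinj) (by
      rintro _ ⟨χ, rfl⟩
      have h1 : ∀ᶠ t in 𝓝[Ici 0] s,
          ‖(resolventSemigroup R t - resolventSemigroup R s) (R χ)‖ ≤ |t - s| * ‖χ‖ := by
        filter_upwards [self_mem_nhdsWithin] with t ht
        have h2 : (resolventSemigroup R t - resolventSemigroup R s) * R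
            = cfc (fun x => (resolventExp t x - resolventExp s x) * x) R := by
          have := continuous_resolventExp t
          have := continuous_resolventExp s
          rw [cfc_mul (fun x => resolventExp t x - resolventExp s x) (fun x => x) R
            (by fun_prop) (by fun_prop), cfc_sub _ _ R (by fun_prop) (by fun_prop),
            cfc_id' ℝ R hR.isSelfAdjoint]
          rfl
        have h3 : ‖(resolventSemigroup R t - resolventSemigroup R s) * R‖ ≤ |t - s| := by
          rw [h2]
          exact norm_cfc_le (abs_nonneg _) fun x hx => abs_resolventExp_sub_mul_le hs0 ht
            (spectrum_bounds hR hR1 hx).1 (spectrum_bounds hR hR1 hx).2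
        exact ContinuousLinearMap.le_of_opNorm_le _ h3 χ
      refine squeeze_zero_norm' h1 ?_
      have h4 : Continuous fun t : ℝ => |t - s| * ‖χ‖ := by fun_prop
      have h5 := (h4.tendsto s).mono_left (nhdsWithin_le_nhds (s := Ici 0))
      simpa using h5) ψ
  have h6 : Tendsto (fun t => resolventSemigroup R t ψ - resolventSemigroup R s ψ) (𝓝[Ici 0] s)
      (𝓝 0) := key
  exact tendsto_sub_nhds_zero_iff.1 h6

lemma tendsto_quot_resolvent (hR : R.IsPositive) (hR1 : ‖R‖ ≤ 1)
    (hinj : ∀ x, R x = 0 → x = 0) (χ : H) :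
    Tendsto (fun h : ℝ => ((h⁻¹ : ℝ) : ℂ) • (resolventSemigroup R h (R χ) - R χ)) (𝓝[>] 0)
      (𝓝 (-(χ - R χ))) := by
  have hop : ∀ h : ℝ, cfc (resolventQuot h) R
      = ((h⁻¹ : ℝ) : ℂ) • (resolventSemigroup R h * R - R) + (1 - R) := by
    intro h
    have := continuous_resolventExp h
    have e1 : cfc (fun x : ℝ => h⁻¹ * (resolventExp h x * x - x)) R
        = (h⁻¹ : ℝ) • (resolventSemigroup R h * R - R) := by
      rw [cfc_const_mul h⁻¹ _ R (by fun_prop), cfc_sub _ _ R (by fun_prop) (by fun_prop),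
        cfc_id' ℝ R hR.isSelfAdjoint, resolventSemigroup_mul hR]
    have e2 : cfc (fun x : ℝ => 1 - x) R = 1 - R := by
      rw [cfc_sub (fun _ => (1 : ℝ)) (fun x => x) R (by fun_prop) (by fun_prop),
        cfc_id' ℝ R hR.isSelfAdjoint, cfc_const_one ℝ R hR.isSelfAdjoint]
    unfold resolventQuot
    rw [cfc_add R (fun x : ℝ => h⁻¹ * (resolventExp h x * x - x)) (fun x => 1 - x) (by fun_prop)
      (by fun_prop), e1, e2]
    rfl
  have key := tendsto_zero_of_dense (l := 𝓝[>] (0 : ℝ))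
    (B := fun h => cfc (resolventQuot h) R) (c := 1) (by
      filter_upwards [self_mem_nhdsWithin] with h hh
      exact norm_cfc_le zero_le_one fun x hx => (resolventQuot_bounds hh
        (spectrum_bounds hR hR1 hx).1 (spectrum_bounds hR hR1 hx).2).1)
    (dense_range_of_injective hR hinj) (by
      rintro _ ⟨η, rfl⟩
      have h1 : ∀ᶠ h in 𝓝[>] (0 : ℝ), ‖cfc (resolventQuot h) R (R η)‖ ≤ h * ‖η‖ := by
        filter_upwards [self_mem_nhdsWithin] with h hh
        have h2 : cfc (resolventQuot h) R * R = cfc (fun x => resolventQuot h x * x) R := by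
          have := continuous_resolventQuot h
          rw [cfc_mul (resolventQuot h) (fun x => x) R (by fun_prop) (by fun_prop),
            cfc_id' ℝ R hR.isSelfAdjoint]
        have h3 : ‖cfc (resolventQuot h) R * R‖ ≤ h := by
          rw [h2]
          exact norm_cfc_le (le_of_lt hh) fun x hx => (resolventQuot_bounds hh
            (spectrum_bounds hR hR1 hx).1 (spectrum_bounds hR hR1 hx).2).2
        exact ContinuousLinearMap.le_of_opNorm_le _ h3 η
      refine squeeze_zero_norm' h1 ?_
      have h4 : Continuous fun t : ℝ => t * ‖η‖ := by fun_prop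
      have h5 := (h4.tendsto 0).mono_left (nhdsWithin_le_nhds (s := Ioi 0))
      simpa using h5) χ
  have h6 := key.sub_const (χ - R χ)
  rw [zero_sub] at h6
  refine h6.congr fun h => ?_
  rw [hop h]
  simp

/-- The generator of the semigroup built from the resolvent. -/
theorem resolventSemigroup_generator (hR : R.IsPositive) (hR1 : ‖R‖ ≤ 1)
    (hinj : ∀ x, R x = 0 → x = 0) (ψ η : H) :
    R (ψ + η) = ψ ↔ Tendsto (fun h : ℝ => ((h⁻¹ : ℝ) : ℂ) • (resolventSemigroup R h ψ - ψ))
      (𝓝[>] 0) (𝓝 (-η)) := by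
  constructor
  · intro h
    have := tendsto_quot_resolvent hR hR1 hinj (ψ + η)
    rwa [h, add_sub_cancel_left] at this
  -- Apply $R$ to the difference quotients: it commutes with the semigroup, so the limit is also
  -- that for $R\psi$. Comparing, $R\eta=\psi-R\psi$.
  · intro h
    have h1 := (R.continuous.tendsto _).comp h
    have h2 := tendsto_quot_resolvent hR hR1 hinj ψ
    have h3 : (fun h : ℝ => ((h⁻¹ : ℝ) : ℂ) • (resolventSemigroup R h (R ψ) - R ψ))
        = R ∘ fun h : ℝ => ((h⁻¹ : ℝ) : ℂ) • (resolventSemigroup R h ψ - ψ) := by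
      ext h
      have h4 : resolventSemigroup R h (R ψ) = R (resolventSemigroup R h ψ) :=
        DFunLike.congr_fun (resolventSemigroup_comm hR h) ψ
      simp only [Function.comp_apply, map_smul, map_sub, h4]
    rw [h3] at h2
    have h5 := tendsto_nhds_unique h1 h2
    rw [map_neg, neg_inj] at h5
    rw [map_add, h5]; abel

end Abstract

namespace Params

/-! ### The weight `ν` -/

/-- The Lebesgue density of `ν`. -/
noncomputable def density (w : ℝ) : ℝ := Real.exp (-w) * lg w ^ (5 / 2 : ℝ)

lemma density_pos (w : ℝ) : 0 < density w :=
  mul_pos (Real.exp_pos _) (Real.rpow_pos_of_pos (lg_pos w) _)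

lemma continuous_density : Continuous density := by
  have := continuous_lg_rpow (5 / 2)
  unfold density; fun_prop

lemma measurable_ofReal_density : Measurable fun w => ENNReal.ofReal (density w) :=
  continuous_density.measurable.ennreal_ofReal

lemma integrable_nu_iff {E : Type*} [NormedAddCommGroup E] [NormedSpace ℝ E] {g : ℝ → E} :
    Integrable g nu ↔ Integrable fun w => density w • g w := by
  have h := integrable_withDensity_iff_integrable_smul' (μ := volume) (g := g)
    measurable_ofReal_density (ae_of_all _ fun _ => ENNReal.ofReal_lt_top)
  simp only [ENNReal.toReal_ofReal (density_pos _).le] at h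
  exact h

lemma integral_nu {E : Type*} [NormedAddCommGroup E] [NormedSpace ℝ E] (g : ℝ → E) :
    ∫ w, g w ∂nu = ∫ w, density w • g w := by
  have h := integral_withDensity_eq_integral_toReal_smul (μ := volume)
    measurable_ofReal_density (ae_of_all _ fun _ => ENNReal.ofReal_lt_top) g
  simp only [ENNReal.toReal_ofReal (density_pos _).le] at h
  exact h

/-! ### Square integrability of the weights with respect to $\nu$. -/

lemma W_sq_le (v : ℝ) : W v ^ 2 ≤ 2 * ((lg v)⁻¹ + lg v) := by
  have h1 : (lg v ^ (-(1 / 2) : ℝ)) ^ 2 = (lg v)⁻¹ := by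
    rw [← Real.rpow_natCast, ← Real.rpow_mul (lg_nonneg v), ← Real.rpow_neg_one]; norm_num
  have h2 : (lg v ^ (1 / 2 : ℝ)) ^ 2 = lg v := by
    rw [← Real.rpow_natCast, ← Real.rpow_mul (lg_nonneg v)]; norm_num
  have h3 := sq_nonneg (lg v ^ (-(1 / 2) : ℝ) - lg v ^ (1 / 2 : ℝ))
  rw [W]
  calc _ ≤ 2 * ((lg v ^ (-(1 / 2) : ℝ)) ^ 2 + (lg v ^ (1 / 2 : ℝ)) ^ 2) := by linarith
    _ = _ := by rw [h1, h2]

lemma density_mul_W_sq_le (v : ℝ) :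
    density v * W v ^ 2 ≤ 2 * Real.exp (-v) * (lg v ^ (3 / 2 : ℝ) + lg v ^ (7 / 2 : ℝ)) := by
  have h1 : lg v ^ (5 / 2 : ℝ) * (lg v)⁻¹ = lg v ^ (3 / 2 : ℝ) := by
    rw [← Real.rpow_neg_one, ← Real.rpow_add (lg_pos v)]; norm_num
  have h2 : lg v ^ (5 / 2 : ℝ) * lg v = lg v ^ (7 / 2 : ℝ) := by
    nth_rewrite 2 [← Real.rpow_one (lg v)]
    rw [← Real.rpow_add (lg_pos v)]; norm_num
  calc _ ≤ density v * (2 * ((lg v)⁻¹ + lg v)) :=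
        mul_le_mul_of_nonneg_left (W_sq_le v) (density_pos v).le
    _ = _ := by rw [← h1, ← h2, density]; ring

/-- On the left the exponent is $-1+\frac32-2\alpha>\frac16$, by $\alpha<\frac16$. On the right it
is $-1+\frac14+2\mu c_0<-\frac14$, by $\mu c_0<\frac14$; the $\frac14$ pays for powers of
$1+v\le16e^{v/16}$ up to the fourth. -/
lemma density_mul_W_mul_G_sq_le {p : Params} (hp : p.Admissible) (v : ℝ) :
    density v * (W v * p.G v) ^ 2 ≤ 16 * 16 ^ 4 * Real.exp (-(1 / 6 * |v|)) := by
  have hα := hp.α_pos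
  have hα' := hp.α_lt
  have hk : 0 < p.μ * p.c₀ := hp.α_pos.trans hp.lt_μc₀
  have hk' := hp.μc₀_lt
  rw [mul_pow, ← mul_assoc]
  rcases le_total v 0 with h | h
  · have e1 : lg v ≤ Real.exp v := lg_le_exp v
    have b1 : lg v ^ (3 / 2 : ℝ) ≤ Real.exp (3 / 2 * v) :=
      (Real.rpow_le_rpow (lg_nonneg v) e1 (by norm_num)).trans_eq (by
        rw [← Real.exp_mul, mul_comm])
    have b2 : lg v ^ (7 / 2 : ℝ) ≤ Real.exp (3 / 2 * v) :=
      (Real.rpow_le_rpow (lg_nonneg v) e1 (by norm_num)).trans (by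
        rw [← Real.exp_mul]; exact Real.exp_le_exp.2 (by linarith))
    have g1 : p.G v ≤ 2 * Real.exp (-p.α * v) := by
      have : Real.exp (p.μ * p.c₀ * v) ≤ Real.exp (-p.α * v) := Real.exp_le_exp.2 (by nlinarith)
      rw [G]; linarith
    calc _ ≤ 2 * Real.exp (-v) * (lg v ^ (3 / 2 : ℝ) + lg v ^ (7 / 2 : ℝ)) * p.G v ^ 2 :=
          mul_le_mul_of_nonneg_right (density_mul_W_sq_le v) (sq_nonneg _)
      _ ≤ 2 * Real.exp (-v) * (Real.exp (3 / 2 * v) + Real.exp (3 / 2 * v))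
            * (2 * Real.exp (-p.α * v)) ^ 2 := by
          have := p.G_pos v
          gcongr
      _ = 16 * Real.exp ((1 / 2 - 2 * p.α) * v) := by
          have e : Real.exp ((1 / 2 - 2 * p.α) * v) = Real.exp (-v) * Real.exp (3 / 2 * v)
              * Real.exp (-p.α * v) ^ 2 := by
            rw [← Real.exp_nat_mul, ← Real.exp_add, ← Real.exp_add]; congr 1; push_cast; ring
          rw [e]; ring
      _ ≤ 16 * 16 ^ 4 * Real.exp (-(1 / 6 * |v|)) := by
          have : Real.exp ((1 / 2 - 2 * p.α) * v) ≤ Real.exp (-(1 / 6 * |v|)) := by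
            rw [abs_of_nonpos h]
            exact Real.exp_le_exp.2 (by nlinarith)
          nlinarith [Real.exp_pos (-(1 / 6 * |v|))]
  · have e1 : lg v ≤ 1 + v := by linarith [lg_le_add_one h]
    have e2 : (1 + v) ^ 4 ≤ 16 ^ 4 * Real.exp (1 / 4 * v) := by
      have h1 : 1 + v ≤ 16 * Real.exp (v / 16) := by linarith [Real.add_one_le_exp (v / 16)]
      calc _ ≤ (16 * Real.exp (v / 16)) ^ 4 := by gcongr
        _ = _ := by rw [mul_pow, ← Real.exp_nat_mul]; congr 2; push_cast; ring
    have b : ∀ s : ℝ, 0 ≤ s → s ≤ 4 → lg v ^ s ≤ 16 ^ 4 * Real.exp (1 / 4 * v) := by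
      intro s hs hs4
      calc lg v ^ s ≤ (1 + v) ^ s := Real.rpow_le_rpow (lg_nonneg v) e1 hs
        _ ≤ (1 + v) ^ (4 : ℝ) := Real.rpow_le_rpow_of_exponent_le (by linarith) hs4
        _ = (1 + v) ^ 4 := by norm_cast
        _ ≤ _ := e2
    have g1 : p.G v ≤ 2 * Real.exp (p.μ * p.c₀ * v) := by
      have : Real.exp (-p.α * v) ≤ Real.exp (p.μ * p.c₀ * v) := Real.exp_le_exp.2 (by nlinarith)
      rw [G]; linarith
    calc _ ≤ 2 * Real.exp (-v) * (lg v ^ (3 / 2 : ℝ) + lg v ^ (7 / 2 : ℝ)) * p.G v ^ 2 :=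
          mul_le_mul_of_nonneg_right (density_mul_W_sq_le v) (sq_nonneg _)
      _ ≤ 2 * Real.exp (-v) * (16 ^ 4 * Real.exp (1 / 4 * v) + 16 ^ 4 * Real.exp (1 / 4 * v))
            * (2 * Real.exp (p.μ * p.c₀ * v)) ^ 2 := by
          have := p.G_pos v
          have := b (3 / 2) (by norm_num) (by norm_num)
          have := b (7 / 2) (by norm_num) (by norm_num)
          gcongr
      _ = 16 * 16 ^ 4 * Real.exp ((2 * (p.μ * p.c₀) - 3 / 4) * v) := by
          have e : Real.exp ((2 * (p.μ * p.c₀) - 3 / 4) * v) = Real.exp (-v) * Real.exp (1 / 4 * v)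
              * Real.exp (p.μ * p.c₀ * v) ^ 2 := by
            rw [← Real.exp_nat_mul, ← Real.exp_add, ← Real.exp_add]; congr 1; push_cast; ring
          rw [e]; ring
      _ ≤ 16 * 16 ^ 4 * Real.exp (-(1 / 6 * |v|)) := by
          rw [abs_of_nonneg h]
          gcongr
          nlinarith

lemma memLp_W_mul_G {p : Params} (hp : p.Admissible) : MemLp (fun v => W v * p.G v) 2 nu := by
  have hc : Continuous fun v => W v * p.G v := continuous_W.mul p.continuous_G
  rw [memLp_two_iff_integrable_sq hc.aestronglyMeasurable, integrable_nu_iff]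
  refine integrable_of_le_exp_abs
    (continuous_density.smul (hc.pow 2)).aestronglyMeasurable
    (C := 16 * 16 ^ 4) (by norm_num : (0 : ℝ) < 1 / 6) fun w => ?_
  rw [smul_eq_mul, Real.norm_of_nonneg (mul_nonneg (density_pos w).le (sq_nonneg _))]
  exact density_mul_W_mul_G_sq_le hp w

lemma memLp_of_le {p : Params} (hp : p.Admissible) {E : Type*} [NormedAddCommGroup E] {f : ℝ → E}
    (hf : AEStronglyMeasurable f nu) {M : ℝ} (hb : ∀ v, ‖f v‖ ≤ M * (W v * p.G v)) :
    MemLp f 2 nu :=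
  (memLp_W_mul_G hp).of_le_mul hf (ae_of_all _ fun v => (hb v).trans_eq (by
    rw [Real.norm_of_nonneg (mul_pos (W_pos v) (p.G_pos v)).le]))

lemma G_le_W_mul_G (p : Params) (v : ℝ) : p.G v ≤ W v * p.G v :=
  le_mul_of_one_le_left (p.G_pos v).le (by linarith [two_le_W v])

lemma memLp_of_le_G {p : Params} (hp : p.Admissible) {E : Type*} [NormedAddCommGroup E] {f : ℝ → E}
    (hf : Continuous f) {M : ℝ} (hM : 0 ≤ M) (hb : ∀ v, ‖f v‖ ≤ M * p.G v) : MemLp f 2 nu :=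
  memLp_of_le hp hf.aestronglyMeasurable fun v =>
    (hb v).trans (mul_le_mul_of_nonneg_left (p.G_le_W_mul_G v) hM)

lemma isFiniteMeasure_nu {p : Params} (hp : p.Admissible) : IsFiniteMeasure nu := by
  have h : MemLp (fun _ : ℝ => (1 : ℝ)) 2 nu :=
    memLp_of_le_G hp continuous_const zero_le_one fun v => by
      rw [norm_one, one_mul]; exact one_le_G hp v
  rcases (memLp_const_iff (by norm_num) (by norm_num)).1 h with h | h
  · exact absurd h one_ne_zero
  · exact ⟨h⟩

instance sigmaFinite_nu : SigmaFinite nu :=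
  SigmaFinite.withDensity_of_ne_top (ae_of_all _ fun _ => ENNReal.ofReal_ne_top)

/-! ### The generator on continuous functions -/

/-- The function `V ψ - K ψ`. -/
noncomputable def gen (p : Params) (ψ : ℝ → ℂ) (v : ℝ) : ℂ := p.V v • ψ v - p.Kop ψ v

/-- The drift inequality is used here only as an upper bound for $KG$. The first estimate controls
absolute row integrals of the form, the second gives square integrability of $V\psi-K\psi$. -/
lemma exists_gen_le {p : Params} (hp : p.Admissible) : ∃ C, 0 < C ∧ ∀ (ψ : ℝ → ℂ) (M : ℝ), 0 ≤ M →
    (∀ v, ‖ψ v‖ ≤ M * p.G v) → ∀ v, p.V v * (M * p.G v) + M * p.Kop p.G v ≤ M * C * (W v * p.G v)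
      ∧ ‖p.gen ψ v‖ ≤ M * C * (W v * p.G v) := by
  obtain ⟨c, D, hc, hD, hdr⟩ := exists_drift hp
  obtain ⟨C, hC, hV⟩ := exists_V_le hp
  refine ⟨2 * C + D, by positivity, fun ψ M hM hb v => ?_⟩
  have hG := one_le_G hp v
  have hW := two_le_W v
  have h1 : p.V v * (M * p.G v) + M * p.Kop p.G v ≤ M * (2 * C + D) * (W v * p.G v) := by
    have h2 := hdr v
    have h3 : p.V v * p.G v ≤ C * W v * p.G v := mul_le_mul_of_nonneg_right (hV v) (by linarith)
    have h4 : 0 ≤ c * (W v * p.G v) := by positivity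
    have h5 : D ≤ D * (W v * p.G v) := le_mul_of_one_le_right hD (by nlinarith)
    have h6 : p.V v * p.G v + p.Kop p.G v ≤ (2 * C + D) * (W v * p.G v) := by linarith
    calc _ = M * (p.V v * p.G v + p.Kop p.G v) := by ring
      _ ≤ M * ((2 * C + D) * (W v * p.G v)) := by gcongr
      _ = _ := by ring
  refine ⟨h1, (norm_sub_le _ _).trans (le_trans (add_le_add ?_ (norm_Kop_le_mul hp v hb)) h1)⟩
  rw [norm_smul, Real.norm_of_nonneg (V_nonneg hp v)]
  exact mul_le_mul_of_nonneg_left (hb v) (V_nonneg hp v)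

lemma continuous_gen {p : Params} (hp : p.Admissible) {ψ : ℝ → ℂ} (hc : Continuous ψ) {M : ℝ}
    (hM : 0 ≤ M) (hb : ∀ v, ‖ψ v‖ ≤ M * p.G v) : Continuous (p.gen ψ) :=
  ((continuous_V hp).smul hc).sub (continuous_Kop_const hp hc hM hb)

/-! ### The symmetric kernel -/

lemma kernelBarEps_symm (p : Params) (v w : ℝ) : p.kernelBarEps v w = p.kernelBarEps w v := by
  unfold kernelBarEps kernelBar reg
  rw [mul_comm (lg v), abs_sub_comm v w, min_comm v w, max_comm v w]

lemma density_mul_kernelBarEps (p : Params) {v w : ℝ} (h : w ≠ v) :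
    density w * p.kernelBarEps v w = p.K3eps v w := by
  have hL : (lg v * lg w) ^ (-(3 / 2) : ℝ) * lg w ^ (5 / 2 : ℝ)
      = lg v ^ (-(3 / 2) : ℝ) * lg w := by
    rw [Real.mul_rpow (lg_nonneg v) (lg_nonneg w), mul_assoc, ← Real.rpow_add (lg_pos w)]
    norm_num
  unfold kernelBarEps K3eps
  rw [← mul_assoc]
  congr 1
  unfold kernelBar density
  have key : Real.exp (-w) * (Real.exp (-|v - w|) / (1 + Real.exp (-min v w) + Real.exp (-max v w)))
      * ((2 + Real.exp (max v w)) / (1 - Real.exp (-|v - w|))) * (4 * p.nbar)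
      * (lg v ^ (-(3 / 2) : ℝ) * lg w) = p.K3 v w := by
    have hx := Real.exp_pos v
    have hy := Real.exp_pos w
    rcases lt_or_gt_of_ne h with h | h
    · rw [K3, if_pos h, K1, K2, max_eq_left h.le, min_eq_right h.le, abs_of_pos (by linarith)]
      have e : Real.exp (-(v - w)) = Real.exp w / Real.exp v := by rw [← Real.exp_sub]; ring_nf
      have hlt := Real.exp_lt_exp.2 h
      rw [e, Real.exp_neg, Real.exp_neg]
      have h1 : Real.exp v - Real.exp w ≠ 0 := by linarith
      have h2 : 1 - Real.exp w / Real.exp v ≠ 0 := by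
        rw [one_sub_div hx.ne']; exact div_ne_zero h1 hx.ne'
      field_simp
      ring
    · rw [K3, if_neg (not_lt.2 h.le), Kup, max_eq_right h.le, min_eq_left h.le,
        abs_of_neg (by linarith)]
      have e : Real.exp (-(w - v)) = Real.exp v / Real.exp w := by rw [← Real.exp_sub]; ring_nf
      have hlt := Real.exp_lt_exp.2 h
      rw [neg_sub, e, Real.exp_neg, Real.exp_neg]
      have h1 : Real.exp w - Real.exp v ≠ 0 := by linarith
      have h2 : 1 - Real.exp v / Real.exp w ≠ 0 := by
        rw [one_sub_div hy.ne']; exact div_ne_zero h1 hy.ne'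
      field_simp
      ring
  rw [← key, ← hL]
  ring

lemma kernelBarEps_nonneg {p : Params} (hp : p.Admissible) (v w : ℝ) : 0 ≤ p.kernelBarEps v w := by
  rcases eq_or_ne w v with h | h
  · simp [h, kernelBarEps, kernelBar]
  · have h1 := density_mul_kernelBarEps p h
    have h2 := K3eps_nonneg hp v w
    rw [← h1] at h2
    exact nonneg_of_mul_nonneg_right h2 (density_pos w)

lemma measurable_kernelBarEps (p : Params) :
    Measurable fun z : ℝ × ℝ => p.kernelBarEps z.1 z.2 := by
  have h1 := measurable_lg
  have h2 := (continuous_eps p).measurable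
  unfold kernelBarEps kernelBar reg
  fun_prop

/-! ### The form on continuous functions -/

lemma integrable_K3eps_smul_sub {p : Params} (hp : p.Admissible) {ψ : ℝ → ℂ} (hc : Continuous ψ)
    {M : ℝ} (hb : ∀ v, ‖ψ v‖ ≤ M * p.G v) (v : ℝ) :
    Integrable fun w => p.K3eps v w • (ψ v - ψ w) := by
  have h1 : Integrable fun w => p.K3eps v w • ψ v := (integrable_K3eps hp v).smul_const _
  have h2 : Integrable fun w => p.K3eps v w • ψ w :=
    integrable_K3eps_smul hp v hc.aestronglyMeasurable hb
  refine (h1.sub h2).congr (ae_of_all _ fun w => ?_)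
  simp only [Pi.sub_apply, smul_sub]

lemma integral_K3eps_smul_sub {p : Params} (hp : p.Admissible) {ψ : ℝ → ℂ} (hc : Continuous ψ)
    {M : ℝ} (hb : ∀ v, ‖ψ v‖ ≤ M * p.G v) (v : ℝ) :
    ∫ w, p.K3eps v w • (ψ v - ψ w) = p.gen ψ v := by
  have h1 : Integrable fun w => p.K3eps v w • ψ v := (integrable_K3eps hp v).smul_const _
  have h2 : Integrable fun w => p.K3eps v w • ψ w :=
    integrable_K3eps_smul hp v hc.aestronglyMeasurable hb
  simp only [smul_sub]
  rw [integral_sub h1 h2, integral_smul_const, ← V_eq_integral hp]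
  rfl

lemma ae_density_smul_kernelBarEps (p : Params) {E : Type*} [AddCommGroup E] [Module ℝ E] (v : ℝ)
    (g : ℝ → E) :
    (fun w => density w • (p.kernelBarEps v w • g w)) =ᵐ[volume] fun w => p.K3eps v w • g w := by
  filter_upwards [compl_mem_ae_iff.2 (measure_singleton v)] with w hw
  rw [smul_smul, density_mul_kernelBarEps p hw]

/-- The regularization makes $V$ finite, so this unsymmetrized term converges absolutely by itself:
its row integrals are at most $|\varphi|(VMG+MKG)$, a product of two $L^2(\nu)$ functions up to a
constant. Fubini then produces $V\psi-K\psi$. -/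
lemma integrable_cross {p : Params} (hp : p.Admissible) {φ ψ : ℝ → ℂ} (hφ : MemLp φ 2 nu)
    (hc : Continuous ψ) {M : ℝ} (hM : 0 ≤ M) (hb : ∀ v, ‖ψ v‖ ≤ M * p.G v) :
    Integrable (fun z : ℝ × ℝ => p.kernelBarEps z.1 z.2 • (conj (φ z.1) * (ψ z.1 - ψ z.2)))
      (nu.prod nu) ∧
    ∫ z : ℝ × ℝ, p.kernelBarEps z.1 z.2 • (conj (φ z.1) * (ψ z.1 - ψ z.2)) ∂(nu.prod nu)
      = ∫ v, conj (φ v) * p.gen ψ v ∂nu := by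
  have hm : AEStronglyMeasurable
      (fun z : ℝ × ℝ => p.kernelBarEps z.1 z.2 • (conj (φ z.1) * (ψ z.1 - ψ z.2)))
      (nu.prod nu) := by
    refine (measurable_kernelBarEps p).aestronglyMeasurable.smul (AEStronglyMeasurable.mul ?_ ?_)
    · exact Complex.continuous_conj.comp_aestronglyMeasurable hφ.1.comp_fst
    · exact (by fun_prop : Continuous fun z : ℝ × ℝ => ψ z.1 - ψ z.2).aestronglyMeasurable
  have hrow : ∀ v, (fun w => density w • (p.kernelBarEps v w • (conj (φ v) * (ψ v - ψ w))))
      =ᵐ[volume] fun w => conj (φ v) * (p.K3eps v w • (ψ v - ψ w)) := fun v =>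
    (ae_density_smul_kernelBarEps p v _).trans (ae_of_all _ fun w => by
      simp only [Complex.real_smul]; ring)
  have hi : Integrable (fun z : ℝ × ℝ => p.kernelBarEps z.1 z.2 • (conj (φ z.1) * (ψ z.1 - ψ z.2)))
      (nu.prod nu) := by
    rw [integrable_prod_iff hm]
    refine ⟨ae_of_all _ fun v => ?_, ?_⟩
    · rw [integrable_nu_iff]
      exact ((integrable_K3eps_smul_sub hp hc hb v).const_mul _).congr (hrow v).symm
    · obtain ⟨C, hC, hCb⟩ := exists_gen_le hp
      have hdom : Integrable (fun v => ‖φ v‖ * (M * C * (W v * p.G v))) nu :=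
        hφ.norm.integrable_mul ((memLp_W_mul_G hp).const_mul (M * C))
      refine hdom.mono' hm.norm.integral_prod_right' (ae_of_all _ fun v => ?_)
      rw [Real.norm_of_nonneg (integral_nonneg fun _ => norm_nonneg _), integral_nu]
      have e : ∫ w, density w • ‖p.kernelBarEps v w • (conj (φ v) * (ψ v - ψ w))‖
          = ∫ w, ‖φ v‖ * (p.K3eps v w * ‖ψ v - ψ w‖) := by
        refine integral_congr_ae ?_
        filter_upwards [ae_density_smul_kernelBarEps p v fun w => ‖φ v‖ * ‖ψ v - ψ w‖] with w hw
        rw [norm_smul, norm_mul, RCLike.norm_conj, Real.norm_of_nonneg (kernelBarEps_nonneg hp v w)]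
        simp only [smul_eq_mul] at hw ⊢
        rw [hw]; ring
      rw [e, integral_const_mul]
      refine mul_le_mul_of_nonneg_left ?_ (norm_nonneg _)
      refine le_trans ?_ (hCb ψ M hM hb v).1
      have i1 : Integrable fun w => p.K3eps v w * ‖ψ v - ψ w‖ :=
        (integrable_K3eps_smul_sub hp hc hb v).norm.congr (ae_of_all _ fun w => by
          simp only [norm_smul, Real.norm_of_nonneg (K3eps_nonneg hp v w)])
      have i2 : Integrable fun w => p.K3eps v w * (M * p.G v) := (integrable_K3eps hp v).mul_const _
      have i3 : Integrable fun w => M * (p.K3eps v w * p.G w) :=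
        (integrable_K3eps_mul_G hp v).const_mul _
      calc ∫ w, p.K3eps v w * ‖ψ v - ψ w‖
          ≤ ∫ w, (p.K3eps v w * (M * p.G v) + M * (p.K3eps v w * p.G w)) := by
            refine integral_mono i1 (i2.add i3) fun w => ?_
            have h1 : ‖ψ v - ψ w‖ ≤ M * p.G v + M * p.G w :=
              (norm_sub_le _ _).trans (add_le_add (hb v) (hb w))
            have h2 := mul_le_mul_of_nonneg_left h1 (K3eps_nonneg hp v w)
            linarith
        _ = _ := by
            rw [integral_add i2 i3, integral_mul_const, integral_const_mul, ← V_eq_integral hp]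
            rfl
  refine ⟨hi, ?_⟩
  rw [integral_prod _ hi]
  refine integral_congr_ae (ae_of_all _ fun v => ?_)
  simp only
  rw [integral_nu, integral_congr_ae (hrow v), integral_const_mul, integral_K3eps_smul_sub hp hc hb]

/-- By symmetry of the kernel the integrand is the cross term plus its image under the swap of
variables. Here $\varphi$ need only be in $L^2(\nu)$. -/
lemma integrable_form_integrand {p : Params} (hp : p.Admissible) {φ ψ : ℝ → ℂ} (hφ : MemLp φ 2 nu)
    (hc : Continuous ψ) {M : ℝ} (hM : 0 ≤ M) (hb : ∀ v, ‖ψ v‖ ≤ M * p.G v) :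
    Integrable (fun z : ℝ × ℝ => p.kernelBarEps z.1 z.2 •
      (conj (φ z.1 - φ z.2) * (ψ z.1 - ψ z.2))) (nu.prod nu) ∧
    ∫ z : ℝ × ℝ, p.kernelBarEps z.1 z.2 • (conj (φ z.1 - φ z.2) * (ψ z.1 - ψ z.2)) ∂(nu.prod nu)
      = 2 * ∫ v, conj (φ v) * p.gen ψ v ∂nu := by
  obtain ⟨h1, h2⟩ := integrable_cross hp hφ hc hM hb
  have e : (fun z : ℝ × ℝ => p.kernelBarEps z.1 z.2 • (conj (φ z.1 - φ z.2) * (ψ z.1 - ψ z.2)))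
      = fun z => p.kernelBarEps z.1 z.2 • (conj (φ z.1) * (ψ z.1 - ψ z.2))
        + p.kernelBarEps z.swap.1 z.swap.2 • (conj (φ z.swap.1) * (ψ z.swap.1 - ψ z.swap.2)) := by
    funext z
    simp only [Prod.fst_swap, Prod.snd_swap, kernelBarEps_symm p z.2 z.1, map_sub,
      Complex.real_smul]
    ring
  have h3 := h1.swap
  rw [e]
  refine ⟨h1.add h3, ?_⟩
  refine (integral_add h1 h3).trans ?_
  simp only [Function.comp_def]
  rw [integral_prod_swap (fun z : ℝ × ℝ => p.kernelBarEps z.1 z.2 • (conj (φ z.1) * (ψ z.1 - ψ z.2))), h2, two_mul]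

lemma ae_prod_sub {f g : ℝ → ℂ} (h : f =ᵐ[nu] g) :
    (fun z : ℝ × ℝ => f z.1 - f z.2) =ᵐ[nu.prod nu] fun z => g z.1 - g z.2 :=
  (Measure.quasiMeasurePreserving_fst.ae_eq_comp h).sub
    (Measure.quasiMeasurePreserving_snd.ae_eq_comp h)

/-- Functions in `X` belong to the domain of the generator, where it acts as `V - K`. -/
lemma mem_graphL3 {p : Params} (hp : p.Admissible) {ψ : ℝ → ℂ} (hc : Continuous ψ) {M : ℝ}
    (hM : 0 ≤ M) (hb : ∀ v, ‖ψ v‖ ≤ M * p.G v) (hψ : MemLp ψ 2 nu) (hη : MemLp (p.gen ψ) 2 nu) :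
    (hψ.toLp ψ, hη.toLp (p.gen ψ)) ∈ p.graphL3 := by
  have hsub := ae_prod_sub hψ.coeFn_toLp
  constructor
  · have h1 := (integrable_form_integrand hp hψ hc hM hb).1
    have h2 : ∫⁻ z : ℝ × ℝ, ENNReal.ofReal
        (p.kernelBarEps z.1 z.2 * ‖hψ.toLp ψ z.1 - hψ.toLp ψ z.2‖ ^ 2) ∂(nu.prod nu)
        = ∫⁻ z : ℝ × ℝ, ‖p.kernelBarEps z.1 z.2 •
          (conj (ψ z.1 - ψ z.2) * (ψ z.1 - ψ z.2))‖ₑ ∂(nu.prod nu) := by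
      refine lintegral_congr_ae ?_
      filter_upwards [hsub] with z hz
      rw [hz, ← ofReal_norm, norm_smul, norm_mul, RCLike.norm_conj, ← sq,
        Real.norm_of_nonneg (kernelBarEps_nonneg hp _ _)]
    exact h2.trans_lt h1.2
  · intro φ _
    have h1 := (integrable_form_integrand hp (Lp.memLp φ) hc hM hb).2
    have h2 : p.form φ (hψ.toLp ψ) = (1 / 2 : ℝ) • ∫ z : ℝ × ℝ, p.kernelBarEps z.1 z.2 •
        (conj (φ z.1 - φ z.2) * (ψ z.1 - ψ z.2)) ∂(nu.prod nu) := by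
      unfold form
      congr 1
      refine integral_congr_ae ?_
      filter_upwards [hsub] with z hz
      rw [hz]
    rw [h2, h1, L2.inner_def]
    simp only [Complex.real_smul]
    push_cast
    rw [← mul_assoc]
    norm_num
    refine integral_congr_ae ?_
    filter_upwards [hη.coeFn_toLp] with v hv
    rw [hv, mul_comm]

/-! ### The form domain as a Hilbert space -/

/-- The measure on pairs for which the form is the `L²` inner product of differences. -/
noncomputable def jump (p : Params) : Measure (ℝ × ℝ) :=
  (nu.prod nu).withDensity fun z => ENNReal.ofReal (1 / 2 * p.kernelBarEps z.1 z.2)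

lemma measurable_jump_density (p : Params) :
    Measurable fun z : ℝ × ℝ => ENNReal.ofReal (1 / 2 * p.kernelBarEps z.1 z.2) :=
  ((measurable_kernelBarEps p).const_mul _).ennreal_ofReal

lemma jump_absolutelyContinuous (p : Params) : p.jump ≪ nu.prod nu :=
  withDensity_absolutelyContinuous _ _

lemma aestronglyMeasurable_sub (p : Params) (ψ : L2) :
    AEStronglyMeasurable (fun z : ℝ × ℝ => ψ z.1 - ψ z.2) p.jump :=
  ((Lp.aestronglyMeasurable ψ).comp_fst.sub (Lp.aestronglyMeasurable ψ).comp_snd).mono_ac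
    p.jump_absolutelyContinuous

lemma integrable_jump_iff {p : Params} (hp : p.Admissible) {E : Type*} [NormedAddCommGroup E]
    [NormedSpace ℝ E] {g : ℝ × ℝ → E} : Integrable g p.jump ↔
      Integrable (fun z => (1 / 2 * p.kernelBarEps z.1 z.2) • g z) (nu.prod nu) := by
  have h := integrable_withDensity_iff_integrable_smul' (μ := nu.prod nu) (g := g)
    (measurable_jump_density p) (ae_of_all _ fun _ => ENNReal.ofReal_lt_top)
  have h0 : ∀ z : ℝ × ℝ, 0 ≤ 1 / 2 * p.kernelBarEps z.1 z.2 := fun z =>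
    mul_nonneg (by norm_num) (kernelBarEps_nonneg hp _ _)
  simp only [ENNReal.toReal_ofReal (h0 _)] at h
  exact h

lemma integral_jump {p : Params} (hp : p.Admissible) {E : Type*} [NormedAddCommGroup E]
    [NormedSpace ℝ E] (g : ℝ × ℝ → E) :
    ∫ z, g z ∂p.jump = ∫ z : ℝ × ℝ, (1 / 2 * p.kernelBarEps z.1 z.2) • g z ∂(nu.prod nu) := by
  have h := integral_withDensity_eq_integral_toReal_smul (μ := nu.prod nu)
    (measurable_jump_density p) (ae_of_all _ fun _ => ENNReal.ofReal_lt_top) g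
  have h0 : ∀ z : ℝ × ℝ, 0 ≤ 1 / 2 * p.kernelBarEps z.1 z.2 := fun z =>
    mul_nonneg (by norm_num) (kernelBarEps_nonneg hp _ _)
  simp only [ENNReal.toReal_ofReal (h0 _)] at h
  exact h

lemma mem_formDomain_iff {p : Params} (hp : p.Admissible) {ψ : L2} :
    ψ ∈ p.formDomain ↔ MemLp (fun z : ℝ × ℝ => ψ z.1 - ψ z.2) 2 p.jump := by
  have hm : AEStronglyMeasurable (fun z : ℝ × ℝ => ψ z.1 - ψ z.2) (nu.prod nu) :=
    (Lp.aestronglyMeasurable ψ).comp_fst.sub (Lp.aestronglyMeasurable ψ).comp_snd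
  have hk : AEStronglyMeasurable
      (fun z : ℝ × ℝ => p.kernelBarEps z.1 z.2 * ‖ψ z.1 - ψ z.2‖ ^ 2) (nu.prod nu) :=
    (measurable_kernelBarEps p).aestronglyMeasurable.mul (hm.norm.pow 2)
  rw [memLp_two_iff_integrable_sq_norm (aestronglyMeasurable_sub p ψ), integrable_jump_iff hp]
  have e : (fun z : ℝ × ℝ => (1 / 2 * p.kernelBarEps z.1 z.2) • ‖ψ z.1 - ψ z.2‖ ^ 2)
      = fun z => (1 / 2 : ℝ) * (p.kernelBarEps z.1 z.2 * ‖ψ z.1 - ψ z.2‖ ^ 2) := by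
    funext z; rw [smul_eq_mul, mul_assoc]
  rw [e, integrable_const_mul_iff (by norm_num : IsUnit (1 / 2 : ℝ))]
  have h0 : 0 ≤ᵐ[nu.prod nu] fun z : ℝ × ℝ => p.kernelBarEps z.1 z.2 * ‖ψ z.1 - ψ z.2‖ ^ 2 :=
    ae_of_all _ fun z => mul_nonneg (kernelBarEps_nonneg hp _ _) (sq_nonneg _)
  rw [Integrable, and_iff_right hk, hasFiniteIntegral_iff_ofReal h0]
  rfl

lemma form_eq {p : Params} (hp : p.Admissible) (φ ψ : L2) :
    p.form φ ψ = ∫ z : ℝ × ℝ, inner ℂ (φ z.1 - φ z.2) (ψ z.1 - ψ z.2) ∂p.jump := by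
  rw [integral_jump hp, form, ← integral_smul]
  congr 1
  funext z
  rw [smul_smul, RCLike.inner_apply, mul_comm (ψ z.1 - ψ z.2)]

lemma ae_jump_sub (p : Params) {f g : ℝ → ℂ} (h : f =ᵐ[nu] g) :
    (fun z : ℝ × ℝ => f z.1 - f z.2) =ᵐ[p.jump] fun z => g z.1 - g z.2 :=
  p.jump_absolutelyContinuous.ae_le (ae_prod_sub h)

/-- The Hilbert space in which the form domain is a closed subspace. -/
abbrev Pair (p : Params) : Type := WithLp 2 (L2 × Lp ℂ 2 p.jump)

/-- The form domain, each element together with its differences. -/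
noncomputable def energy (p : Params) : Submodule ℂ p.Pair where
  carrier := {x | x.snd =ᵐ[p.jump] fun z => x.fst z.1 - x.fst z.2}
  zero_mem' := by
    have h1 : (0 : p.Pair).snd =ᵐ[p.jump] 0 := Lp.coeFn_zero ..
    have h2 := p.ae_jump_sub (Lp.coeFn_zero ℂ 2 nu)
    change (0 : p.Pair).snd =ᵐ[p.jump] fun z => (0 : L2) z.1 - (0 : L2) z.2
    filter_upwards [h1, h2] with z e1 e2
    rw [e1, e2]; simp
  add_mem' := by
    intro x y hx hy
    have h1 : (x + y).snd =ᵐ[p.jump] x.snd + y.snd := Lp.coeFn_add _ _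
    have h2 := p.ae_jump_sub (Lp.coeFn_add x.fst y.fst)
    change (x + y).snd =ᵐ[p.jump] fun z => (x.fst + y.fst) z.1 - (x.fst + y.fst) z.2
    filter_upwards [h1, h2, hx, hy] with z e1 e2 e3 e4
    rw [e1, e2, Pi.add_apply, Pi.add_apply, Pi.add_apply, e3, e4]; ring
  smul_mem' := by
    intro c x hx
    have h1 : (c • x).snd =ᵐ[p.jump] c • x.snd := Lp.coeFn_smul _ _
    have h2 := p.ae_jump_sub (Lp.coeFn_smul c x.fst)
    change (c • x).snd =ᵐ[p.jump] fun z => (c • x.fst) z.1 - (c • x.fst) z.2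
    filter_upwards [h1, h2, hx] with z e1 e2 e3
    rw [e1, e2, Pi.smul_apply, Pi.smul_apply, Pi.smul_apply, e3, smul_sub]

/-- This is the closedness of the form. Along a common subsequence both components converge almost
everywhere, and `jump` is absolutely continuous with respect to $\nu\otimes\nu$, so the relation
between them survives. -/
lemma isClosed_energy (p : Params) : IsClosed (p.energy : Set p.Pair) := by
  refine IsSeqClosed.isClosed fun x y hx hxy => ?_
  have c1 : Continuous fun x : p.Pair => x.fst :=
    continuous_fst.comp (WithLp.prodContinuousLinearEquiv 2 ℂ L2 (Lp ℂ 2 p.jump)).continuous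
  have c2 : Continuous fun x : p.Pair => x.snd :=
    continuous_snd.comp (WithLp.prodContinuousLinearEquiv 2 ℂ L2 (Lp ℂ 2 p.jump)).continuous
  have t1 : Tendsto (fun n => (x n).fst) atTop (𝓝 y.fst) := (c1.tendsto y).comp hxy
  have t2 : Tendsto (fun n => (x n).snd) atTop (𝓝 y.snd) := (c2.tendsto y).comp hxy
  obtain ⟨ns, hns, h1⟩ := (tendstoInMeasure_of_tendsto_Lp t1).exists_seq_tendsto_ae
  obtain ⟨ms, hms, h2⟩ := (tendstoInMeasure_of_tendsto_Lp
    (t2.comp hns.tendsto_atTop)).exists_seq_tendsto_ae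
  have h3 : ∀ᵐ z ∂p.jump, ∀ n, (x n).snd z = (x n).fst z.1 - (x n).fst z.2 := ae_all_iff.2 hx
  have q1 := p.jump_absolutelyContinuous.ae_le (Measure.quasiMeasurePreserving_fst.ae h1)
  have q2 := p.jump_absolutelyContinuous.ae_le (Measure.quasiMeasurePreserving_snd.ae h1)
  change y.snd =ᵐ[p.jump] fun z => y.fst z.1 - y.fst z.2
  filter_upwards [h2, h3, q1, q2] with z e2 e3 e4 e5
  refine tendsto_nhds_unique e2 (((e4.sub e5).comp hms.tendsto_atTop).congr fun n => ?_)
  exact (e3 _).symm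

instance completeSpace_energy (p : Params) : CompleteSpace p.energy :=
  (isClosed_energy p).completeSpace_coe

lemma mem_formDomain_of_mem_energy {p : Params} (hp : p.Admissible) {x : p.Pair}
    (hx : x ∈ p.energy) : x.fst ∈ p.formDomain :=
  (mem_formDomain_iff hp).2 ((memLp_congr_ae hx).1 (Lp.memLp _))

/-- An element of the form domain, together with its differences. -/
noncomputable def lift {p : Params} (hp : p.Admissible) {ψ : L2} (h : ψ ∈ p.formDomain) : p.Pair :=
  WithLp.toLp 2 (ψ, ((mem_formDomain_iff hp).1 h).toLp _)

lemma lift_mem {p : Params} (hp : p.Admissible) {ψ : L2} (h : ψ ∈ p.formDomain) :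
    lift hp h ∈ p.energy := ((mem_formDomain_iff hp).1 h).coeFn_toLp

lemma form_eq_inner {p : Params} (hp : p.Admissible) {x y : p.Pair} (hx : x ∈ p.energy)
    (hy : y ∈ p.energy) : p.form x.fst y.fst = inner ℂ x.snd y.snd := by
  rw [form_eq hp, L2.inner_def]
  refine integral_congr_ae ?_
  filter_upwards [hx, hy] with z h1 h2
  rw [h1, h2]

/-! ### The resolvent as a compressed orthogonal projection. -/

/-- The inclusion of `L²(ν)`. -/
noncomputable def incl (p : Params) : L2 →L[ℂ] p.Pair :=
  ((WithLp.prodContinuousLinearEquiv 2 ℂ L2 (Lp ℂ 2 p.jump)).symm : L2 × Lp ℂ 2 p.jump →L[ℂ] p.Pair)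
    ∘L ContinuousLinearMap.inl ℂ L2 (Lp ℂ 2 p.jump)

/-- The projection to `L²(ν)`. -/
noncomputable def proj (p : Params) : p.Pair →L[ℂ] L2 :=
  ContinuousLinearMap.fst ℂ L2 (Lp ℂ 2 p.jump) ∘L
    (WithLp.prodContinuousLinearEquiv 2 ℂ L2 (Lp ℂ 2 p.jump) : p.Pair →L[ℂ] L2 × Lp ℂ 2 p.jump)

lemma incl_fst (p : Params) (ψ : L2) : (p.incl ψ).fst = ψ := rfl

lemma incl_snd (p : Params) (ψ : L2) : (p.incl ψ).snd = 0 := rfl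

lemma inner_incl (p : Params) (x : p.Pair) (ψ : L2) :
    inner ℂ x (p.incl ψ) = inner ℂ x.fst ψ := by
  rw [WithLp.prod_inner_apply]
  change inner ℂ x.fst ψ + inner ℂ x.snd 0 = _
  rw [inner_zero_right, add_zero]

lemma norm_fst_le (p : Params) (x : p.Pair) : ‖x.fst‖ ≤ ‖x‖ := by
  have h := WithLp.prod_norm_sq_eq_of_L2 x
  exact le_of_sq_le_sq (by nlinarith [sq_nonneg ‖x.snd‖]) (norm_nonneg x)

lemma norm_incl (p : Params) (ψ : L2) : ‖p.incl ψ‖ = ‖ψ‖ := by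
  have h := WithLp.prod_norm_sq_eq_of_L2 (p.incl ψ)
  rw [incl_fst, incl_snd, norm_zero] at h
  exact (sq_eq_sq₀ (norm_nonneg _) (norm_nonneg _)).1 (by linarith)

/-- The resolvent `(1 + L)⁻¹` of the operator `L` associated with the form. -/
noncomputable def resolvent (p : Params) : L2 →L[ℂ] L2 :=
  p.proj ∘L p.energy.starProjection ∘L p.incl

lemma resolvent_apply (p : Params) (ψ : L2) :
    p.resolvent ψ = (p.energy.starProjection (p.incl ψ)).fst := rfl

lemma inner_resolvent (p : Params) (φ ψ : L2) : inner ℂ (p.resolvent φ) ψ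
    = inner ℂ (p.energy.starProjection (p.incl φ)) (p.incl ψ) := by
  rw [inner_incl, resolvent_apply]

/-- The inclusion and the projection to the first component are adjoint, so this is the compression
of an orthogonal projection. -/
lemma isPositive_resolvent (p : Params) : p.resolvent.IsPositive := by
  constructor
  · intro φ ψ
    change inner ℂ (p.resolvent φ) ψ = inner ℂ φ (p.resolvent ψ)
    rw [inner_resolvent, Submodule.inner_starProjection_left_eq_right, ← inner_conj_symm,
      ← inner_resolvent, inner_conj_symm]
  · intro φ
    rw [ContinuousLinearMap.reApplyInnerSelf_apply, inner_resolvent]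
    exact Submodule.re_inner_starProjection_nonneg _ _

lemma norm_resolvent_le (p : Params) : ‖p.resolvent‖ ≤ 1 := by
  refine ContinuousLinearMap.opNorm_le_bound _ zero_le_one fun ψ => ?_
  rw [resolvent_apply, one_mul, ← p.norm_incl ψ]
  exact (p.norm_fst_le _).trans (Submodule.norm_starProjection_apply_le _ _)

lemma lift_fst {p : Params} (hp : p.Admissible) {ψ : L2} (h : ψ ∈ p.formDomain) :
    (lift hp h).fst = ψ := rfl

lemma form_fst_lift {p : Params} (hp : p.Admissible) {x : p.Pair} (hx : x ∈ p.energy) {ψ : L2}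
    (h : ψ ∈ p.formDomain) : p.form x.fst ψ = inner ℂ x.snd (lift hp h).snd := by
  rw [← form_eq_inner hp hx (lift_mem hp h), lift_fst]

lemma form_lift_fst {p : Params} (hp : p.Admissible) {x : p.Pair} (hx : x ∈ p.energy) {ψ : L2}
    (h : ψ ∈ p.formDomain) : p.form ψ x.fst = inner ℂ (lift hp h).snd x.snd := by
  rw [← form_eq_inner hp (lift_mem hp h) hx, lift_fst]

lemma inner_pair (p : Params) (x y : p.Pair) :
    inner ℂ x y = inner ℂ x.fst y.fst + inner ℂ x.snd y.snd := WithLp.prod_inner_apply _ _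

lemma form_zero_right {p : Params} (hp : p.Admissible) (φ : L2) : p.form φ 0 = 0 := by
  rw [form_eq hp]
  refine integral_eq_zero_of_ae ?_
  filter_upwards [p.ae_jump_sub (Lp.coeFn_zero ℂ 2 nu)] with z hz
  rw [hz]
  simp

lemma inner_lift {p : Params} (hp : p.Admissible) {x : p.Pair} (hx : x ∈ p.energy) {ψ : L2}
    (h : ψ ∈ p.formDomain) : inner ℂ x (lift hp h) = inner ℂ x.fst ψ + p.form x.fst ψ := by
  rw [inner_pair, lift_fst, form_fst_lift hp hx h]

/-- On the form domain the inner product of the pair space is $(\varphi,\psi)+\tilde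
Q_\varepsilon(\varphi,\psi)$. Hence $(\varphi,\eta)=\tilde Q_\varepsilon(\varphi,\psi)$ for all
$\varphi$ says that $(\psi+\eta,0)$ minus the lift of $\psi$ is orthogonal to `energy`, that is, the
lift is the projection. -/
lemma mem_graphL3_iff {p : Params} (hp : p.Admissible) (ψ η : L2) :
    (ψ, η) ∈ p.graphL3 ↔ p.resolvent (ψ + η) = ψ := by
  have key : ∀ (z x : p.Pair), inner ℂ (p.incl (ψ + η) - z) x = 0 ↔
      inner ℂ x.fst (ψ + η) - inner ℂ x z = 0 := fun z x => by
    rw [← inner_conj_symm, map_eq_zero, inner_sub_right, inner_incl]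
  constructor
  · rintro ⟨hψ, h⟩
    have e : p.energy.starProjection (p.incl (ψ + η)) = lift hp hψ := by
      refine Submodule.eq_starProjection_of_mem_of_inner_eq_zero (lift_mem hp hψ) fun x hx => ?_
      rw [key, inner_lift hp hx hψ, inner_add_right, h _ (mem_formDomain_of_mem_energy hp hx)]
      exact sub_self _
    rw [resolvent_apply, e]
    rfl
  · intro h
    obtain ⟨x, hx⟩ : ∃ x, x = p.energy.starProjection (p.incl (ψ + η)) := ⟨_, rfl⟩
    have hxm : x ∈ p.energy := hx ▸ Submodule.starProjection_apply_mem _ _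
    have hx1 : x.fst = ψ := by rw [hx]; exact h
    refine ⟨hx1 ▸ mem_formDomain_of_mem_energy hp hxm, fun φ hφ => ?_⟩
    have h1 := Submodule.starProjection_inner_eq_zero (K := p.energy) (p.incl (ψ + η)) _
      (lift_mem hp hφ)
    have h2 := form_lift_fst hp hxm hφ
    have h3 : inner ℂ (lift hp hφ) x = inner ℂ φ ψ + p.form φ ψ := by
      rw [inner_pair, ← h2, hx1, lift_fst]
    have h4 : inner ℂ φ (ψ + η) - inner ℂ (lift hp hφ) x = 0 := by
      rw [← hx] at h1
      exact (key x (lift hp hφ)).1 h1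
    rw [h3, inner_add_right] at h4
    change inner ℂ φ η = p.form φ ψ
    linear_combination h4

/-- Bounded continuous functions are dense in $L^2$ of the finite measure $\nu$, and $G\ge1$ makes
them admissible in `mem_graphL3`. -/
lemma dense_formDomain {p : Params} (hp : p.Admissible) : Dense p.formDomain := by
  have := isFiniteMeasure_nu hp
  have h := BoundedContinuousFunction.toLp_denseRange ℂ nu (p := 2) ℂ (by norm_num)
  refine h.mono ?_
  rintro _ ⟨f, rfl⟩
  have hb : ∀ v, ‖f v‖ ≤ ‖f‖ * p.G v := fun v =>
    (f.norm_coe_le_norm v).trans (le_mul_of_one_le_right (norm_nonneg f) (one_le_G hp v))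
  have h1 : MemLp f 2 nu := memLp_of_le_G hp f.continuous (norm_nonneg f) hb
  obtain ⟨C, hC, hg⟩ := exists_gen_le hp
  have h2 : MemLp (p.gen f) 2 nu :=
    memLp_of_le hp (continuous_gen hp f.continuous (norm_nonneg f) hb).aestronglyMeasurable
      fun v => (hg f _ (norm_nonneg f) hb v).2
  exact (mem_graphL3 hp f.continuous (norm_nonneg f) hb h1 h2).1

/-- A vector of the kernel is orthogonal to the whole form domain, which is dense. -/
lemma resolvent_injective {p : Params} (hp : p.Admissible) (ψ : L2) (h : p.resolvent ψ = 0) :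
    ψ = 0 := by
  have h1 : ((0 : L2), ψ) ∈ p.graphL3 := by rw [mem_graphL3_iff hp, zero_add, h]
  refine (dense_formDomain hp).eq_zero_of_inner_right ℂ fun φ hφ => ?_
  exact (h1.2 φ hφ).trans (form_zero_right hp φ)

lemma re_inner_nonneg_of_mem_graphL3 {p : Params} (hp : p.Admissible) {ψ η : L2}
    (h : (ψ, η) ∈ p.graphL3) : 0 ≤ (inner ℂ ψ η).re := by
  have h1 : inner ℂ ψ η = p.form ψ ψ := h.2 ψ h.1
  have h2 := form_fst_lift hp (lift_mem hp h.1) h.1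
  rw [lift_fst] at h2
  rw [h1, h2]
  exact inner_self_nonneg (𝕜 := ℂ)

lemma sub_mem_graphL3 {p : Params} (hp : p.Admissible) {ψ η ψ' η' : L2} (h : (ψ, η) ∈ p.graphL3)
    (h' : (ψ', η') ∈ p.graphL3) : (ψ - ψ', η - η') ∈ p.graphL3 := by
  have h1 := (mem_graphL3_iff hp ψ η).1 h
  have h2 := (mem_graphL3_iff hp ψ' η').1 h'
  rw [mem_graphL3_iff hp, show ψ - ψ' + (η - η') = (ψ + η) - (ψ' + η') by abel, map_sub, h1, h2]

/-- The operator associated with the form generates a contraction semigroup. -/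
theorem exists_isSemigroupOf {p : Params} (hp : p.Admissible) :
    ∃ S : ℝ → L2 →L[ℂ] L2, IsSemigroupOf p.graphL3 S := by
  have hR := p.isPositive_resolvent
  have hR1 := p.norm_resolvent_le
  have hinj := resolvent_injective hp
  refine ⟨resolventSemigroup p.resolvent, resolventSemigroup_zero hR,
    fun s t hs ht => resolventSemigroup_add hR hR1 hs ht,
    continuousOn_resolventSemigroup hR hR1 hinj,
    fun t ht => norm_resolventSemigroup_le hR hR1 ht, fun ψ η => ?_⟩
  rw [mem_graphL3_iff hp, resolventSemigroup_generator hR hR1 hinj]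
  have h : ∀ (h : ℝ) (x : L2), ((h : ℝ) : ℂ) • x = h • x := fun h x =>
    algebraMap_smul ℂ h x
  simp only [h]

/-! ### Identification of the Duhamel solution with the semigroup -/

/-- Pull $e^{-tV(v)}$ out of the time integral at fixed $v$; the rest is differentiable by the
fundamental theorem of calculus. -/
lemma hasDerivWithinAt_fixedPoint {p : Params} (hp : p.Admissible) {ψ₀ : ℝ → ℂ} {ψ : ℝ → ℝ → ℂ}
    (hc : Continuous fun x : ℝ × ℝ => ψ x.1 x.2) {M : ℝ} (hM : 0 ≤ M)
    (hb : ∀ t v, ‖ψ t v‖ ≤ M * p.G v) (he : ∀ t, 0 ≤ t → ∀ v, ψ t v = p.duhamel ψ₀ ψ t v)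
    {t : ℝ} (ht : 0 ≤ t) (v : ℝ) :
    HasDerivWithinAt (fun s => ψ s v) (-p.gen (ψ t) v) (Ici t) t := by
  have hk : Continuous fun s => Real.exp (s * p.V v) • p.Kop (ψ s) v := by
    have h1 := (continuous_Kop hp hc hM hb).comp (by fun_prop : Continuous fun s : ℝ => (s, v))
    have h2 : Continuous fun s : ℝ => Real.exp (s * p.V v) := by fun_prop
    exact h2.smul h1
  have hd1 : HasDerivAt (fun s => ψ₀ v + ∫ r in (0 : ℝ)..s, Real.exp (r * p.V v) • p.Kop (ψ r) v)
      (Real.exp (t * p.V v) • p.Kop (ψ t) v) t :=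
    (hk.integral_hasStrictDerivAt 0 t).hasDerivAt.const_add _
  have hd2 : HasDerivAt (fun s => Real.exp (-s * p.V v)) (Real.exp (-t * p.V v) * (-1 * p.V v)) t :=
    (((hasDerivAt_id t).neg).mul_const _).exp
  have heq : ∀ s, 0 ≤ s → ψ s v = Real.exp (-s * p.V v) •
      (ψ₀ v + ∫ r in (0 : ℝ)..s, Real.exp (r * p.V v) • p.Kop (ψ r) v) := by
    intro s hs
    rw [he s hs v, duhamel, smul_add, ← intervalIntegral.integral_smul]
    congr 2
    funext r
    rw [smul_smul, ← Real.exp_add]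
    congr 2; ring
  have hd := (hd2.smul hd1).hasDerivWithinAt (s := Ici t)
  refine (hd.congr_of_mem (fun s hs => heq s (ht.trans hs)) self_mem_Ici).congr_deriv ?_
  have h3 : Real.exp (-t * p.V v) • (Real.exp (t * p.V v) • p.Kop (ψ t) v) = p.Kop (ψ t) v := by
    rw [smul_smul, ← Real.exp_add]; simp
  rw [h3, gen, heq t ht, smul_smul, neg_sub, sub_eq_add_neg, ← neg_smul]
  congr 2
  ring

/-- The mean value inequality at fixed $v$ supplies the majorant of the difference quotients for
their convergence in $L^2(\nu)$. -/
lemma norm_sub_le_of_fixedPoint {p : Params} (hp : p.Admissible) {ψ₀ : ℝ → ℂ} {ψ : ℝ → ℝ → ℂ}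
    (hc : Continuous fun x : ℝ × ℝ => ψ x.1 x.2) {M : ℝ} (hM : 0 ≤ M)
    (hb : ∀ t v, ‖ψ t v‖ ≤ M * p.G v) (he : ∀ t, 0 ≤ t → ∀ v, ψ t v = p.duhamel ψ₀ ψ t v)
    {B : ℝ → ℝ} (hB : ∀ t v, ‖p.gen (ψ t) v‖ ≤ B v) {t s : ℝ} (ht : 0 ≤ t) (hs : t ≤ s) (v : ℝ) :
    ‖ψ s v - ψ t v‖ ≤ B v * (s - t) := by
  refine norm_image_sub_le_of_norm_deriv_right_le_segment (f := fun s => ψ s v)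
    (f' := fun s => -p.gen (ψ s) v) ?_ (fun r hr =>
      hasDerivWithinAt_fixedPoint hp hc hM hb he (ht.trans hr.1) v) (fun r _ => ?_) s
      (right_mem_Icc.2 hs)
  · exact (hc.comp (by fun_prop : Continuous fun s : ℝ => (s, v))).continuousOn
  · rw [norm_neg]; exact hB r v

lemma tendsto_toLp_of_dominated {ι : Type*} {l : Filter ι} [l.IsCountablyGenerated] [l.NeBot]
    {F : ι → ℝ → ℂ} {f : ℝ → ℂ} (hF : ∀ i, MemLp (F i) 2 nu) (hf : MemLp f 2 nu) {B : ℝ → ℝ}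
    (hB : MemLp B 2 nu) (hb : ∀ᶠ i in l, ∀ v, ‖F i v‖ ≤ B v)
    (ht : ∀ v, Tendsto (fun i => F i v) l (𝓝 (f v))) :
    Tendsto (fun i => (hF i).toLp (F i)) l (𝓝 (hf.toLp f)) := by
  rw [Lp.tendsto_Lp_iff_tendsto_eLpNorm'']
  have hfB : ∀ v, ‖f v‖ ≤ B v := fun v =>
    le_of_tendsto (ht v).norm (hb.mono fun i hi => hi v)
  have hint : Integrable (fun v => (2 * B v) ^ 2) nu := (hB.const_mul 2).integrable_sq
  have h1 : Tendsto (fun i => ∫⁻ v, ‖F i v - f v‖ₑ ^ (2 : ℝ) ∂nu) l (𝓝 (∫⁻ _, 0 ∂nu)) := by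
    refine tendsto_lintegral_filter_of_dominated_convergence' (fun v => ENNReal.ofReal ((2 * B v) ^ 2))
      (Eventually.of_forall fun i => ((hF i).1.sub hf.1).enorm.pow_const _) ?_ ?_ ?_
    · filter_upwards [hb] with i hi
      refine ae_of_all _ fun v => ?_
      have h2 : ‖F i v - f v‖ ≤ 2 * B v := (norm_sub_le _ _).trans (by linarith [hi v, hfB v])
      rw [← ofReal_norm, ENNReal.ofReal_rpow_of_nonneg (norm_nonneg _) (by norm_num)]
      refine ENNReal.ofReal_le_ofReal ?_
      rw [Real.rpow_two]
      gcongr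
    · exact hint.lintegral_lt_top.ne
    · refine ae_of_all _ fun v => ?_
      have h3 : Tendsto (fun i => F i v - f v) l (𝓝 0) := tendsto_sub_nhds_zero_iff.2 (ht v)
      have h4 := (continuous_enorm.tendsto _).comp h3
      rw [enorm_zero] at h4
      have h5 := ((ENNReal.continuous_rpow_const (y := (2 : ℝ))).tendsto _).comp h4
      rwa [ENNReal.zero_rpow_of_pos (by norm_num)] at h5
  rw [lintegral_zero] at h1
  have h6 := ((ENNReal.continuous_rpow_const (y := (1 / 2 : ℝ))).tendsto _).comp h1
  rw [ENNReal.zero_rpow_of_pos (by norm_num)] at h6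
  refine h6.congr fun i => ?_
  rw [eLpNorm_eq_lintegral_rpow_enorm_toReal (by norm_num) (by norm_num)]
  simp

/-- $S_t$ commutes with the difference quotients at time $0$, so it preserves the graph. Right
derivatives suffice below and avoid any argument about times before $t$. -/
lemma IsSemigroupOf.hasDerivWithinAt {A : Set (L2 × L2)} {S : ℝ → L2 →L[ℂ] L2}
    (hS : IsSemigroupOf A S) {x y : L2} (hxy : (x, y) ∈ A) {t : ℝ} (ht : 0 ≤ t) :
    (S t x, S t y) ∈ A ∧ HasDerivWithinAt (fun s => S s x) (-S t y) (Ici t) t := by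
  have h1 := ((S t).continuous.tendsto _).comp ((hS.generator x y).1 hxy)
  have h2 : Tendsto (fun h : ℝ => h⁻¹ • (S h (S t x) - S t x)) (𝓝[>] 0) (𝓝 (-S t y)) := by
    rw [map_neg] at h1
    refine h1.congr' ?_
    filter_upwards [self_mem_nhdsWithin] with h hh
    have h3 : S t (S h x) = S h (S t x) := by
      have e1 := hS.add t h ht (le_of_lt hh)
      have e2 := hS.add h t (le_of_lt hh) ht
      rw [add_comm, e2] at e1
      exact (DFunLike.congr_fun e1 x).symm
    rw [Function.comp_apply, ← h3, ← map_sub]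
    exact (S t).map_smul_of_tower _ _
  refine ⟨(hS.generator _ _).2 h2, ?_⟩
  rw [← hasDerivWithinAt_Ioi_iff_Ici, hasDerivWithinAt_iff_tendsto_slope' (by simp)]
  have h4 : Tendsto (fun s : ℝ => s - t) (𝓝[>] t) (𝓝[>] 0) := by
    refine tendsto_nhdsWithin_iff.2 ⟨?_, ?_⟩
    · have h5 : Continuous fun s : ℝ => s - t := by fun_prop
      have := h5.tendsto t
      rw [sub_self] at this
      exact this.mono_left nhdsWithin_le_nhds
    · filter_upwards [self_mem_nhdsWithin] with s hs
      exact sub_pos.2 (mem_Ioi.1 hs)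
  refine (h2.comp h4).congr' ?_
  filter_upwards [self_mem_nhdsWithin] with s hs
  have e := hS.add (s - t) t (sub_nonneg.2 (le_of_lt hs)) ht
  rw [sub_add_cancel] at e
  rw [Function.comp_apply, slope_def_module, e]
  rfl

/-- Two curves with the same initial value whose difference is dissipated agree. -/
lemma eq_zero_of_dissipative {d e : ℝ → L2} {T : ℝ} (hT : 0 ≤ T) (h0 : d 0 = 0)
    (hd : ContinuousOn d (Icc 0 T))
    (hd' : ∀ t ∈ Ico 0 T, HasDerivWithinAt d (-e t) (Ici t) t)
    (hdis : ∀ t ∈ Ico 0 T, 0 ≤ (inner ℂ (d t) (e t)).re) : d T = 0 := by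
  have hsq : ∀ x : L2, (inner ℂ x x).re = ‖x‖ ^ 2 := fun x => inner_self_eq_norm_sq (𝕜 := ℂ) x
  have hder : ∀ t ∈ Ico 0 T, HasDerivWithinAt (fun s => (inner ℂ (d s) (d s)).re)
      (-2 * (inner ℂ (d t) (e t)).re) (Ici t) t := by
    intro t ht
    have h1 := (hd' t ht).inner ℂ (hd' t ht)
    have h2 := Complex.reCLM.hasFDerivAt.comp_hasDerivWithinAt t h1
    refine h2.congr_deriv ?_
    rw [Complex.reCLM_apply, Complex.add_re, inner_neg_left, inner_neg_right, Complex.neg_re,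
      Complex.neg_re]
    have h3 : (inner ℂ (e t) (d t)).re = (inner ℂ (d t) (e t)).re := inner_re_symm (𝕜 := ℂ) _ _
    rw [h3]; ring
  have key := image_le_of_deriv_right_le_deriv_boundary (B := fun _ => 0) (B' := fun _ => 0)
    (Complex.continuous_re.comp_continuousOn (hd.inner (𝕜 := ℂ) hd)) hder (by simp [h0]) continuousOn_const
    (fun _ _ => hasDerivWithinAt_const _ _ _) (fun t ht => by linarith [hdis t ht])
    (right_mem_Icc.2 hT)
  simp only [Function.comp_apply] at key
  rw [hsq] at key
  have : ‖d T‖ = 0 := by nlinarith [norm_nonneg (d T)]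
  exact norm_eq_zero.1 this

/-- The fixed point of the Duhamel map is the orbit of the semigroup. -/
theorem ae_eq_semigroup {p : Params} (hp : p.Admissible) {ψ₀ : ℝ → ℂ} {ψ : ℝ → ℝ → ℂ}
    (hc : Continuous fun x : ℝ × ℝ => ψ x.1 x.2) {M : ℝ} (hM : 0 ≤ M)
    (hb : ∀ t v, ‖ψ t v‖ ≤ M * p.G v) (he : ∀ t, 0 ≤ t → ∀ v, ψ t v = p.duhamel ψ₀ ψ t v)
    (hL2 : MemLp ψ₀ 2 nu) {S : ℝ → L2 →L[ℂ] L2} (hS : IsSemigroupOf p.graphL3 S) {T : ℝ}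
    (hT : 0 ≤ T) : ψ T =ᵐ[nu] S T (hL2.toLp ψ₀) := by
  obtain ⟨C, hC, hg⟩ := exists_gen_le hp
  have hct : ∀ t, Continuous (ψ t) := fun t =>
    hc.comp (by fun_prop : Continuous fun v : ℝ => (t, v))
  have hcv : ∀ v, Continuous fun t => ψ t v := fun v =>
    hc.comp (by fun_prop : Continuous fun t : ℝ => (t, v))
  have hu : ∀ t, MemLp (ψ t) 2 nu := fun t => memLp_of_le_G hp (hct t) hM (hb t)
  have hB : ∀ t v, ‖p.gen (ψ t) v‖ ≤ M * C * (W v * p.G v) := fun t v => (hg _ M hM (hb t) v).2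
  have hη : ∀ t, MemLp (p.gen (ψ t)) 2 nu := fun t =>
    memLp_of_le hp (continuous_gen hp (hct t) hM (hb t)).aestronglyMeasurable (hB t)
  set u : ℝ → L2 := fun t => (hu t).toLp (ψ t) with hudef
  set η : ℝ → L2 := fun t => (hη t).toLp (p.gen (ψ t)) with hηdef
  have hgr : ∀ t, (u t, η t) ∈ p.graphL3 := fun t => mem_graphL3 hp (hct t) hM (hb t) (hu t) (hη t)
  have hψ0 : ψ 0 = ψ₀ := by
    funext v
    rw [he 0 le_rfl v, duhamel]
    simp
  have hu0 : u 0 = hL2.toLp ψ₀ := by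
    simp only [hudef, hψ0]
  have huc : Continuous u := continuous_iff_continuousAt.2 fun t =>
    tendsto_toLp_of_dominated hu (hu t) ((memLp_W_mul_G hp).const_mul M)
      (Eventually.of_forall fun s v => (hb s v).trans
        (mul_le_mul_of_nonneg_left (p.G_le_W_mul_G v) hM)) fun v => (hcv v).tendsto t
  have hud : ∀ t, 0 ≤ t → HasDerivWithinAt u (-η t) (Ici t) t := by
    intro t ht
    rw [← hasDerivWithinAt_Ioi_iff_Ici, hasDerivWithinAt_iff_tendsto_slope' (by simp)]
    have hF : ∀ s : ℝ, MemLp ((s - t)⁻¹ • (ψ s - ψ t)) 2 nu := fun s =>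
      ((hu s).sub (hu t)).const_smul _
    refine (tendsto_toLp_of_dominated (l := 𝓝[>] t) hF (hη t).neg
      ((memLp_W_mul_G hp).const_mul (M * C)) ?_ fun v => ?_).congr fun s => ?_
    · filter_upwards [self_mem_nhdsWithin] with s hs v
      have h1 := norm_sub_le_of_fixedPoint hp hc hM hb he hB ht (le_of_lt hs) v
      have h2 : 0 < s - t := sub_pos.2 hs
      rw [Pi.smul_apply, Pi.sub_apply, norm_smul, norm_inv, Real.norm_of_nonneg h2.le,
        inv_mul_le_iff₀ h2, mul_comm]
      exact h1
    · have h1 := hasDerivWithinAt_fixedPoint hp hc hM hb he ht v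
      rw [← hasDerivWithinAt_Ioi_iff_Ici, hasDerivWithinAt_iff_tendsto_slope' (by simp)] at h1
      exact h1
    · rw [slope_def_module]
      rfl
  have hw := fun t (ht : 0 ≤ t) => hS.hasDerivWithinAt (hgr 0) ht
  -- Both curves solve $u'=-L_3^\varepsilon u$ from the right. The graph is closed under differences
  -- and the form is nonnegative, so the norm of the difference cannot grow.
  have key := eq_zero_of_dissipative (d := fun t => u t - S t (u 0))
    (e := fun t => η t - S t (η 0)) hT (by simp [hS.zero])
    (huc.continuousOn.sub ((hS.continuousOn (u 0)).mono Icc_subset_Ici_self))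
    (fun t ht => ((hud t ht.1).sub (hw t ht.1).2).congr_deriv (by abel))
    (fun t ht => re_inner_nonneg_of_mem_graphL3 hp (sub_mem_graphL3 hp (hgr t) (hw t ht.1).1))
  have h1 : u T = S T (hL2.toLp ψ₀) := by rw [← hu0]; exact sub_eq_zero.1 key
  rw [← h1]
  exact (hu T).coeFn_toLp.symm

end Params

end RegularizedBose

theorem theorem3p11 (p : RegularizedBose.Params) (hp : p.Admissible)
    (ψ₀ : ℝ → ℂ) (hψ₀ : ψ₀ ∈ p.X) :
    ∃ ψ : ℝ → ℝ → ℂ,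
      (p.IsDuhamelSolution ψ₀ ψ ∧ p.normSup ψ < ⊤) ∧
      (∀ φ : ℝ → ℝ → ℂ, p.IsDuhamelSolution ψ₀ φ → p.normSup φ < ⊤ →
        ∀ t, 0 ≤ t → φ t = ψ t) ∧
      ∃ hL2 : MemLp ψ₀ 2 RegularizedBose.Params.nu,
        (∃ S : ℝ → RegularizedBose.Params.L2 →L[ℂ] RegularizedBose.Params.L2,
          RegularizedBose.Params.IsSemigroupOf p.graphL3 S) ∧
        ∀ S : ℝ → RegularizedBose.Params.L2 →L[ℂ] RegularizedBose.Params.L2,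
          RegularizedBose.Params.IsSemigroupOf p.graphL3 S →
          ∀ t, 0 ≤ t → ψ t =ᵐ[RegularizedBose.Params.nu] S t (hL2.toLp ψ₀) := by
  obtain ⟨ψ, hc, ⟨M, hM, hb⟩, he⟩ := RegularizedBose.Params.exists_duhamel_fixedPoint hp hψ₀
  have hsol := RegularizedBose.Params.isDuhamelSolution_of_fixedPoint hp hc hM hb he
  have hsup := (RegularizedBose.Params.normSup_lt_top_iff hp).2 ⟨M, hM, fun t _ => hb t⟩
  obtain ⟨h0c, M₀, hM₀, h0b⟩ := (RegularizedBose.Params.mem_X_iff hp).1 hψ₀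
  have hL2 := RegularizedBose.Params.memLp_of_le_G hp h0c hM₀ h0b
  exact ⟨ψ, ⟨hsol, hsup⟩,
    fun φ hφ hφb t ht => RegularizedBose.Params.IsDuhamelSolution.unique hp hsol hφ hsup hφb ht, hL2,
    -- The identification uses only the defining properties of the semigroup, so it holds for every
    -- such $S$ and not only for the one constructed.
    RegularizedBose.Params.exists_isSemigroupOf hp, fun S hS t ht =>
      RegularizedBose.Params.ae_eq_semigroup hp hc hM hb he hL2 hS ht⟩
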